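/- **Theorem 2.2 (Existence of slow solutions).** Let $H$ be a real Hilbert space with norm $|\cdot|$ and scalar product $\langle\cdot,\cdot\rangle$, and let $A$ be a self-adjoint nonnegative operator on $H$ with dense domain $D(A)$. Equip $D(A^{1/2})$ with the norm $|u|_{D(A^{1/2})}=(|u|^2+|A^{1/2}u|^2)^{1/2}$, let $R>0$, let $B_R=\{u\in D(A^{1/2}):|u|_{D(A^{1/2})}<R\}$, and let $f:B_R\to H$. Assume that 1. $\ker A\neq\{0\}$ and there is $\nu>0$ with $|Au|^2\ge\nu|A^{1/2}u|^2$ for all $u\in D(A)$; 2. there is a constant $L$ with $|f(u)-f(v)|\le L|u-v|_{D(A^{1/2})}$ for all $u,v\in B_R$; 3. there are $p>0$, $q>0$, $K_0\ge0$ with $|f(u)|\le K_0\left(|u|^{1+p}+|A^{1/2}u|^{1+q}\right)$ for all $u\in B_R$, and $\langle u,f(u)\rangle\le0$ for all $u\in B_R$. A solution on $[0,T]$ with initial datum $u_0$ is a function $u\in C^0([0,T],D(A^{1/2}))$ with values in $B_R$ and $u(0)=u_0$, such that $u\in W^{1,2}((0,T),H)\cap L^2((0,T),D(A))$, the function $t\mapsto|A^{1/2}u(t)|^2$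 is absolutely continuous in $[0,T]$, and for almost every $t\in(0,T)$ the derivative $u'(t)$ exists, $u(t)\in D(A)$ and $u'(t)+Au(t)=f(u(t))$. Then for every $K_1>0$ with $K_1\ge 4K_0^2(3+2p)/\nu$ there is $\sigma_0>0$ such that the set $$\mathcal S=\left\{u_0\in D(A^{1/2}):\ u_0\ne0,\ |u_0|<\sigma_0,\ |A^{1/2}u_0|^2<K_1|u_0|^{2+2p}\right\}$$ is nonempty, contained in $B_R$ and open in $D(A^{1/2})$, and has the following property. For every $u_0\in\mathcal S$ there is a global solution $u:[0,+\infty)\to B_R$ with initial datum $u_0$ (that is, a solution on $[0,T]$ for every $T>0$); it is unique, in the sense that every solution on an interval $[0,T]$ with initial datum $u_0$ coincides with $u$ on $[0,T]$; and it is slow: there is $M_1>0$ such that $$|u(t)|\ge\frac{M_1}{(1+t)^{1/p}}\qquad\forall t\ge0.$$ -/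

import Mathlib

open Set Filter Topology MeasureTheory
open scoped RealInnerProductSpace

namespace SlowSolutions

noncomputable section

/-- A (possibly unbounded) operator is nonnegative if `⟨A x, x⟩ ≥ 0` on its domain. -/
def IsNonneg {H : Type*} [NormedAddCommGroup H] [InnerProductSpace ℝ H]
    (A : H →ₗ.[ℝ] H) : Prop :=
  ∀ x : A.domain, 0 ≤ ⟪A x, (x : H)⟫

/-- `B` is a nonnegative self-adjoint square root of `A`: `B ∘ B = A` as unbounded operators, that
is, `x ∈ D(A)` with `A x = y` if and only if `x ∈ D(B)`, `B x ∈ D(B)` and `B (B x) = y`.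
(A self-adjoint operator in Mathlib's sense is automatically densely defined.) -/
structure IsNonnegSqrt {H : Type*} [NormedAddCommGroup H] [InnerProductSpace ℝ H] [CompleteSpace H]
    (A B : H →ₗ.[ℝ] H) : Prop where
  isSelfAdjoint : IsSelfAdjoint B
  isNonneg : IsNonneg B
  sq_eq : ∀ x y : H, (x, y) ∈ A.graph ↔ ∃ z : H, (x, z) ∈ B.graph ∧ (z, y) ∈ B.graph

open Classical in
/-- The operator `A^{1/2}`: the nonnegative self-adjoint square root of `A`, which exists and is
unique whenever `A` is self-adjoint and nonnegative (value `⊥` for operators that have none). -/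
def sqrtOp {H : Type*} [NormedAddCommGroup H] [InnerProductSpace ℝ H] [CompleteSpace H]
    (A : H →ₗ.[ℝ] H) : H →ₗ.[ℝ] H :=
  if h : ∃ B : H →ₗ.[ℝ] H, IsNonnegSqrt A B then h.choose else ⊥

/-- The space `D(A^{1/2})`. It carries the norm `(|u|² + |A^{1/2} u|²)^{1/2}`, see below. -/
def HalfDomain {H : Type*} [NormedAddCommGroup H] [InnerProductSpace ℝ H] [CompleteSpace H]
    (A : H →ₗ.[ℝ] H) : Type _ :=
  (sqrtOp A).domain

namespace HalfDomain

variable {H : Type*} [NormedAddCommGroup H] [InnerProductSpace ℝ H] [CompleteSpace H]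
  (A : H →ₗ.[ℝ] H)

instance instAddCommGroup : AddCommGroup (HalfDomain A) :=
  inferInstanceAs (AddCommGroup (sqrtOp A).domain)

instance instModule : Module ℝ (HalfDomain A) :=
  inferInstanceAs (Module ℝ (sqrtOp A).domain)

variable {A}

/-- The inclusion of `D(A^{1/2})` in `H`. -/
def val : HalfDomain A →ₗ[ℝ] H := (sqrtOp A).domain.subtype

/-- The map `u ↦ A^{1/2} u` on `D(A^{1/2})`. -/
def half : HalfDomain A →ₗ[ℝ] H := (sqrtOp A).toFun

theorem val_injective : Function.Injective (val : HalfDomain A → H) := Subtype.val_injective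

/-- The map `u ↦ (u, A^{1/2} u)` into the Hilbert space `H ⊕ H`. -/
def toGraph : HalfDomain A →ₗ[ℝ] WithLp 2 (H × H) :=
  (WithLp.linearEquiv 2 ℝ (H × H)).symm.toLinearMap ∘ₗ val.prod half

theorem toGraph_injective : Function.Injective (toGraph : HalfDomain A → WithLp 2 (H × H)) := by
  intro u v h
  have h' := (WithLp.linearEquiv 2 ℝ (H × H)).symm.injective h
  exact val_injective (congrArg Prod.fst h')

instance instNormedAddCommGroup : NormedAddCommGroup (HalfDomain A) :=
  NormedAddCommGroup.induced (HalfDomain A) (WithLp 2 (H × H)) toGraph toGraph_injective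

instance instNormedSpace : NormedSpace ℝ (HalfDomain A) :=
  NormedSpace.induced ℝ (HalfDomain A) (WithLp 2 (H × H)) toGraph

/-- The norm of `D(A^{1/2})`. -/
theorem norm_eq (u : HalfDomain A) : ‖u‖ = √(‖val u‖ ^ 2 + ‖half u‖ ^ 2) :=
  WithLp.prod_norm_eq_of_L2 (toGraph u)

end HalfDomain

open HalfDomain

/-- `u` is a solution on `[0, T]` of `u' + A u = f(u)`, `u(0) = u₀`, with values in the open ball
`B_R` of `D(A^{1/2})` (the set where `f` matters), with the regularity of strong solutions. -/
structure IsSolutionOn {H : Type*} [NormedAddCommGroup H] [InnerProductSpace ℝ H] [CompleteSpace H]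
    (A : H →ₗ.[ℝ] H) (R : ℝ) (f : HalfDomain A → H) (T : ℝ) (u₀ : HalfDomain A)
    (u : ℝ → HalfDomain A) : Prop where
  /-- `u(0) = u₀` -/
  initial : u 0 = u₀
  /-- `u(t) ∈ B_R` for all `t ∈ [0, T]` -/
  mem_ball : ∀ t ∈ Icc 0 T, u t ∈ Metric.ball (0 : HalfDomain A) R
  /-- `u ∈ C⁰([0, T], D(A^{1/2}))` -/
  continuousOn : ContinuousOn u (Icc 0 T)
  /-- `u ∈ W^{1,2}((0, T), H)`: `u` is a primitive of a function in `L²((0, T), H)` -/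
  sobolev : ∃ w : ℝ → H, MemLp w 2 (volume.restrict (Ioo 0 T)) ∧
    ∀ t ∈ Icc 0 T, val (u t) = val (u 0) + ∫ s in (0 : ℝ)..t, w s
  /-- `u ∈ L²((0, T), D(A))`: almost everywhere `u(t) ∈ D(A)`, and `A u ∈ L²((0, T), H)`
  (that `u ∈ L²((0, T), H)` follows from continuity) -/
  memLp_domain : ∃ a : ℝ → H, MemLp a 2 (volume.restrict (Ioo 0 T)) ∧
    ∀ᵐ t ∂(volume.restrict (Ioo 0 T)), (val (u t), a t) ∈ A.graph
  /-- `t ↦ |A^{1/2} u(t)|²` is absolutely continuous in `[0, T]` -/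
  absCont : AbsolutelyContinuousOnInterval (fun t => ‖half (u t)‖ ^ 2) 0 T
  /-- for almost every `t ∈ (0, T)`: `u'(t)` exists in `H`, `u(t) ∈ D(A)`, and
  `u'(t) + A u(t) = f(u(t))` -/
  equation : ∀ᵐ t ∂(volume.restrict (Ioo 0 T)), ∃ (x : A.domain) (u' : H),
    (x : H) = val (u t) ∧ HasDerivAt (fun s => val (u s)) u' t ∧ u' + A x = f (u t)

/-- The set of initial data `u₀ ∈ D(A^{1/2})` with `u₀ ≠ 0`, `|u₀| < σ₀` and
`|A^{1/2} u₀|² < K₁ |u₀|^{2+2p}`. -/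
def slowSet {H : Type*} [NormedAddCommGroup H] [InnerProductSpace ℝ H] [CompleteSpace H]
    (A : H →ₗ.[ℝ] H) (p σ₀ K₁ : ℝ) : Set (HalfDomain A) :=
  {v | v ≠ 0 ∧ ‖val v‖ < σ₀ ∧ ‖half v‖ ^ 2 < K₁ * ‖val v‖ ^ (2 + 2 * p)}

end

end SlowSolutions

/-! Heart of the proof. Where `|A^{1/2}u|² < K₁|u|^{2+2p}` and `|u|` is small, the kernel of `A`
dominates: `|A^{1/2}u|^{1+q} ≤ |u|^{1+p}`, hence `|f(u)| ≤ 2K₀|u|^{1+p}`, and `(|u|²)' = 2⟨u,f(u)⟩ -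
2|A^{1/2}u|²` is at least `-C(|u|²)^{1+p/2}`. This differential inequality forces `|u|` to decay no
faster than `t^{-1/p}`.

The region is forward invariant (`mem_slowSet_of_forall_lt`). The lower bound keeps `u` away from
`0`, and the sign condition makes `|u|` nonincreasing. Near the face `|A^{1/2}u|² = K₁|u|^{2+2p}`
the spectral gap yields dissipation `ν|A^{1/2}u|²`. The forcing contributes at most
`νK₁|u|^{2+2p}/3`, by the lower bound on `K₁`, and the variation of `K₁|u|^{2+2p}` at most the same
amount, by smallness of `σ₀`. So the solution is pushed inward (`dissipation_le_of_mem_slowSet`).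

Everything else is existence and uniqueness, built from resolvents and without a spectral theorem.
`A^{1/2}` is `Q P⁻¹`, where `P² = (1+A)⁻¹`, `Q² = 1 - (1+A)⁻¹`, and bounded roots come from a power
series. The linear problem `w' + Aw = g` is solved by Yosida approximation, in a weak sense tested
against resolvents (`IsWeakSol`). Regularization by `(1+A/(n+1))⁻²` then gives continuity in
`D(A^{1/2})`, an estimate for differences, and strong regularity (`IsWeakSol.exists_strong`).

The nonlinearity is composed with a radial retraction, which makes it globally Lipschitz on
`D(A^{1/2})`, and Picard iteration gives a global weak solution (`exists_global_weakSol`). By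
invariance the solution never meets the truncation, so it solves the original equation. Uniqueness
is an energy estimate in `H` (`IsSolutionOn.eqOn`). -/

namespace SlowSolutions

/-! ### The power series of `1 - √(1 - x)` in a Banach algebra. -/

section BinomialSeries

/-- The coefficients of the power series `1 - √(1 - x) = ∑ aₙ xⁿ⁺¹`. -/
noncomputable def sqrtCoeff (n : ℕ) : ℝ := (catalan n : ℝ) / (2 * 4 ^ n)

theorem sqrtCoeff_nonneg (n : ℕ) : 0 ≤ sqrtCoeff n := by
  unfold sqrtCoeff; positivity

/-- The series `y = 1 - √(1 - x)` solves `2y = x + y²`; on coefficients this is the Catalan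
recursion. -/
theorem two_mul_sqrtCoeff_succ (n : ℕ) :
    2 * sqrtCoeff (n + 1) =
      ∑ ij ∈ Finset.HasAntidiagonal.antidiagonal n, sqrtCoeff ij.1 * sqrtCoeff ij.2 := by
  unfold sqrtCoeff
  rw [catalan_succ']
  push_cast
  rw [Finset.sum_div, Finset.mul_sum]
  refine Finset.sum_congr rfl fun ij hij => ?_
  rw [← Finset.HasAntidiagonal.mem_antidiagonal.1 hij]
  field_simp
  ring

/-- The partial sums `s` satisfy `2 s_{n+1} ≤ 1 + s_n²`, so the bound `1` propagates. Summability up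
to the boundary `‖x‖ = 1` follows with no asymptotics of Catalan numbers. -/
theorem sum_sqrtCoeff_le_one (n : ℕ) : ∑ i ∈ Finset.range n, sqrtCoeff i ≤ 1 := by
  induction n with
  | zero => simp
  | succ n ih =>
    have h0 : 0 ≤ ∑ i ∈ Finset.range n, sqrtCoeff i :=
      Finset.sum_nonneg fun i _ => sqrtCoeff_nonneg i
    have h1 : 2 * ∑ i ∈ Finset.range n, sqrtCoeff (i + 1) ≤
        (∑ i ∈ Finset.range n, sqrtCoeff i) * ∑ i ∈ Finset.range n, sqrtCoeff i := by
      simp only [Finset.mul_sum _ _ (2 : ℝ), two_mul_sqrtCoeff_succ,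
        Finset.Nat.sum_antidiagonal_eq_sum_range_succ (fun i j => sqrtCoeff i * sqrtCoeff j)]
      rw [Finset.sum_range_diag_flip n fun i j => sqrtCoeff i * sqrtCoeff j, Finset.sum_mul]
      refine Finset.sum_le_sum fun i _ => ?_
      rw [← Finset.mul_sum]
      exact mul_le_mul_of_nonneg_left (Finset.sum_le_sum_of_subset_of_nonneg
        (Finset.range_subset_range.2 (Nat.sub_le n i)) fun j _ _ => sqrtCoeff_nonneg j)
        (sqrtCoeff_nonneg i)
    rw [Finset.sum_range_succ']
    have h2 : sqrtCoeff 0 = 1 / 2 := by simp [sqrtCoeff]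
    nlinarith

theorem summable_sqrtCoeff : Summable sqrtCoeff :=
  summable_of_sum_range_le sqrtCoeff_nonneg sum_sqrtCoeff_le_one

theorem tsum_sqrtCoeff_le_one : ∑' n, sqrtCoeff n ≤ 1 :=
  Real.tsum_le_of_sum_range_le sqrtCoeff_nonneg sum_sqrtCoeff_le_one

variable {R : Type*} [NormedRing R] [NormedAlgebra ℝ R]

/-- `1 - √(1 - x)`, defined by its power series. -/
noncomputable def sqrtDefect (x : R) : R := ∑' n, sqrtCoeff n • x ^ (n + 1)

theorem norm_sqrtCoeff_smul_pow_le {x : R} (hx : ‖x‖ ≤ 1) (n : ℕ) :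
    ‖sqrtCoeff n • x ^ (n + 1)‖ ≤ sqrtCoeff n := by
  rw [norm_smul, Real.norm_of_nonneg (sqrtCoeff_nonneg n)]
  exact mul_le_of_le_one_right (sqrtCoeff_nonneg n)
    ((norm_pow_le' x n.succ_pos).trans (pow_le_one₀ (norm_nonneg x) hx))

theorem summable_norm_sqrtDefect {x : R} (hx : ‖x‖ ≤ 1) :
    Summable fun n => ‖sqrtCoeff n • x ^ (n + 1)‖ :=
  summable_sqrtCoeff.of_nonneg_of_le (fun _ => norm_nonneg _) (norm_sqrtCoeff_smul_pow_le hx)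

theorem norm_sqrtDefect_le_one {x : R} (hx : ‖x‖ ≤ 1) : ‖sqrtDefect x‖ ≤ 1 :=
  (tsum_of_norm_bounded summable_sqrtCoeff.hasSum (norm_sqrtCoeff_smul_pow_le hx)).trans
    tsum_sqrtCoeff_le_one

variable [CompleteSpace R]

/-- The Cauchy product turns the coefficient recursion into `2U = x + U²`, whence `(1 - U)² = 1 -
x`. -/
theorem sqrtDefect_sq {x : R} (hx : ‖x‖ ≤ 1) :
    (1 - sqrtDefect x) * (1 - sqrtDefect x) = 1 - x := by
  have hs := (summable_norm_sqrtDefect hx).of_norm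
  have h1 : sqrtDefect x * sqrtDefect x =
      ∑' n, (2 * sqrtCoeff (n + 1)) • x ^ (n + 2) := by
    unfold sqrtDefect
    rw [tsum_mul_tsum_eq_tsum_sum_antidiagonal_of_summable_norm
      (summable_norm_sqrtDefect hx) (summable_norm_sqrtDefect hx)]
    refine tsum_congr fun n => ?_
    rw [two_mul_sqrtCoeff_succ, Finset.sum_smul]
    refine Finset.sum_congr rfl fun ij hij => ?_
    rw [smul_mul_smul_comm, ← pow_add, ← Finset.HasAntidiagonal.mem_antidiagonal.1 hij]
    congr 2
    ring
  have h2 : sqrtDefect x + sqrtDefect x = x + sqrtDefect x * sqrtDefect x := by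
    rw [h1, ← two_smul ℝ (sqrtDefect x), sqrtDefect, ← tsum_const_smul'' (2 : ℝ)]
    rw [(hs.const_smul (2 : ℝ)).tsum_eq_zero_add]
    simp [sqrtCoeff, smul_smul]
  have h3 : (1 - sqrtDefect x) * (1 - sqrtDefect x) =
      1 - (sqrtDefect x + sqrtDefect x) + sqrtDefect x * sqrtDefect x := by noncomm_ring
  rw [h3, h2]
  abel

theorem commute_sqrtDefect {x y : R} (hxy : Commute x y) (hy : ‖y‖ ≤ 1) :
    Commute x (sqrtDefect y) := by
  have hs := (summable_norm_sqrtDefect hy).of_norm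
  change x * sqrtDefect y = sqrtDefect y * x
  rw [sqrtDefect, ← hs.tsum_mul_left, ← hs.tsum_mul_right]
  exact tsum_congr fun n => ((hxy.pow_right (n + 1)).smul_right _)

omit [CompleteSpace R] in
theorem isSelfAdjoint_sqrtDefect [StarRing R] [ContinuousStar R] [StarModule ℝ R] {x : R}
    (hx : IsSelfAdjoint x) : IsSelfAdjoint (sqrtDefect x) := by
  change star (sqrtDefect x) = sqrtDefect x
  rw [sqrtDefect, tsum_star]
  refine tsum_congr fun n => ?_
  rw [star_smul, (hx.pow _).star_eq, star_trivial]

end BinomialSeries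

/-! ### Square roots of bounded self-adjoint operators. -/

section BoundedSqrt

variable {H : Type*} [NormedAddCommGroup H] [InnerProductSpace ℝ H] [CompleteSpace H]

omit [CompleteSpace H] in
theorem inner_one_sub_nonneg {U : H →L[ℝ] H} (hU : ‖U‖ ≤ 1) (x : H) :
    0 ≤ ⟪(1 - U) x, x⟫ := by
  have h1 : ⟪U x, x⟫ ≤ ‖x‖ * ‖x‖ :=
    (real_inner_le_norm _ _).trans (mul_le_mul_of_nonneg_right
      ((U.le_of_opNorm_le hU x).trans_eq (one_mul _)) (norm_nonneg _))
  simp only [sub_apply, one_apply_eq_self, inner_sub_left,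
    real_inner_self_eq_norm_mul_norm]
  linarith

/-- Commuting self-adjoint square roots of `J` and `1 - J`, whose product is nonnegative. -/
theorem exists_commuting_sqrt {J : H →L[ℝ] H} (hJ : IsSelfAdjoint J) (h1 : ‖J‖ ≤ 1)
    (h2 : ‖1 - J‖ ≤ 1) :
    ∃ P Q : H →L[ℝ] H, IsSelfAdjoint P ∧ IsSelfAdjoint Q ∧ (∀ x, 0 ≤ ⟪Q x, P x⟫) ∧
      P * P = J ∧ Q * Q = 1 - J ∧ Commute P Q := by
  have hc : Commute (sqrtDefect (1 - J)) (sqrtDefect J) :=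
    commute_sqrtDefect (commute_sqrtDefect ((Commute.one_right J).sub_right (.refl J)) h2).symm h1
  have hU := norm_sqrtDefect_le_one h2
  have hUs : IsSelfAdjoint (sqrtDefect (1 - J)) :=
    isSelfAdjoint_sqrtDefect ((IsSelfAdjoint.one _).sub hJ)
  set U := sqrtDefect (1 - J)
  set V := sqrtDefect J
  have hV : ∀ x, 0 ≤ ⟪(1 - V) x, x⟫ := inner_one_sub_nonneg (norm_sqrtDefect_le_one h1)
  -- A second root, `S² = 1 - U = P`. Since `S` is self-adjoint and commutes with `Q = 1 - V`, one
  -- gets `⟨Qx, Px⟩ = ⟨Q(Sx), Sx⟩ ≥ 0`.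
  have hS := sqrtDefect_sq hU
  have hSs : IsSelfAdjoint (1 - sqrtDefect U) :=
    (IsSelfAdjoint.one _).sub (isSelfAdjoint_sqrtDefect hUs)
  have hSV : Commute (1 - sqrtDefect U) (1 - V) :=
    (Commute.one_left _).sub_left ((Commute.one_right _).sub_right
      (commute_sqrtDefect hc.symm hU).symm)
  refine ⟨1 - U, 1 - V, (IsSelfAdjoint.one _).sub hUs,
    (IsSelfAdjoint.one _).sub (isSelfAdjoint_sqrtDefect hJ), fun x => ?_, ?_, sqrtDefect_sq h1, ?_⟩
  · rw [← hS]
    set S := 1 - sqrtDefect U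
    have h3 : ⟪(1 - V) x, (S * S) x⟫ = ⟪(1 - V) (S x), S x⟫ := by
      have h4 := ContinuousLinearMap.isSelfAdjoint_iff_isSymmetric.1 hSs ((1 - V) x) (S x)
      have h5 : S ((1 - V) x) = (1 - V) (S x) := DFunLike.congr_fun hSV.eq x
      rw [← h5]
      exact h4.symm
    rw [h3]
    exact hV _
  · rw [sqrtDefect_sq h2, sub_sub_cancel]
  · exact ((Commute.one_left _).sub_left ((Commute.one_right _).sub_right hc))

end BoundedSqrt

end SlowSolutions

namespace SlowSolutions

open HalfDomain

variable {H : Type*} [NormedAddCommGroup H] [InnerProductSpace ℝ H] [CompleteSpace H]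
  {A : H →ₗ.[ℝ] H}

/-- The graph of `A` is that of its adjoint. Arguing with pairs in the graph avoids carrying proofs
of domain membership. -/
theorem mem_graph_iff_of_isSelfAdjoint (hA : IsSelfAdjoint A) {x y : H} :
    (x, y) ∈ A.graph ↔ ∀ a b, (a, b) ∈ A.graph → ⟪b, x⟫ = ⟪a, y⟫ := by
  have h := LinearPMap.adjoint_graph_eq_graph_adjoint hA.dense_domain
  rw [LinearPMap.isSelfAdjoint_def.1 hA] at h
  conv_lhs => rw [h]
  simp [Submodule.mem_adjoint_iff, sub_eq_zero]

theorem inner_symm_of_mem_graph (hA : IsSelfAdjoint A) {x y a b : H} (h : (x, y) ∈ A.graph)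
    (h' : (a, b) ∈ A.graph) : ⟪b, x⟫ = ⟪a, y⟫ :=
  (mem_graph_iff_of_isSelfAdjoint hA).1 h a b h'

theorem inner_nonneg_of_mem_graph (hA : IsNonneg A) {x y : H} (h : (x, y) ∈ A.graph) :
    0 ≤ ⟪y, x⟫ := by
  obtain ⟨a, rfl, rfl⟩ := A.mem_graph_iff.1 h
  exact hA a

/-! ### Resolvents and Yosida approximations of a nonnegative self-adjoint operator. -/

section Resolvent

theorem norm_sq_add_le_of_mem_graph (hA : IsNonneg A) {l : ℝ} (hl : 0 < l) {y z : H}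
    (h : (y, z) ∈ A.graph) : ‖y‖ ^ 2 + ‖l • z‖ ^ 2 ≤ ‖y + l • z‖ ^ 2 := by
  have := mul_nonneg hl.le (inner_nonneg_of_mem_graph hA h)
  rw [norm_add_sq_real, inner_smul_right, real_inner_comm]
  linarith

/-- Nonnegativity makes `(y, z) ↦ y + l z` bounded below on the closed graph, so its range is
closed; self-adjointness makes the range dense. -/
theorem exists_resolvent (hA : IsSelfAdjoint A) (hA0 : IsNonneg A) {l : ℝ} (hl : 0 < l) (x : H) :
    ∃ y z, (y, z) ∈ A.graph ∧ y + l • z = x := by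
  let F : A.graph →L[ℝ] H :=
    (ContinuousLinearMap.fst ℝ H H + l • ContinuousLinearMap.snd ℝ H H).comp A.graph.subtypeL
  have hF : ∀ p : A.graph, F p = p.1.1 + l • p.1.2 := fun p => rfl
  have : CompleteSpace A.graph := hA.isClosed.completeSpace_coe
  have hanti : AntilipschitzWith (⟨1 + l⁻¹, by positivity⟩ : NNReal) F := by
    refine ContinuousLinearMap.antilipschitz_of_bound F fun p => ?_
    have h := norm_sq_add_le_of_mem_graph hA0 hl p.2
    rw [← hF] at h
    have h1 : ‖p.1.1‖ ≤ ‖F p‖ := by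
      refine le_of_sq_le_sq ?_ (norm_nonneg _)
      nlinarith [sq_nonneg ‖l • p.1.2‖]
    have h2 : ‖p.1.2‖ ≤ l⁻¹ * ‖F p‖ := by
      have h3 : ‖l • p.1.2‖ ≤ ‖F p‖ := by
        refine le_of_sq_le_sq ?_ (norm_nonneg _)
        nlinarith [sq_nonneg ‖p.1.1‖]
      rw [norm_smul, Real.norm_of_nonneg hl.le] at h3
      rwa [le_inv_mul_iff₀ hl]
    have h4 : ‖p‖ = max ‖p.1.1‖ ‖p.1.2‖ := rfl
    have h5 : 0 ≤ l⁻¹ * ‖F p‖ := by positivity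
    have h6 := norm_nonneg (F p)
    rw [h4]
    change _ ≤ (1 + l⁻¹) * ‖F p‖
    exact max_le (by linarith) (by linarith)
  have hclosed : IsClosed ((LinearMap.range F.toLinearMap : Submodule ℝ H) : Set H) :=
    hanti.isClosed_range F.uniformContinuous
  have hbot : (LinearMap.range F.toLinearMap)ᗮ = ⊥ := by
    rw [Submodule.eq_bot_iff]
    intro z hz
    have hz' : ∀ a b, (a, b) ∈ A.graph → ⟪a + l • b, z⟫ = 0 := fun a b hab =>
      (Submodule.mem_orthogonal _ _).1 hz _ ⟨⟨(a, b), hab⟩, rfl⟩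
    -- A vector `z` orthogonal to the range satisfies `A(l z) = -z`, and nonnegativity then reads
    -- `-l‖z‖² ≥ 0`.
    have h1 : (l • z, -z) ∈ A.graph := by
      rw [mem_graph_iff_of_isSelfAdjoint hA]
      intro a b hab
      have := hz' a b hab
      rw [inner_add_left, real_inner_smul_left] at this
      rw [inner_smul_right, inner_neg_right]
      linarith
    have h2 := inner_nonneg_of_mem_graph hA0 h1
    rw [inner_neg_left, inner_smul_right, real_inner_self_eq_norm_sq] at h2
    have h3 : ‖z‖ ^ 2 ≤ 0 := by nlinarith [sq_nonneg ‖z‖]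
    simpa using h3
  have htop := (Submodule.topologicalClosure_eq_top_iff).2 hbot
  rw [IsClosed.submodule_topologicalClosure_eq hclosed] at htop
  obtain ⟨p, hp⟩ : x ∈ LinearMap.range F.toLinearMap := htop ▸ Submodule.mem_top
  exact ⟨p.1.1, p.1.2, p.2, hp⟩

theorem eq_of_add_smul_eq (hA0 : IsNonneg A) {l : ℝ} (hl : 0 < l) {y z y' z' : H}
    (h : (y, z) ∈ A.graph) (h' : (y', z') ∈ A.graph) (heq : y + l • z = y' + l • z') : y = y' := by
  have h1 := norm_sq_add_le_of_mem_graph hA0 hl (A.graph.sub_mem h h')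
  have h2 : (y - y') + l • (z - z') = 0 := by
    rw [smul_sub, sub_add_sub_comm, heq, sub_self]
  simp only [h2, norm_zero] at h1
  have h3 : ‖y - y'‖ ^ 2 ≤ 0 := by nlinarith [sq_nonneg ‖l • (z - z')‖]
  simpa [sub_eq_zero] using h3

theorem exists_resolventCLM (hA : IsSelfAdjoint A) (hA0 : IsNonneg A) {l : ℝ} (hl : 0 < l) :
    ∃ J : H →L[ℝ] H, ∀ x, (J x, l⁻¹ • (x - J x)) ∈ A.graph := by
  choose j k hjk hsum using exists_resolvent hA hA0 hl
  let J : H →ₗ[ℝ] H :=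
    { toFun := j
      map_add' := fun x y => eq_of_add_smul_eq hA0 hl (hjk (x + y))
        (A.graph.add_mem (hjk x) (hjk y)) (by
          change _ = j x + j y + l • (k x + k y)
          rw [hsum, smul_add, add_add_add_comm, hsum, hsum])
      map_smul' := fun c x => eq_of_add_smul_eq hA0 hl (hjk (c • x))
        (A.graph.smul_mem c (hjk x)) (by
          change _ = c • j x + l • c • k x
          rw [hsum, smul_comm l, ← smul_add, hsum]) }
  refine ⟨J.mkContinuous 1 fun x => ?_, fun x => ?_⟩
  · have h := norm_sq_add_le_of_mem_graph hA0 hl (hjk x)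
    rw [hsum] at h
    rw [one_mul]
    refine le_of_sq_le_sq ?_ (norm_nonneg _)
    change ‖j x‖ ^ 2 ≤ _
    nlinarith [sq_nonneg ‖l • k x‖]
  · change (j x, l⁻¹ • (x - j x)) ∈ A.graph
    have : l⁻¹ • (x - j x) = k x := by
      nth_rw 1 [← hsum x]
      rw [add_sub_cancel_left, inv_smul_smul₀ hl.ne']
    rw [this]
    exact hjk x

open Classical in
/-- The resolvent `(1 + l A)⁻¹`. -/
noncomputable def res (A : H →ₗ.[ℝ] H) (l : ℝ) : H →L[ℝ] H :=
  if h : ∃ J : H →L[ℝ] H, ∀ x, (J x, l⁻¹ • (x - J x)) ∈ A.graph then h.choose else 0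

/-- The Yosida approximation `A (1 + l A)⁻¹`. -/
noncomputable def yosida (A : H →ₗ.[ℝ] H) (l : ℝ) : H →L[ℝ] H := l⁻¹ • (1 - res A l)

theorem yosida_apply (l : ℝ) (x : H) : yosida A l x = l⁻¹ • (x - res A l x) := rfl

variable (hA : IsSelfAdjoint A) (hA0 : IsNonneg A) {l : ℝ} (hl : 0 < l)
include hl

theorem res_add_smul_yosida (x : H) : res A l x + l • yosida A l x = x := by
  rw [yosida_apply, smul_inv_smul₀ hl.ne', add_sub_cancel]

include hA hA0

theorem res_mem_graph (x : H) : (res A l x, yosida A l x) ∈ A.graph := by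
  have h := exists_resolventCLM hA hA0 hl
  rw [yosida_apply, res, dif_pos h]
  exact h.choose_spec x

theorem res_eq_of_mem_graph {y z : H} (h : (y, z) ∈ A.graph) : res A l (y + l • z) = y :=
  eq_of_add_smul_eq hA0 hl (res_mem_graph hA hA0 hl _) h (res_add_smul_yosida hl _)

theorem yosida_eq_res_of_mem_graph {y z : H} (h : (y, z) ∈ A.graph) :
    yosida A l y = res A l z := by
  have h1 := res_eq_of_mem_graph hA hA0 hl h
  have h2 : y - res A l y = l • res A l z := by
    nth_rw 1 [← h1]
    rw [map_add, map_smul, add_sub_cancel_left]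
  rw [yosida_apply, h2, inv_smul_smul₀ hl.ne']

theorem res_map_mem_graph {y z : H} (h : (y, z) ∈ A.graph) :
    (res A l y, res A l z) ∈ A.graph := by
  rw [← yosida_eq_res_of_mem_graph hA hA0 hl h]
  exact res_mem_graph hA hA0 hl y

theorem norm_sq_res_add_le (x : H) : ‖res A l x‖ ^ 2 + ‖l • yosida A l x‖ ^ 2 ≤ ‖x‖ ^ 2 := by
  have h := norm_sq_add_le_of_mem_graph hA0 hl (res_mem_graph hA hA0 hl x)
  rwa [res_add_smul_yosida hl] at h

theorem norm_res_le (x : H) : ‖res A l x‖ ≤ ‖x‖ :=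
  le_of_sq_le_sq (by nlinarith [norm_sq_res_add_le hA hA0 hl x, sq_nonneg ‖l • yosida A l x‖])
    (norm_nonneg _)

theorem norm_sub_res_le (x : H) : ‖x - res A l x‖ ≤ ‖x‖ := by
  have h : x - res A l x = l • yosida A l x := by
    rw [yosida_apply, smul_inv_smul₀ hl.ne']
  rw [h]
  exact le_of_sq_le_sq (by nlinarith [norm_sq_res_add_le hA hA0 hl x, sq_nonneg ‖res A l x‖])
    (norm_nonneg _)

theorem inner_res_symm (x y : H) : ⟪res A l x, y⟫ = ⟪x, res A l y⟫ := by
  have h := inner_symm_of_mem_graph hA (res_mem_graph hA hA0 hl y) (res_mem_graph hA hA0 hl x)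
  nth_rw 1 [← res_add_smul_yosida (A := A) hl y]
  nth_rw 2 [← res_add_smul_yosida (A := A) hl x]
  rw [inner_add_left, inner_add_right, real_inner_smul_left, inner_smul_right, h]

theorem inner_yosida_symm (x y : H) : ⟪yosida A l x, y⟫ = ⟪x, yosida A l y⟫ := by
  rw [yosida_apply, yosida_apply, real_inner_smul_left, inner_smul_right, inner_sub_left,
    inner_sub_right, inner_res_symm hA hA0 hl]

theorem isSelfAdjoint_res : IsSelfAdjoint (res A l) :=
  ContinuousLinearMap.isSelfAdjoint_iff_isSymmetric.2 fun x y => inner_res_symm hA hA0 hl x y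

theorem res_comm {m : ℝ} (hm : 0 < m) (x : H) : res A l (res A m x) = res A m (res A l x) := by
  have h := res_eq_of_mem_graph hA hA0 hm
    (res_map_mem_graph hA hA0 hl (res_mem_graph hA hA0 hm x))
  rw [← map_smul, ← map_add, res_add_smul_yosida hm] at h
  exact h.symm

theorem yosida_res_comm {m : ℝ} (hm : 0 < m) (x : H) :
    yosida A l (res A m x) = res A m (yosida A l x) := by
  rw [yosida_apply, yosida_apply, map_smul, map_sub, res_comm hA hA0 hl hm]

theorem inner_yosida_nonneg (x : H) : 0 ≤ ⟪yosida A l x, x⟫ := by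
  have h := inner_nonneg_of_mem_graph hA0 (res_mem_graph hA hA0 hl x)
  nth_rw 2 [← res_add_smul_yosida (A := A) hl x]
  rw [inner_add_right, inner_smul_right, real_inner_self_eq_norm_sq]
  positivity

-- On `D(A)` the error is at most `l‖A y‖`; density of `D(A)` and contractivity of the resolvents
-- give the rest.
omit hl in
theorem tendsto_res (x : H) : Tendsto (fun l => res A l x) (𝓝[>] 0) (𝓝 x) := by
  have hdom : ∀ y ∈ A.domain, Tendsto (fun l => res A l y) (𝓝[>] 0) (𝓝 y) := by
    intro y hy
    rw [tendsto_iff_norm_sub_tendsto_zero]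
    have h0 : Tendsto (fun l : ℝ => l * ‖A ⟨y, hy⟩‖) (𝓝[>] 0) (𝓝 0) := by
      have : Tendsto (fun l : ℝ => l * ‖A ⟨y, hy⟩‖) (𝓝 0) (𝓝 (0 * ‖A ⟨y, hy⟩‖)) :=
        tendsto_id.mul_const _
      rw [zero_mul] at this
      exact this.mono_left nhdsWithin_le_nhds
    refine squeeze_zero' (.of_forall fun _ => norm_nonneg _) ?_ h0
    filter_upwards [self_mem_nhdsWithin] with l hl
    have hl : 0 < l := hl
    have h1 : y - res A l y = l • yosida A l y := by
      rw [yosida_apply, smul_inv_smul₀ hl.ne']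
    rw [norm_sub_rev, h1, norm_smul, Real.norm_of_nonneg hl.le,
      yosida_eq_res_of_mem_graph hA hA0 hl (A.mem_graph ⟨y, hy⟩)]
    exact mul_le_mul_of_nonneg_left (norm_res_le hA hA0 hl _) hl.le
  rw [Metric.tendsto_nhds]
  intro ε hε
  obtain ⟨y, hy, hxy⟩ := Metric.dense_iff.1 hA.dense_domain x (ε / 3) (by positivity)
  rw [Metric.mem_ball, dist_comm] at hy
  filter_upwards [Metric.tendsto_nhds.1 (hdom y hxy) (ε / 3) (by positivity),
    self_mem_nhdsWithin] with l h1 hl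
  have h2 : dist (res A l x) (res A l y) ≤ dist x y := by
    rw [dist_eq_norm, dist_eq_norm, ← map_sub]
    exact norm_res_le hA hA0 hl _
  have h3 := dist_triangle4 (res A l x) (res A l y) y x
  rw [dist_comm y x] at h3
  linarith

end Resolvent

/-! ### Existence of `A^{1/2}`. -/

section SquareRoot

/-- With `J = (1 + A)⁻¹` one has `A = (1 - J)J⁻¹`, so for commuting roots `P² = J`, `Q² = 1 - J` the
operator sought is `Q P⁻¹`, whose graph is `{(Pc, Qc)}`. The identity `P² + Q² = 1` replaces
functional calculus. -/
theorem exists_isNonnegSqrt (hA : IsSelfAdjoint A) (hA0 : IsNonneg A) :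
    ∃ B : H →ₗ.[ℝ] H, IsNonnegSqrt A B := by
  have one_pos' : (0 : ℝ) < 1 := one_pos
  obtain ⟨P, Q, hP, hQ, hPQ0, hPP, hQQ, hPQ⟩ := exists_commuting_sqrt
    (isSelfAdjoint_res hA hA0 one_pos')
    (ContinuousLinearMap.opNorm_le_bound _ zero_le_one fun x => by
      simpa using norm_res_le hA hA0 one_pos' x)
    (ContinuousLinearMap.opNorm_le_bound _ zero_le_one fun x => by
      simpa using norm_sub_res_le hA hA0 one_pos' x)
  replace hP : ∀ x y, ⟪P x, y⟫ = ⟪x, P y⟫ :=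
    fun x y => ContinuousLinearMap.isSelfAdjoint_iff_isSymmetric.1 hP x y
  replace hQ : ∀ x y, ⟪Q x, y⟫ = ⟪x, Q y⟫ :=
    fun x y => ContinuousLinearMap.isSelfAdjoint_iff_isSymmetric.1 hQ x y
  replace hPP : ∀ x, P (P x) = res A 1 x := fun x => by rw [← hPP]; rfl
  replace hQQ : ∀ x, Q (Q x) = x - res A 1 x := fun x => by
    have : (Q * Q) x = (1 - res A 1) x := by rw [hQQ]
    exact this
  replace hPQ : ∀ x, P (Q x) = Q (P x) := fun x => DFunLike.congr_fun hPQ.eq x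
  have hsum : ∀ x, P (P x) + Q (Q x) = x := fun x => by rw [hPP, hQQ, add_sub_cancel]
  have hPinj : ∀ x, P x = 0 → x = 0 := by
    intro x hx
    have h1 : res A 1 x = 0 := by rw [← hPP, hx, map_zero]
    have h2 := res_mem_graph hA hA0 one_pos' x
    rw [yosida_apply, h1, inv_one, one_smul, sub_zero] at h2
    exact A.graph_fst_eq_zero_snd h2 rfl
  let G : Submodule ℝ (H × H) := LinearMap.range (P.prod Q).toLinearMap
  have hG : ∀ x y, (x, y) ∈ G ↔ ∃ c, P c = x ∧ Q c = y := by
    intro x y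
    simp [G, LinearMap.mem_range]
  have hG0 : ∀ x ∈ G, x.1 = 0 → x.2 = 0 := by
    rintro ⟨x, y⟩ hx hx0
    obtain ⟨c, rfl, rfl⟩ := (hG x y).1 hx
    simp [hPinj c hx0]
  have hgr : G.toLinearPMap.graph = G := Submodule.toLinearPMap_graph_eq G hG0
  have hdom : ∀ x, x ∈ G.toLinearPMap.domain ↔ ∃ c, P c = x := by
    intro x
    rw [LinearPMap.mem_domain_iff]
    simp only [hgr, hG]
    exact ⟨fun ⟨_, c, hc, _⟩ => ⟨c, hc⟩, fun ⟨c, hc⟩ => ⟨Q c, c, hc, rfl⟩⟩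
  have hdense : Dense (G.toLinearPMap.domain : Set H) := by
    rw [Submodule.dense_iff_topologicalClosure_eq_top, Submodule.topologicalClosure_eq_top_iff,
      Submodule.eq_bot_iff]
    intro z hz
    refine hPinj z ?_
    have h := (Submodule.mem_orthogonal _ _).1 hz (P (P z)) ((hdom _).2 ⟨_, rfl⟩)
    rw [hP] at h
    exact inner_self_eq_zero.1 h
  have hmem : ∀ a b, (a, b) ∈ A.graph ↔ ∃ c, res A 1 c = a ∧ c - res A 1 c = b := by
    intro a b
    constructor
    · intro h
      have h' := res_eq_of_mem_graph hA hA0 one_pos' h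
      rw [one_smul] at h'
      exact ⟨a + b, h', by rw [h', add_sub_cancel_left]⟩
    · rintro ⟨c, rfl, rfl⟩
      have h' := res_mem_graph hA hA0 one_pos' c
      rwa [yosida_apply, inv_one, one_smul] at h'
  refine ⟨G.toLinearPMap, ?_, ?_, ?_⟩
  · rw [LinearPMap.isSelfAdjoint_def]
    refine LinearPMap.eq_of_eq_graph ?_
    rw [LinearPMap.adjoint_graph_eq_graph_adjoint hdense, hgr]
    ext ⟨x, y⟩
    rw [Submodule.mem_adjoint_iff]
    constructor
    · intro h
      have hQP : Q x = P y := by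
        refine ext_inner_left ℝ fun c => ?_
        have := h _ _ ((hG _ _).2 ⟨c, rfl, rfl⟩)
        rw [← hP, ← hQ]
        exact sub_eq_zero.1 this
      -- If `x = Pc` and `y = Qc`, then `Px + Qy = (P² + Q²)c = c`, so this is the only possible
      -- parameter.
      refine (hG x y).2 ⟨P x + Q y, ?_, ?_⟩
      · rw [map_add, hPQ, ← hQP, hsum]
      · rw [map_add, ← hPQ, hQP, hsum]
    · intro h a b hab
      obtain ⟨c, rfl, rfl⟩ := (hG x y).1 h
      obtain ⟨d, rfl, rfl⟩ := (hG a b).1 hab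
      rw [sub_eq_zero, hQ, hP, hPQ]
  · intro x
    obtain ⟨c, hc, hc'⟩ := (hG _ _).1 (hgr ▸ G.toLinearPMap.mem_graph x)
    rw [← hc', ← hc]
    exact hPQ0 c
  · intro x y
    rw [hmem]
    simp only [hgr, hG]
    constructor
    · rintro ⟨c, rfl, rfl⟩
      exact ⟨P (Q c), ⟨P c, hPP c, (hPQ c).symm⟩, ⟨Q c, rfl, hQQ c⟩⟩
    · rintro ⟨z, ⟨a, rfl, rfl⟩, ⟨b, hb, rfl⟩⟩
      -- From `Pb = Qa` and `P² + Q² = 1`, this `c` satisfies `Pc = a` and `Qc = b`.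
      refine ⟨P a + Q b, ?_, ?_⟩
      · rw [← hPP, map_add, hPQ b, hb, hsum]
      · rw [← hQQ, map_add, ← hPQ a, ← hb, hsum]

theorem isNonnegSqrt_sqrtOp (hA : IsSelfAdjoint A) (hA0 : IsNonneg A) :
    IsNonnegSqrt A (sqrtOp A) := by
  have h := exists_isNonnegSqrt hA hA0
  rw [sqrtOp, dif_pos h]
  exact h.choose_spec

end SquareRoot

end SlowSolutions

namespace SlowSolutions

open HalfDomain

variable {H : Type*} [NormedAddCommGroup H] [InnerProductSpace ℝ H] [CompleteSpace H]
  {A : H →ₗ.[ℝ] H}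

/-! ### The space `D(A^{1/2})`: resolvents, energy identities, completeness. -/

namespace HalfDomain

theorem norm_sq_eq (u : HalfDomain A) : ‖u‖ ^ 2 = ‖val u‖ ^ 2 + ‖half u‖ ^ 2 := by
  rw [norm_eq, Real.sq_sqrt (by positivity)]

theorem norm_val_le (u : HalfDomain A) : ‖val u‖ ≤ ‖u‖ :=
  le_of_sq_le_sq (by nlinarith [norm_sq_eq u, sq_nonneg ‖half u‖]) (norm_nonneg _)

theorem norm_half_le (u : HalfDomain A) : ‖half u‖ ≤ ‖u‖ :=
  le_of_sq_le_sq (by nlinarith [norm_sq_eq u, sq_nonneg ‖val u‖]) (norm_nonneg _)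

theorem norm_le_add (u : HalfDomain A) : ‖u‖ ≤ ‖val u‖ + ‖half u‖ :=
  le_of_sq_le_sq (by nlinarith [norm_sq_eq u, norm_nonneg (val u), norm_nonneg (half u)])
    (by positivity)

theorem continuous_val : Continuous (val : HalfDomain A → H) :=
  (val.mkContinuous 1 fun u => by simpa using norm_val_le u).continuous

theorem continuous_half : Continuous (half : HalfDomain A → H) :=
  (half.mkContinuous 1 fun u => by simpa using norm_half_le u).continuous

theorem mem_graph (v : HalfDomain A) : (val v, half v) ∈ (sqrtOp A).graph :=
  (sqrtOp A).mem_graph v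

theorem exists_of_mem_graph {x z : H} (h : (x, z) ∈ (sqrtOp A).graph) :
    ∃ v : HalfDomain A, val v = x ∧ half v = z := by
  obtain ⟨v, h1, h2⟩ := (sqrtOp A).mem_graph_iff.1 h
  exact ⟨v, h1, h2⟩

variable (hA : IsSelfAdjoint A) (hA0 : IsNonneg A)
include hA hA0

theorem inner_half_symm (v w : HalfDomain A) : ⟪half v, val w⟫ = ⟪val v, half w⟫ :=
  inner_symm_of_mem_graph (isNonnegSqrt_sqrtOp hA hA0).isSelfAdjoint (mem_graph w) (mem_graph v)

theorem mem_graph_iff {x y : H} :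
    (x, y) ∈ A.graph ↔ ∃ v w : HalfDomain A, val v = x ∧ val w = half v ∧ half w = y := by
  rw [(isNonnegSqrt_sqrtOp hA hA0).sq_eq]
  constructor
  · rintro ⟨z, h1, h2⟩
    obtain ⟨v, hv, rfl⟩ := exists_of_mem_graph h1
    obtain ⟨w, hw, rfl⟩ := exists_of_mem_graph h2
    exact ⟨v, w, hv, hw, rfl⟩
  · rintro ⟨v, w, rfl, h, rfl⟩
    exact ⟨half v, mem_graph v, h ▸ mem_graph w⟩

theorem norm_sq_half_of_mem_graph {v : HalfDomain A} {y : H} (h : (val v, y) ∈ A.graph) :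
    ‖half v‖ ^ 2 = ⟪y, val v⟫ := by
  obtain ⟨v', w, hv, hw, rfl⟩ := (mem_graph_iff hA hA0).1 h
  rw [val_injective hv] at hw
  rw [inner_half_symm hA hA0, hw, real_inner_self_eq_norm_sq]

theorem exists_val_of_mem_graph {x y : H} (h : (x, y) ∈ A.graph) :
    ∃ v : HalfDomain A, val v = x ∧ ‖half v‖ ^ 2 = ⟪y, x⟫ := by
  obtain ⟨v, w, rfl, -, -⟩ := (mem_graph_iff hA hA0).1 h
  exact ⟨v, rfl, norm_sq_half_of_mem_graph hA hA0 h⟩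

/-- Resolvents commute with `A^{1/2}`: for `v' = (1 + lA)⁻¹v`, applying `A^{1/2}` to `v' + lAv' = v`
shows that `A^{1/2}v'` solves the resolvent equation with datum `A^{1/2}v`. -/
theorem exists_res {l : ℝ} (hl : 0 < l) (v : HalfDomain A) :
    ∃ v' : HalfDomain A, val v' = res A l (val v) ∧ half v' = res A l (half v) := by
  obtain ⟨v', w, hv', hw, hw'⟩ := (mem_graph_iff hA hA0).1 (res_mem_graph hA hA0 hl (val v))
  refine ⟨v', hv', ?_⟩
  have h1 : val (l⁻¹ • (v - v')) = half w := by
    rw [hw', map_smul, map_sub, hv', yosida_apply]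
  have h2 : (half v', half (l⁻¹ • (v - v'))) ∈ A.graph :=
    (mem_graph_iff hA hA0).2 ⟨w, l⁻¹ • (v - v'), hw, h1, rfl⟩
  have h3 := res_eq_of_mem_graph hA hA0 hl h2
  rw [map_smul, map_sub, smul_inv_smul₀ hl.ne', add_sub_cancel] at h3
  exact h3.symm

/-- The left side equals `⟨(1 + lA)⁻¹A^{1/2}v, A^{1/2}v⟩`. This bounds the initial Yosida energies
uniformly in `l`. -/
theorem inner_yosida_le {l : ℝ} (hl : 0 < l) (v : HalfDomain A) :
    ⟪yosida A l (val v), val v⟫ ≤ ‖half v‖ ^ 2 := by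
  obtain ⟨v', w, hv', hw, hw'⟩ := (mem_graph_iff hA hA0).1 (res_mem_graph hA hA0 hl (val v))
  obtain ⟨v'', hv'', hh⟩ := exists_res hA hA0 hl v
  have : v' = v'' := val_injective (hv'.trans hv''.symm)
  subst this
  rw [← hw', inner_half_symm hA hA0, hw, hh]
  refine (real_inner_le_norm _ _).trans ?_
  rw [sq]
  exact mul_le_mul_of_nonneg_right (norm_res_le hA hA0 hl _) (norm_nonneg _)

theorem half_eq_zero_of_mem_graph {v : HalfDomain A} (h : (val v, (0 : H)) ∈ A.graph) :
    half v = 0 := by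
  have := norm_sq_half_of_mem_graph hA hA0 h
  simpa using this

theorem exists_tendsto_of_cauchySeq {v : ℕ → HalfDomain A} (h1 : CauchySeq fun n => val (v n))
    (h2 : CauchySeq fun n => half (v n)) : ∃ w, Tendsto v atTop (𝓝 w) := by
  obtain ⟨x, hx⟩ := cauchySeq_tendsto_of_complete h1
  obtain ⟨z, hz⟩ := cauchySeq_tendsto_of_complete h2
  have hmem : (x, z) ∈ (sqrtOp A).graph :=
    (isNonnegSqrt_sqrtOp hA hA0).isSelfAdjoint.isClosed.mem_of_tendsto (hx.prodMk_nhds hz)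
      (.of_forall fun n => mem_graph (v n))
  obtain ⟨w, rfl, rfl⟩ := exists_of_mem_graph hmem
  refine ⟨w, ?_⟩
  rw [tendsto_iff_norm_sub_tendsto_zero] at hx hz ⊢
  refine squeeze_zero (fun _ => norm_nonneg _) (fun n => ?_) (by simpa using hx.add hz)
  simpa using norm_le_add (v n - w)

theorem completeSpace : CompleteSpace (HalfDomain A) := by
  refine Metric.complete_of_cauchySeq_tendsto fun v hv => ?_
  exact exists_tendsto_of_cauchySeq hA hA0
    (hv.map (val.mkContinuous 1 fun u => by simpa using norm_val_le u).uniformContinuous)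
    (hv.map (half.mkContinuous 1 fun u => by simpa using norm_half_le u).uniformContinuous)

end HalfDomain

/-- Elements approximated by elements of the domain with bounded images lie in the domain. -/
theorem exists_mem_graph_of_tendsto (hA : IsSelfAdjoint A) {x y : ℕ → H} {x₀ : H} {C : ℝ}
    (hxy : ∀ n, (x n, y n) ∈ A.graph) (hx : Tendsto x atTop (𝓝 x₀))
    (hy : ∃ᶠ n in atTop, ‖y n‖ ≤ C) : ∃ y₀, (x₀, y₀) ∈ A.graph := by
  -- Boundedness of `a ↦ ⟨x₀, A a⟩` places `x₀` in the domain of the adjoint, with no weak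
  -- compactness. A bound along a subsequence suffices, which is what a finite `liminf` provides.
  have key : ∀ a : A.domain, |⟪x₀, A a⟫| ≤ C * ‖a‖ := by
    intro a
    have h1 : Tendsto (fun n => |⟪x n, A a⟫|) atTop (𝓝 |⟪x₀, A a⟫|) :=
      (hx.inner tendsto_const_nhds).abs
    refine le_of_tendsto_of_frequently h1 (hy.mono fun n hn => ?_)
    rw [real_inner_comm, inner_symm_of_mem_graph hA (hxy n) (A.mem_graph a), real_inner_comm]
    exact (abs_real_inner_le_norm _ _).trans (mul_le_mul_of_nonneg_right hn (norm_nonneg _))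
  have h2 : x₀ ∈ A.adjoint.domain := by
    rw [LinearPMap.mem_adjoint_domain_iff]
    refine (LinearMap.mkContinuous _ C fun a => ?_).continuous
    simpa using key a
  rw [LinearPMap.isSelfAdjoint_def.1 hA] at h2
  exact ⟨_, A.mem_graph ⟨x₀, h2⟩⟩

end SlowSolutions

namespace SlowSolutions

open HalfDomain

/-! ### Limits of continuous functions and linear equations with a bounded operator. -/

section Preliminaries

/-- A sequence of continuous functions that is locally uniformly Cauchy on `[0, ∞)` has a
continuous limit. -/
theorem exists_continuous_limit {E : Type*} [NormedAddCommGroup E] [CompleteSpace E]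
    {F : ℕ → ℝ → E} (hF : ∀ n, Continuous (F n))
    (hest : ∀ T, 0 ≤ T → ∃ ε : ℕ → ℝ, Tendsto ε atTop (𝓝 0) ∧
      ∀ n m, ∀ t ∈ Icc 0 T, ‖F n t - F m t‖ ^ 2 ≤ ε n + ε m) :
    ∃ w : ℝ → E, Continuous w ∧ ∀ t, 0 ≤ t → Tendsto (fun n => F n t) atTop (𝓝 (w t)) := by
  have hcauchy : ∀ T, 0 ≤ T → UniformCauchySeqOn F atTop (Icc 0 T) := by
    intro T hT
    obtain ⟨ε, hε, hle⟩ := hest T hT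
    rw [Metric.uniformCauchySeqOn_iff]
    intro δ hδ
    obtain ⟨N, hN⟩ := eventually_atTop.1
      (hε.eventually (gt_mem_nhds (show (0 : ℝ) < δ ^ 2 / 2 by positivity)))
    refine ⟨N, fun m hm n hn t ht => ?_⟩
    rw [dist_eq_norm]
    refine lt_of_pow_lt_pow_left₀ 2 hδ.le ((hle m n t ht).trans_lt ?_)
    linarith [hN m hm, hN n hn]
  have hlim : ∀ t, ∃ w, 0 ≤ t → Tendsto (fun n => F n t) atTop (𝓝 w) := by
    intro t
    by_cases ht : 0 ≤ t
    · obtain ⟨w, hw⟩ := cauchySeq_tendsto_of_complete ((hcauchy t ht).cauchySeq ⟨ht, le_rfl⟩)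
      exact ⟨w, fun _ => hw⟩
    · exact ⟨F 0 0, fun h => absurd h ht⟩
  choose w hw using hlim
  have hwcont : ContinuousOn w (Ici 0) := by
    intro t ht
    have ht' : (0 : ℝ) ≤ t := ht
    have h := ((hcauchy (t + 1) (by linarith)).tendstoUniformlyOn_of_tendsto
      fun s hs => hw s hs.1).continuousOn (.of_forall fun n => (hF n).continuousOn)
    refine (h t ⟨ht, by linarith⟩).mono_of_mem_nhdsWithin ?_
    rw [mem_nhdsWithin]
    exact ⟨Iio (t + 1), isOpen_Iio, by simp, fun s hs => ⟨hs.2, hs.1.le⟩⟩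
  -- Negative times get the value at `0`, so that continuity holds on all of `ℝ`.
  refine ⟨fun t => w (max t 0), hwcont.comp_continuous (continuous_id.max continuous_const)
    fun t => le_max_right t 0, fun t ht => ?_⟩
  simpa [max_eq_left ht] using hw t ht


/-- Duhamel's formula with the operator exponential. -/
theorem exists_linear_ode {E : Type*} [NormedAddCommGroup E] [NormedSpace ℝ E] [CompleteSpace E]
    (C : E →L[ℝ] E) {g : ℝ → E} (hg : Continuous g) (x : E) :
    ∃ u : ℝ → E, u 0 = x ∧ ∀ t, HasDerivAt u (g t - C (u t)) t := by
  let _ : NormedAlgebra ℚ (E →L[ℝ] E) := .restrictScalars ℚ ℝ _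
  let S : ℝ → E →L[ℝ] E := fun t => NormedSpace.exp (t • C)
  have hS : ∀ t, HasDerivAt S (S t * C) t := fun t => hasDerivAt_exp_smul_const C t
  have hScont : Continuous S := continuous_iff_continuousAt.2 fun t => (hS t).continuousAt
  have hSS : ∀ t, S (-t) * S t = 1 := fun t => by
    have h := (NormedSpace.exp_add_of_commute (𝔸 := E →L[ℝ] E)
      (((Commute.refl C).smul_left (-t)).smul_right t))
    rw [← add_smul, neg_add_cancel, zero_smul, NormedSpace.exp_zero] at h
    exact h.symm
  have hint : Continuous fun s => S s (g s) := hScont.clm_apply hg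
  have hcomm : ∀ t, Commute (S t) C := fun t =>
    ((Commute.refl C).smul_left t).exp_left
  refine ⟨fun t => S (-t) (x + ∫ s in (0 : ℝ)..t, S s (g s)), ?_, fun t => ?_⟩
  · simp [S]
  · have h1 : HasDerivAt (fun t => x + ∫ s in (0 : ℝ)..t, S s (g s)) (S t (g t)) t :=
      (hint.integral_hasStrictDerivAt 0 t).hasDerivAt.const_add x
    have h2 : HasDerivAt (fun t => S (-t)) (-(S (-t) * C)) t := by
      have := (hS (-t)).scomp t (hasDerivAt_neg t)
      rw [neg_one_smul] at this
      exact this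
    convert h2.clm_apply h1 using 1
    have h3 : S (-t) (S t (g t)) = g t := DFunLike.congr_fun (hSS t) (g t)
    have h4 : ∀ y, S (-t) (C y) = C (S (-t) y) := fun y => DFunLike.congr_fun (hcomm (-t)).eq y
    rw [h3]
    change g t - C (S (-t) _) = -(S (-t) (C _)) + g t
    rw [h4]
    abel

end Preliminaries

variable {H : Type*} [NormedAddCommGroup H] [InnerProductSpace ℝ H] [CompleteSpace H]
  {A : H →ₗ.[ℝ] H}

/-- A weak formulation of `w' + A w = g` on `[0, ∞)`: the equation holds in integrated form after
an application of any resolvent of `A`. -/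
def IsWeakSol (A : H →ₗ.[ℝ] H) (g w : ℝ → H) : Prop :=
  ∀ l : ℝ, 0 < l → ∀ t : ℝ, 0 ≤ t →
    res A l (w t) = res A l (w 0) + ∫ s in (0 : ℝ)..t, (res A l (g s) - yosida A l (w s))

theorem tendsto_one_div_nat_nhdsGT :
    Tendsto (fun n : ℕ => 1 / ((n : ℝ) + 1)) atTop (𝓝[>] 0) :=
  tendsto_nhdsWithin_iff.2
    ⟨tendsto_one_div_add_atTop_nhds_zero_nat, .of_forall fun _ => mem_Ioi.2 Nat.one_div_pos_of_nat⟩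

/-! ### The linear problem `w' + Aw = g` by Yosida approximation. -/

section Yosida

variable (hA : IsSelfAdjoint A) (hA0 : IsNonneg A)
include hA hA0

/-- Split `x = J x + l A_l x`, where `J` is the resolvent and `A_l` the Yosida approximation, and
likewise `y`. Monotonicity of `A` disposes of the resolvent parts, and the remainder is of order `l
+ m`. -/
theorem inner_yosida_sub_le {l m : ℝ} (hl : 0 < l) (hm : 0 < m) (x y : H) :
    -2 * ⟪yosida A l x - yosida A m y, x - y⟫ ≤
      (l + m) * (‖yosida A l x‖ ^ 2 + ‖yosida A m y‖ ^ 2) := by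
  have h := inner_nonneg_of_mem_graph hA0
    (A.graph.sub_mem (res_mem_graph hA hA0 hl x) (res_mem_graph hA hA0 hm y))
  have hxy : x - y = (res A l x - res A m y) + (l • yosida A l x - m • yosida A m y) := by
    nth_rw 1 [← res_add_smul_yosida (A := A) hl x, ← res_add_smul_yosida (A := A) hm y]
    abel
  change 0 ≤ ⟪yosida A l x - yosida A m y, res A l x - res A m y⟫ at h
  rw [hxy, inner_add_right]
  set a := yosida A l x
  set b := yosida A m y
  have h2 : ⟪a - b, l • a - m • b⟫ = l * ‖a‖ ^ 2 + m * ‖b‖ ^ 2 - (l + m) * ⟪a, b⟫ := by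
    simp only [inner_sub_left, inner_sub_right, inner_smul_right, real_inner_self_eq_norm_sq,
      real_inner_comm a b]
    ring
  have h3 : 2 * ⟪a, b⟫ ≤ ‖a‖ ^ 2 + ‖b‖ ^ 2 := by
    have := norm_sub_sq_real a b
    nlinarith [sq_nonneg ‖a - b‖]
  have h4 := mul_le_mul_of_nonneg_left h3 (add_pos hl hm).le
  rw [h2]
  nlinarith [mul_nonneg hl.le (sq_nonneg ‖a‖), mul_nonneg hm.le (sq_nonneg ‖b‖)]

theorem hasDerivAt_inner_yosida {l : ℝ} (hl : 0 < l) {u : ℝ → H} {u' : H} {t : ℝ}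
    (hu : HasDerivAt u u' t) :
    HasDerivAt (fun s => ⟪yosida A l (u s), u s⟫) (2 * ⟪yosida A l (u t), u'⟫) t := by
  have h := (((yosida A l).hasFDerivAt.comp_hasDerivAt t hu).inner ℝ hu)
  have h1 : 2 * ⟪yosida A l (u t), u'⟫ = ⟪yosida A l (u t), u'⟫ + ⟪yosida A l u', u t⟫ := by
    rw [inner_yosida_symm hA hA0 hl u', real_inner_comm _ u']
    ring
  rw [h1]
  exact h

/-- The error terms `‖A_l u‖²` and `‖A_m v‖²` are absorbed by adding `l + m` times the two Yosida
energies, whose derivatives contain `-‖A_l u‖²` and `-‖A_m v‖²`. The resulting functional is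
nonincreasing. -/
theorem yosida_sub_sq_le {l m : ℝ} (hl : 0 < l) (hm : 0 < m) {g u v : ℝ → H} (hg : Continuous g)
    (hu : ∀ t, HasDerivAt u (g t - yosida A l (u t)) t)
    (hv : ∀ t, HasDerivAt v (g t - yosida A m (v t)) t) {u₀ : HalfDomain A}
    (hu0 : u 0 = val u₀) (hv0 : v 0 = val u₀) {t : ℝ} (ht : 0 ≤ t) :
    ‖u t - v t‖ ^ 2 ≤ (l + m) * (2 * ‖half u₀‖ ^ 2 + 2 * ∫ s in (0 : ℝ)..t, ‖g s‖ ^ 2) := by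
  have hlm : 0 < l + m := add_pos hl hm
  let F : ℝ → ℝ := fun t => ‖u t - v t‖ ^ 2 +
    (l + m) * (⟪yosida A l (u t), u t⟫ + ⟪yosida A m (v t), v t⟫) -
    (l + m) * (2 * ∫ s in (0 : ℝ)..t, ‖g s‖ ^ 2)
  have hF : ∀ t, HasDerivAt F (2 * ⟪u t - v t, (g t - yosida A l (u t)) - (g t - yosida A m (v t))⟫
      + (l + m) * (2 * ⟪yosida A l (u t), g t - yosida A l (u t)⟫ +
        2 * ⟪yosida A m (v t), g t - yosida A m (v t)⟫) - (l + m) * (2 * ‖g t‖ ^ 2)) t := by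
    intro t
    exact ((((hu t).sub (hv t)).norm_sq).add
      (((hasDerivAt_inner_yosida hA hA0 hl (hu t)).add
        (hasDerivAt_inner_yosida hA hA0 hm (hv t))).const_mul (l + m))).sub
      ((((hg.norm.pow 2).integral_hasStrictDerivAt 0 t).hasDerivAt.const_mul 2).const_mul (l + m))
  have hanti : Antitone F := by
    refine antitone_of_hasDerivAt_nonpos hF fun t => ?_
    set a := yosida A l (u t)
    set b := yosida A m (v t)
    have h1 := inner_yosida_sub_le hA hA0 hl hm (u t) (v t)
    have h2 : ⟪u t - v t, (g t - a) - (g t - b)⟫ = -⟪a - b, u t - v t⟫ := by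
      rw [sub_sub_sub_cancel_left, real_inner_comm, ← inner_neg_left, neg_sub]
    have h3 : ∀ c : H, 2 * ⟪c, g t - c⟫ ≤ ‖g t‖ ^ 2 - ‖c‖ ^ 2 := by
      intro c
      rw [inner_sub_right, real_inner_self_eq_norm_sq]
      have := norm_sub_sq_real c (g t)
      nlinarith [sq_nonneg ‖c - g t‖]
    have h4 := mul_le_mul_of_nonneg_left (add_le_add (h3 a) (h3 b)) hlm.le
    rw [h2]
    change -2 * ⟪a - b, u t - v t⟫ ≤ (l + m) * (‖a‖ ^ 2 + ‖b‖ ^ 2) at h1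
    change 2 * -⟪a - b, u t - v t⟫ + (l + m) * (2 * ⟪a, g t - a⟫ + 2 * ⟪b, g t - b⟫) -
      (l + m) * (2 * ‖g t‖ ^ 2) ≤ 0
    linarith
  have h := hanti ht
  have hF0 : F 0 ≤ (l + m) * (2 * ‖half u₀‖ ^ 2) := by
    simp only [F, hu0, hv0, sub_self, norm_zero, intervalIntegral.integral_same]
    have := mul_le_mul_of_nonneg_left
      (add_le_add (inner_yosida_le hA hA0 hl u₀) (inner_yosida_le hA hA0 hm u₀)) hlm.le
    linarith
  have h5 := mul_nonneg hlm.le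
    (add_nonneg (inner_yosida_nonneg hA hA0 hl (u t)) (inner_yosida_nonneg hA hA0 hm (v t)))
  simp only [F] at h hF0
  linarith

theorem tendsto_res_seq (x : H) :
    Tendsto (fun n : ℕ => res A (1 / ((n : ℝ) + 1)) x) atTop (𝓝 x) :=
  (tendsto_res hA hA0 x).comp tendsto_one_div_nat_nhdsGT

theorem exists_isWeakSol {g : ℝ → H} (hg : Continuous g) (u₀ : HalfDomain A) :
    ∃ w : ℝ → H, Continuous w ∧ w 0 = val u₀ ∧ IsWeakSol A g w := by
  let l : ℕ → ℝ := fun n => 1 / ((n : ℝ) + 1)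
  have hl : ∀ n, 0 < l n := fun n => Nat.one_div_pos_of_nat
  have hl1 : ∀ n, l n ≤ 1 := fun n => by
    simp only [l]
    rw [div_le_one (by positivity)]
    simp
  have hl0 : Tendsto l atTop (𝓝 0) := tendsto_one_div_add_atTop_nhds_zero_nat
  choose u hu0 hu using fun n => exists_linear_ode (yosida A (l n)) hg (val u₀)
  have hucont : ∀ n, Continuous (u n) := fun n =>
    continuous_iff_continuousAt.2 fun t => (hu n t).continuousAt
  let K : ℝ → ℝ := fun T => 2 * ‖half u₀‖ ^ 2 + 2 * ∫ s in (0 : ℝ)..T, ‖g s‖ ^ 2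
  have hgi : ∀ a b, IntervalIntegrable (fun s => ‖g s‖ ^ 2) volume a b := fun a b =>
    (hg.norm.pow 2).intervalIntegrable a b
  have hK0 : ∀ T, 0 ≤ T → 0 ≤ K T := fun T hT => by
    have : 0 ≤ ∫ s in (0 : ℝ)..T, ‖g s‖ ^ 2 :=
      intervalIntegral.integral_nonneg hT fun s _ => by positivity
    positivity
  have hKmono : ∀ s T, 0 ≤ s → s ≤ T → K s ≤ K T := fun s T hs hsT => by
    have : ∫ r in (0 : ℝ)..s, ‖g r‖ ^ 2 ≤ ∫ r in (0 : ℝ)..T, ‖g r‖ ^ 2 :=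
      intervalIntegral.integral_mono_interval le_rfl hs hsT (.of_forall fun r => by positivity)
        (hgi 0 T)
    simp only [K]
    linarith
  have hest : ∀ n m t, 0 ≤ t → ‖u n t - u m t‖ ^ 2 ≤ (l n + l m) * K t := fun n m t ht =>
    yosida_sub_sq_le hA hA0 (hl n) (hl m) hg (hu n) (hu m) (hu0 n) (hu0 m) ht
  obtain ⟨w, hwcont, hw⟩ := exists_continuous_limit hucont fun T hT =>
    ⟨fun n => l n * K T, by simpa using hl0.mul_const (K T), fun n m t ht =>
      (hest n m t ht.1).trans ((mul_le_mul_of_nonneg_left (hKmono t T ht.1 ht.2)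
        (add_pos (hl n) (hl m)).le).trans_eq (add_mul _ _ _))⟩
  have hest' : ∀ n t, 0 ≤ t → ‖u n t - w t‖ ^ 2 ≤ l n * K t := by
    intro n t ht
    have h1 : Tendsto (fun m => ‖u n t - u m t‖ ^ 2) atTop (𝓝 (‖u n t - w t‖ ^ 2)) :=
      ((tendsto_const_nhds.sub (hw t ht)).norm).pow 2
    have h2 : Tendsto (fun m => (l n + l m) * K t) atTop (𝓝 ((l n + 0) * K t)) :=
      (tendsto_const_nhds.add hl0).mul_const _
    rw [add_zero] at h2
    exact le_of_tendsto_of_tendsto' h1 h2 fun m => hest n m t ht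
  have hw0 : w 0 = val u₀ :=
    tendsto_nhds_unique (hw 0 le_rfl) (by simp only [hu0]; exact tendsto_const_nhds)
  refine ⟨w, hwcont, hw0, fun k hk t ht => ?_⟩
  -- After applying a fixed resolvent, `A_{l n} u` becomes a bounded operator, independent of `n`,
  -- acting on `(1 + l n A)⁻¹u`; every term then has a limit.
  have hint : ∀ n, res A k (u n t) = res A k (u n 0) +
      ∫ s in (0 : ℝ)..t, (res A k (g s) - yosida A k (res A (l n) (u n s))) := by
    intro n
    have hder : ∀ s, HasDerivAt (fun s => res A k (u n s))
        (res A k (g s) - yosida A k (res A (l n) (u n s))) s := by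
      intro s
      have := (res A k).hasFDerivAt.comp_hasDerivAt s (hu n s)
      rwa [map_sub, ← yosida_eq_res_of_mem_graph hA hA0 hk (res_mem_graph hA hA0 (hl n) _)] at this
    rw [intervalIntegral.integral_eq_sub_of_hasDerivAt (fun s _ => hder s)]
    · simp
    · refine Continuous.intervalIntegrable ?_ _ _
      exact ((res A k).continuous.comp hg).sub
        ((yosida A k).continuous.comp ((res A (l n)).continuous.comp (hucont n)))
  have hlimR : Tendsto (fun n => ∫ s in (0 : ℝ)..t,
      (res A k (g s) - yosida A k (res A (l n) (u n s)))) atTop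
      (𝓝 (∫ s in (0 : ℝ)..t, (res A k (g s) - yosida A k (w s)))) := by
    refine intervalIntegral.tendsto_integral_filter_of_dominated_convergence
      (fun s => ‖g s‖ + ‖yosida A k‖ * (‖w s‖ + √(K t))) ?_ ?_ ?_ ?_
    · refine .of_forall fun n => Continuous.aestronglyMeasurable ?_
      exact ((res A k).continuous.comp hg).sub
        ((yosida A k).continuous.comp ((res A (l n)).continuous.comp (hucont n)))
    · refine .of_forall fun n => .of_forall fun s hs => ?_
      rw [uIoc_of_le ht] at hs
      refine (norm_sub_le _ _).trans (add_le_add (norm_res_le hA hA0 hk _) ?_)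
      refine ((yosida A k).le_opNorm _).trans (mul_le_mul_of_nonneg_left ?_ (norm_nonneg _))
      refine (norm_res_le hA hA0 (hl n) _).trans ?_
      have h1 : ‖u n s - w s‖ ≤ √(K t) := by
        refine Real.le_sqrt_of_sq_le ((hest' n s hs.1.le).trans ?_)
        have := hKmono s t hs.1.le hs.2
        have := hK0 s hs.1.le
        nlinarith [hl1 n, hl n]
      have := norm_add_le (u n s - w s) (w s)
      rw [sub_add_cancel] at this
      linarith
    · refine Continuous.intervalIntegrable ?_ _ _
      exact hg.norm.add (continuous_const.mul (hwcont.norm.add continuous_const))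
    · refine .of_forall fun s hs => ?_
      rw [uIoc_of_le ht] at hs
      refine tendsto_const_nhds.sub (((yosida A k).continuous.tendsto _).comp ?_)
      have h1 : Tendsto (fun n => res A (l n) (u n s - w s)) atTop (𝓝 0) := by
        refine squeeze_zero_norm (fun n => norm_res_le hA hA0 (hl n) _) ?_
        simpa using ((hw s hs.1.le).sub_const (w s)).norm
      have h2 := h1.add (tendsto_res_seq hA hA0 (w s))
      rw [zero_add] at h2
      refine h2.congr fun n => ?_
      rw [map_sub]
      exact sub_add_cancel _ _
  have hlimL : Tendsto (fun n => res A k (u n t)) atTop (𝓝 (res A k (w t))) :=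
    ((res A k).continuous.tendsto _).comp (hw t ht)
  have h0 : Tendsto (fun n => res A k (u n 0)) atTop (𝓝 (res A k (w 0))) :=
    ((res A k).continuous.tendsto _).comp (hw 0 le_rfl)
  exact tendsto_nhds_unique hlimL (by simpa only [hint] using h0.add hlimR)

end Yosida

end SlowSolutions

namespace SlowSolutions

open HalfDomain

variable {H : Type*} [NormedAddCommGroup H] [InnerProductSpace ℝ H] [CompleteSpace H]
  {A : H →ₗ.[ℝ] H}

/-! ### Energy estimates for regular solutions of `y' + Ay = h`, with `z = Ay`. -/

section Energy

variable (hA : IsSelfAdjoint A)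
include hA

/-- Difference quotients lie in the closed graph, so `z' = A y'`, and symmetry merges the two terms
of the product rule. -/
theorem hasDerivAt_inner_of_mem_graph {y z : ℝ → H} {y' z' : H} {t : ℝ}
    (hyz : ∀ s, (y s, z s) ∈ A.graph) (hy : HasDerivAt y y' t) (hz : HasDerivAt z z' t) :
    HasDerivAt (fun s => ⟪z s, y s⟫) (2 * ⟪z t, y'⟫) t := by
  have hmem : (y', z') ∈ A.graph := by
    refine hA.isClosed.mem_of_tendsto ((hasDerivAt_iff_tendsto_slope.1 hy).prodMk_nhds
      (hasDerivAt_iff_tendsto_slope.1 hz)) (.of_forall fun s => ?_)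
    exact A.graph.smul_mem _ (A.graph.sub_mem (hyz s) (hyz t))
  have h := hz.inner ℝ hy
  rwa [inner_symm_of_mem_graph hA (hyz t) hmem, real_inner_comm _ y', ← two_mul] at h

/-- Grönwall with weight `e^{-t}`. The left side is the squared norm of `D(A^{1/2})`; the
dissipation `-2‖z‖²` absorbs the term `2⟨z, h⟩`. -/
theorem norm_sq_add_inner_le (hA0 : IsNonneg A) {y z h : ℝ → H} (hyz : ∀ s, (y s, z s) ∈ A.graph)
    (hyc : Continuous y) (hzc : Continuous z) (hh : Continuous h)
    (hy : ∀ t, 0 < t → HasDerivAt y (h t - z t) t)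
    (hz : ∀ t, 0 < t → DifferentiableAt ℝ z t) {t : ℝ} (ht : 0 ≤ t) :
    ‖y t‖ ^ 2 + ⟪z t, y t⟫ ≤ Real.exp t *
      (‖y 0‖ ^ 2 + ⟪z 0, y 0⟫ + 2 * ∫ s in (0 : ℝ)..t, Real.exp (-s) * ‖h s‖ ^ 2) := by
  have hint : Continuous fun s => Real.exp (-s) * ‖h s‖ ^ 2 :=
    (Real.continuous_exp.comp continuous_neg).mul (hh.norm.pow 2)
  let F : ℝ → ℝ := fun t => Real.exp (-t) * (‖y t‖ ^ 2 + ⟪z t, y t⟫) -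
    2 * ∫ s in (0 : ℝ)..t, Real.exp (-s) * ‖h s‖ ^ 2
  have hF : ∀ t, 0 < t → HasDerivAt F ((-Real.exp (-t)) * (‖y t‖ ^ 2 + ⟪z t, y t⟫) +
      Real.exp (-t) * (2 * ⟪y t, h t - z t⟫ + 2 * ⟪z t, h t - z t⟫) -
      2 * (Real.exp (-t) * ‖h t‖ ^ 2)) t := by
    intro t ht
    have h1 : HasDerivAt (fun t => Real.exp (-t)) (-Real.exp (-t)) t := by
      simpa using (hasDerivAt_neg t).exp
    exact (h1.mul ((hy t ht).norm_sq.add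
      (hasDerivAt_inner_of_mem_graph hA hyz (hy t ht) (hz t ht).hasDerivAt))).sub
      ((hint.integral_hasStrictDerivAt 0 t).hasDerivAt.const_mul 2)
  have hcont : Continuous F := by
    refine ((Real.continuous_exp.comp continuous_neg).mul
      ((hyc.norm.pow 2).add (hzc.inner hyc))).sub (continuous_const.mul ?_)
    exact continuous_iff_continuousAt.2 fun t =>
      (hint.integral_hasStrictDerivAt 0 t).hasDerivAt.continuousAt
  have hanti : AntitoneOn F (Ici 0) := by
    refine antitoneOn_of_hasDerivWithinAt_nonpos (convex_Ici 0) hcont.continuousOn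
      (fun t ht => (hF t (by simpa using ht)).hasDerivWithinAt) fun t _ => ?_
    have h1 : 2 * ⟪y t, h t - z t⟫ + 2 * ⟪z t, h t - z t⟫ ≤
        ‖y t‖ ^ 2 + ⟪z t, y t⟫ + 2 * ‖h t‖ ^ 2 := by
      have h2 := norm_sub_sq_real (y t) (h t)
      have h3 := norm_sub_sq_real (z t) (h t)
      have h4 := inner_nonneg_of_mem_graph hA0 (hyz t)
      rw [inner_sub_right, inner_sub_right, real_inner_self_eq_norm_sq, real_inner_comm (z t) (y t)]
      nlinarith [sq_nonneg ‖y t - h t‖, sq_nonneg ‖z t - h t‖, sq_nonneg ‖z t‖]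
    have h5 := mul_le_mul_of_nonneg_left h1 (Real.exp_pos (-t)).le
    linarith
  have hle := hanti (mem_Ici.2 le_rfl) ht ht
  simp only [F, neg_zero, Real.exp_zero, one_mul, intervalIntegral.integral_same, mul_zero,
    sub_zero] at hle
  have hexp : Real.exp t * Real.exp (-t) = 1 := by rw [← Real.exp_add, add_neg_cancel,
    Real.exp_zero]
  have h6 := mul_le_mul_of_nonneg_left hle (Real.exp_pos t).le
  rw [mul_sub, ← mul_assoc, hexp, one_mul] at h6
  rw [mul_add]
  linarith

theorem inner_eq_add_integral {y z h : ℝ → H} (hyz : ∀ s, (y s, z s) ∈ A.graph)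
    (hyc : Continuous y) (hzc : Continuous z) (hh : Continuous h)
    (hy : ∀ t, 0 < t → HasDerivAt y (h t - z t) t)
    (hz : ∀ t, 0 < t → DifferentiableAt ℝ z t) {t : ℝ} (ht : 0 ≤ t) :
    ⟪z t, y t⟫ = ⟪z 0, y 0⟫ + ∫ s in (0 : ℝ)..t, 2 * ⟪z s, h s - z s⟫ := by
  rw [intervalIntegral.integral_eq_sub_of_hasDerivAt_of_le ht (hzc.inner hyc).continuousOn
    (fun s hs => hasDerivAt_inner_of_mem_graph hA hyz (hy s hs.1) (hz s hs.1).hasDerivAt)]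
  · ring
  · exact (continuous_const.mul (hzc.inner (hh.sub hzc))).intervalIntegrable _ _

end Energy

/-! ### Regularization of weak solutions and continuity in `D(A^{1/2})`. -/

section Regularization

/-- The regularizing operators `(1 + A / (n + 1))⁻²`. -/
noncomputable def reg (A : H →ₗ.[ℝ] H) (n : ℕ) : H →L[ℝ] H :=
  (res A (1 / ((n : ℝ) + 1))).comp (res A (1 / ((n : ℝ) + 1)))

/-- The bounded operators `A (1 + A / (n + 1))⁻²`. -/
noncomputable def regA (A : H →ₗ.[ℝ] H) (n : ℕ) : H →L[ℝ] H :=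
  (yosida A (1 / ((n : ℝ) + 1))).comp (res A (1 / ((n : ℝ) + 1)))

theorem one_div_nat_pos (n : ℕ) : (0 : ℝ) < 1 / ((n : ℝ) + 1) := Nat.one_div_pos_of_nat

variable (hA : IsSelfAdjoint A) (hA0 : IsNonneg A)
include hA hA0

theorem reg_mem_graph (n : ℕ) (x : H) : (reg A n x, regA A n x) ∈ A.graph :=
  res_mem_graph hA hA0 (one_div_nat_pos n) _

theorem norm_reg_le (n : ℕ) (x : H) : ‖reg A n x‖ ≤ ‖x‖ :=
  (norm_res_le hA hA0 (one_div_nat_pos n) _).trans (norm_res_le hA hA0 (one_div_nat_pos n) _)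

theorem tendsto_reg (x : H) : Tendsto (fun n => reg A n x) atTop (𝓝 x) := by
  have h1 := tendsto_res_seq hA hA0 x
  have h2 : Tendsto (fun n : ℕ => res A (1 / ((n : ℝ) + 1)) (res A (1 / ((n : ℝ) + 1)) x - x))
      atTop (𝓝 0) := by
    refine squeeze_zero_norm (fun n => norm_res_le hA hA0 (one_div_nat_pos n) _) ?_
    simpa using (h1.sub_const x).norm
  have h3 := h2.add h1
  rw [zero_add] at h3
  refine h3.congr fun n => ?_
  rw [map_sub]
  exact sub_add_cancel _ _

theorem regA_eq_of_mem_graph {x y : H} (h : (x, y) ∈ A.graph) (n : ℕ) :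
    regA A n x = reg A n y :=
  yosida_eq_res_of_mem_graph hA hA0 (one_div_nat_pos n) (res_map_mem_graph hA hA0
    (one_div_nat_pos n) h)

theorem HalfDomain.exists_reg (n : ℕ) (v : HalfDomain A) :
    ∃ v' : HalfDomain A, val v' = reg A n (val v) ∧ half v' = reg A n (half v) := by
  obtain ⟨v', h1, h2⟩ := exists_res hA hA0 (one_div_nat_pos n) v
  obtain ⟨v'', h3, h4⟩ := exists_res hA hA0 (one_div_nat_pos n) v'
  exact ⟨v'', by rw [h3, h1]; rfl, by rw [h4, h2]; rfl⟩

theorem inner_regA_eq (n : ℕ) (v : HalfDomain A) :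
    ⟪regA A n (val v), reg A n (val v)⟫ = ‖reg A n (half v)‖ ^ 2 := by
  obtain ⟨v', h1, h2⟩ := HalfDomain.exists_reg hA hA0 n v
  have h3 := reg_mem_graph hA hA0 n (val v)
  rw [← h1] at h3
  rw [← h2, norm_sq_half_of_mem_graph hA hA0 h3, h1]

omit hA hA0 [CompleteSpace H] in
theorem IsWeakSol.sub {g₁ g₂ w₁ w₂ : ℝ → H} (hg₁ : Continuous g₁) (hg₂ : Continuous g₂)
    (hw₁ : Continuous w₁) (hw₂ : Continuous w₂) (h₁ : IsWeakSol A g₁ w₁)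
    (h₂ : IsWeakSol A g₂ w₂) : IsWeakSol A (fun t => g₁ t - g₂ t) (fun t => w₁ t - w₂ t) := by
  intro l hl t ht
  have hc : ∀ {g w : ℝ → H}, Continuous g → Continuous w →
      IntervalIntegrable (fun s => res A l (g s) - yosida A l (w s)) volume 0 t := fun hg hw =>
    (((res A l).continuous.comp hg).sub ((yosida A l).continuous.comp hw)).intervalIntegrable _ _
  rw [map_sub, map_sub, h₁ l hl t ht, h₂ l hl t ht, add_sub_add_comm,
    ← intervalIntegral.integral_sub (hc hg₁ hw₁) (hc hg₂ hw₂)]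
  congr 2
  funext s
  rw [map_sub, map_sub]
  abel

omit hA hA0 in
theorem IsWeakSol.hasDerivAt {g w : ℝ → H} (hg : Continuous g) (hw : Continuous w)
    (h : IsWeakSol A g w) {l : ℝ} (hl : 0 < l) {t : ℝ} (ht : 0 < t) :
    HasDerivAt (fun s => res A l (w s)) (res A l (g t) - yosida A l (w t)) t := by
  have hc : Continuous fun s => res A l (g s) - yosida A l (w s) :=
    ((res A l).continuous.comp hg).sub ((yosida A l).continuous.comp hw)
  refine ((hc.integral_hasStrictDerivAt 0 t).hasDerivAt.const_add (res A l (w 0))).congr_of_eventuallyEq ?_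
  filter_upwards [lt_mem_nhds ht] with s hs
  exact h l hl s hs.le

theorem IsWeakSol.hasDerivAt_reg {g w : ℝ → H} (hg : Continuous g) (hw : Continuous w)
    (h : IsWeakSol A g w) (n : ℕ) {t : ℝ} (ht : 0 < t) :
    HasDerivAt (fun s => reg A n (w s)) (reg A n (g t) - regA A n (w t)) t := by
  have hl := one_div_nat_pos n
  have := (res A (1 / ((n : ℝ) + 1))).hasFDerivAt.comp_hasDerivAt t (h.hasDerivAt hg hw hl ht)
  rwa [map_sub, ← yosida_res_comm hA hA0 hl hl] at this

-- The reason for two resolvents in `reg`: one makes the weak solution differentiable in time, the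
-- other puts it in `D(A)` and turns `A` into a bounded operator.
omit hA hA0 in
theorem IsWeakSol.differentiableAt_regA {g w : ℝ → H} (hg : Continuous g) (hw : Continuous w)
    (h : IsWeakSol A g w) (n : ℕ) {t : ℝ} (ht : 0 < t) :
    DifferentiableAt ℝ (fun s => regA A n (w s)) t :=
  ((yosida A (1 / ((n : ℝ) + 1))).hasFDerivAt.comp_hasDerivAt t
    (h.hasDerivAt hg hw (one_div_nat_pos n) ht)).differentiableAt

/-- The regularizations of the `H`-valued weak solution are locally uniformly Cauchy in
`D(A^{1/2})`, by the energy estimate applied to their differences. -/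
theorem exists_continuous_weakSol {g : ℝ → H} (hg : Continuous g) (u₀ : HalfDomain A) :
    ∃ u : ℝ → HalfDomain A, Continuous u ∧ u 0 = u₀ ∧ IsWeakSol A g (fun t => val (u t)) := by
  have _ : CompleteSpace (HalfDomain A) := HalfDomain.completeSpace hA hA0
  obtain ⟨w, hw, hw0, hweak⟩ := exists_isWeakSol hA hA0 hg u₀
  choose v hv hvn using fun n t => exists_val_of_mem_graph hA hA0 (reg_mem_graph hA hA0 n (w t))
  have hdiff : ∀ n m s t, ‖v n t - v m s‖ ^ 2 = ‖reg A n (w t) - reg A m (w s)‖ ^ 2 +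
      ⟪regA A n (w t) - regA A m (w s), reg A n (w t) - reg A m (w s)⟫ := by
    intro n m s t
    have h1 : val (v n t - v m s) = reg A n (w t) - reg A m (w s) := by
      rw [map_sub, hv, hv]
    have h2 : (val (v n t - v m s), regA A n (w t) - regA A m (w s)) ∈ A.graph := by
      rw [h1]
      exact A.graph.sub_mem (reg_mem_graph hA hA0 n (w t)) (reg_mem_graph hA hA0 m (w s))
    rw [norm_sq_eq, norm_sq_half_of_mem_graph hA hA0 h2, h1]
  have hregc : ∀ n, Continuous fun t => reg A n (w t) := fun n => (reg A n).continuous.comp hw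
  have hregAc : ∀ n, Continuous fun t => regA A n (w t) := fun n => (regA A n).continuous.comp hw
  have hreggc : ∀ n, Continuous fun t => reg A n (g t) := fun n => (reg A n).continuous.comp hg
  have hvc : ∀ n, Continuous (v n) := by
    intro n
    refine continuous_iff_continuousAt.2 fun s => ?_
    rw [ContinuousAt, tendsto_iff_norm_sub_tendsto_zero]
    have h1 : Tendsto (fun t => ‖v n t - v n s‖ ^ 2) (𝓝 s) (𝓝 0) := by
      have h2 : Continuous fun t => ‖reg A n (w t) - reg A n (w s)‖ ^ 2 +
          ⟪regA A n (w t) - regA A n (w s), reg A n (w t) - reg A n (w s)⟫ :=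
        (((hregc n).sub continuous_const).norm.pow 2).add
          (((hregAc n).sub continuous_const).inner ((hregc n).sub continuous_const))
      simp only [hdiff]
      simpa using h2.tendsto s
    simpa using h1.sqrt
  -- Here `u₀ ∈ D(A^{1/2})` matters: the regularizations commute with `A^{1/2}`, so the initial data
  -- converge in the graph norm.
  have hv0 : Tendsto (fun n => ‖v n 0 - u₀‖ ^ 2) atTop (𝓝 0) := by
    have h1 : ∀ n, ‖v n 0 - u₀‖ ^ 2 =
        ‖reg A n (val u₀) - val u₀‖ ^ 2 + ‖reg A n (half u₀) - half u₀‖ ^ 2 := by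
      intro n
      obtain ⟨v', h1, h2⟩ := HalfDomain.exists_reg hA hA0 n u₀
      have h3 : v n 0 = v' := val_injective (by rw [hv, h1, hw0])
      rw [norm_sq_eq, map_sub, map_sub, h3, h1, h2]
    have h2 : ∀ x : H, Tendsto (fun n => ‖reg A n x - x‖ ^ 2) atTop (𝓝 0) := fun x => by
      simpa using ((((tendsto_reg hA hA0 x).sub_const x).norm).pow 2)
    simp only [h1]
    simpa using (h2 (val u₀)).add (h2 (half u₀))
  have hsq : ∀ {E : Type _} [SeminormedAddCommGroup E] (a b c : E),
      ‖a - b‖ ^ 2 ≤ 2 * (‖a - c‖ ^ 2 + ‖b - c‖ ^ 2) := by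
    intro E _ a b c
    have h1 : ‖a - b‖ ≤ ‖a - c‖ + ‖b - c‖ := by
      rw [← sub_sub_sub_cancel_right a b c]
      exact norm_sub_le _ _
    have h2 := pow_le_pow_left₀ (norm_nonneg _) h1 2
    nlinarith [sq_nonneg (‖a - c‖ - ‖b - c‖)]
  obtain ⟨u, hu, hlim⟩ := exists_continuous_limit hvc fun T hT => by
    refine ⟨fun n => Real.exp T * (2 * ‖v n 0 - u₀‖ ^ 2 +
      4 * ∫ s in (0 : ℝ)..T, ‖reg A n (g s) - g s‖ ^ 2), ?_, fun n m t ht => ?_⟩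
    · have h1 : Tendsto (fun n => ∫ s in (0 : ℝ)..T, ‖reg A n (g s) - g s‖ ^ 2) atTop
          (𝓝 (∫ s in (0 : ℝ)..T, 0)) := by
        refine intervalIntegral.tendsto_integral_filter_of_dominated_convergence
          (fun s => (2 * ‖g s‖) ^ 2) ?_ ?_ ?_ ?_
        · exact .of_forall fun n => (((hreggc n).sub hg).norm.pow 2).aestronglyMeasurable
        · refine .of_forall fun n => .of_forall fun s _ => ?_
          rw [Real.norm_of_nonneg (by positivity)]
          refine pow_le_pow_left₀ (norm_nonneg _) ?_ 2
          have := norm_sub_le (reg A n (g s)) (g s)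
          have := norm_reg_le hA hA0 n (g s)
          linarith
        · exact ((continuous_const.mul hg.norm).pow 2).intervalIntegrable _ _
        · refine .of_forall fun s _ => ?_
          simpa using ((((tendsto_reg hA hA0 (g s)).sub_const (g s)).norm).pow 2)
      rw [intervalIntegral.integral_zero] at h1
      simpa using ((hv0.const_mul 2).add (h1.const_mul 4)).const_mul (Real.exp T)
    · have h1 := norm_sq_add_inner_le hA hA0 (y := fun s => reg A n (w s) - reg A m (w s))
        (z := fun s => regA A n (w s) - regA A m (w s))
        (h := fun s => reg A n (g s) - reg A m (g s))
        (fun s => A.graph.sub_mem (reg_mem_graph hA hA0 n (w s)) (reg_mem_graph hA hA0 m (w s)))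
        ((hregc n).sub (hregc m)) ((hregAc n).sub (hregAc m)) ((hreggc n).sub (hreggc m))
        (fun s hs => by
          have := (hweak.hasDerivAt_reg hA hA0 hg hw n hs).sub
            (hweak.hasDerivAt_reg hA hA0 hg hw m hs)
          rwa [sub_sub_sub_comm] at this)
        (fun s hs => (hweak.differentiableAt_regA hg hw n hs).sub
          (hweak.differentiableAt_regA hg hw m hs)) ht.1
      have h2 : ∫ s in (0 : ℝ)..t, Real.exp (-s) * ‖reg A n (g s) - reg A m (g s)‖ ^ 2 ≤
          2 * (∫ s in (0 : ℝ)..T, ‖reg A n (g s) - g s‖ ^ 2) +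
          2 * ∫ s in (0 : ℝ)..T, ‖reg A m (g s) - g s‖ ^ 2 := by
        have hc : ∀ n, Continuous fun s => ‖reg A n (g s) - g s‖ ^ 2 := fun n =>
          ((hreggc n).sub hg).norm.pow 2
        have hc2 : ∀ n, Continuous fun s => 2 * ‖reg A n (g s) - g s‖ ^ 2 := fun n =>
          continuous_const.mul (hc n)
        have hc' : Continuous fun s =>
          2 * ‖reg A n (g s) - g s‖ ^ 2 + 2 * ‖reg A m (g s) - g s‖ ^ 2 :=
          (hc2 n).add (hc2 m)
        rw [← intervalIntegral.integral_const_mul, ← intervalIntegral.integral_const_mul,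
          ← intervalIntegral.integral_add ((hc2 n).intervalIntegrable _ _)
            ((hc2 m).intervalIntegrable _ _)]
        refine le_trans (intervalIntegral.integral_mono_on ht.1 ?_
          (hc'.intervalIntegrable 0 t) fun s hs => ?_)
          (intervalIntegral.integral_mono_interval le_rfl ht.1 ht.2
            (.of_forall fun s => by positivity) (hc'.intervalIntegrable 0 T))
        · exact ((Real.continuous_exp.comp continuous_neg).mul
            (((hreggc n).sub (hreggc m)).norm.pow 2)).intervalIntegrable _ _
        · have h3 : Real.exp (-s) ≤ 1 := Real.exp_le_one_iff.2 (by linarith [hs.1])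
          have h4 := hsq (reg A n (g s)) (reg A m (g s)) (g s)
          have h5 := sq_nonneg ‖reg A n (g s) - reg A m (g s)‖
          nlinarith
      have h3 : Real.exp t ≤ Real.exp T := Real.exp_le_exp.2 ht.2
      have h4 := hsq (v n 0) (v m 0) u₀
      rw [hdiff n m t t]
      refine h1.trans ?_
      rw [← mul_add]
      have h5 := hdiff n m 0 0
      have h6 : 0 ≤ ∫ s in (0 : ℝ)..t, Real.exp (-s) * ‖reg A n (g s) - reg A m (g s)‖ ^ 2 :=
        intervalIntegral.integral_nonneg ht.1 fun s _ => by positivity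
      refine mul_le_mul h3 ?_ ?_ (Real.exp_pos T).le
      · rw [← h5]
        linarith
      · rw [← h5]
        positivity
  have hval : ∀ t, 0 ≤ t → val (u t) = w t := fun t ht =>
    tendsto_nhds_unique ((continuous_val.tendsto _).comp (hlim t ht)) (by
      simpa only [Function.comp_def, hv] using tendsto_reg hA hA0 (w t))
  refine ⟨u, hu, val_injective (by rw [hval 0 le_rfl, hw0]), fun l hl t ht => ?_⟩
  simp only [hval t ht, hval 0 le_rfl]
  rw [hweak l hl t ht]
  congr 1
  refine intervalIntegral.integral_congr fun s hs => ?_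
  rw [uIcc_of_le ht] at hs
  simp only [hval s hs.1]

/-- The energy estimate for the regularized difference, with `n → ∞`. It controls the full
`D(A^{1/2})` norm by sources measured only in `H`, as Picard iteration requires. -/
theorem norm_sub_sq_le_of_isWeakSol {g₁ g₂ : ℝ → H} {u₁ u₂ : ℝ → HalfDomain A}
    (hg₁ : Continuous g₁) (hg₂ : Continuous g₂) (hu₁ : Continuous u₁) (hu₂ : Continuous u₂)
    (h₁ : IsWeakSol A g₁ fun t => val (u₁ t)) (h₂ : IsWeakSol A g₂ fun t => val (u₂ t))
    (h0 : u₁ 0 = u₂ 0) {t : ℝ} (ht : 0 ≤ t) :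
    ‖u₁ t - u₂ t‖ ^ 2 ≤
      2 * Real.exp t * ∫ s in (0 : ℝ)..t, Real.exp (-s) * ‖g₁ s - g₂ s‖ ^ 2 := by
  have hw₁ := continuous_val.comp hu₁
  have hw₂ := continuous_val.comp hu₂
  have hw := hw₁.sub hw₂
  have hg := hg₁.sub hg₂
  have hweak := h₁.sub hg₁ hg₂ hw₁ hw₂ h₂
  have hc : ∀ {k : ℝ → H}, Continuous k → Continuous fun s => Real.exp (-s) * ‖k s‖ ^ 2 :=
    fun hk => (Real.continuous_exp.comp continuous_neg).mul (hk.norm.pow 2)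
  have hbound : ∀ n, ‖reg A n (val (u₁ t - u₂ t))‖ ^ 2 + ‖reg A n (half (u₁ t - u₂ t))‖ ^ 2 ≤
      2 * Real.exp t * ∫ s in (0 : ℝ)..t, Real.exp (-s) * ‖g₁ s - g₂ s‖ ^ 2 := by
    intro n
    have h := norm_sq_add_inner_le hA hA0
      (y := fun s => reg A n (val (u₁ s) - val (u₂ s)))
      (z := fun s => regA A n (val (u₁ s) - val (u₂ s)))
      (h := fun s => reg A n (g₁ s - g₂ s)) (fun s => reg_mem_graph hA hA0 n _)
      ((reg A n).continuous.comp hw) ((regA A n).continuous.comp hw)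
      ((reg A n).continuous.comp hg)
      (fun s hs => hweak.hasDerivAt_reg hA hA0 hg hw n hs)
      (fun s hs => hweak.differentiableAt_regA hg hw n hs) ht
    rw [← inner_regA_eq hA hA0, map_sub val]
    refine h.trans ?_
    have h2 : ∫ s in (0 : ℝ)..t, Real.exp (-s) * ‖reg A n (g₁ s - g₂ s)‖ ^ 2 ≤
        ∫ s in (0 : ℝ)..t, Real.exp (-s) * ‖g₁ s - g₂ s‖ ^ 2 := by
      refine intervalIntegral.integral_mono_on ht
        ((hc ((reg A n).continuous.comp hg)).intervalIntegrable _ _)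
        ((hc hg).intervalIntegrable _ _) fun s _ => ?_
      exact mul_le_mul_of_nonneg_left
        (pow_le_pow_left₀ (norm_nonneg _) (norm_reg_le hA hA0 n _) 2) (Real.exp_pos _).le
    have h3 := mul_le_mul_of_nonneg_left h2 (Real.exp_pos t).le
    have h4 : val (u₁ 0) - val (u₂ 0) = 0 := by rw [h0, sub_self]
    simp only [h4, map_zero, norm_zero, inner_zero_left]
    linarith
  rw [norm_sq_eq]
  exact le_of_tendsto' ((((tendsto_reg hA hA0 _).norm).pow 2).add
    (((tendsto_reg hA hA0 _).norm).pow 2)) hbound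

end Regularization

end SlowSolutions

namespace SlowSolutions

open HalfDomain

/-! ### Truncation of the nonlinearity by a radial retraction. -/

section RadialRetraction

variable {E : Type*} [NormedAddCommGroup E] [NormedSpace ℝ E]

/-- The radial retraction onto the closed ball of radius `r` around `0`. -/
noncomputable def radialRetraction (r : ℝ) (x : E) : E := (r / max r ‖x‖) • x

theorem radialRetraction_of_norm_le {r : ℝ} (hr : 0 < r) {x : E} (hx : ‖x‖ ≤ r) :
    radialRetraction r x = x := by
  rw [radialRetraction, max_eq_left hx, div_self hr.ne', one_smul]

theorem norm_radialRetraction_le {r : ℝ} (hr : 0 < r) (x : E) : ‖radialRetraction r x‖ ≤ r := by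
  have h : 0 < max r ‖x‖ := lt_max_of_lt_left hr
  rw [radialRetraction, norm_smul, Real.norm_of_nonneg (by positivity), div_mul_eq_mul_div,
    div_le_iff₀ h]
  exact mul_le_mul_of_nonneg_left (le_max_right _ _) hr.le

theorem norm_radialRetraction_sub_le {r : ℝ} (hr : 0 < r) (x y : E) :
    ‖radialRetraction r x - radialRetraction r y‖ ≤ 2 * ‖x - y‖ := by
  unfold radialRetraction
  set a := max r ‖x‖
  set b := max r ‖y‖
  have ha : 0 < a := lt_max_of_lt_left hr
  have hb : 0 < b := lt_max_of_lt_left hr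
  have h1 : (r / a) • x - (r / b) • y = (r / a) • (x - y) + (r / a - r / b) • y := by
    rw [smul_sub, sub_smul]
    abel
  have h2 : ‖(r / a) • (x - y)‖ ≤ ‖x - y‖ := by
    rw [norm_smul, Real.norm_of_nonneg (by positivity)]
    exact mul_le_of_le_one_left (norm_nonneg _) ((div_le_one ha).2 (le_max_left _ _))
  have h3 : |b - a| ≤ ‖x - y‖ := by
    rw [norm_sub_rev]
    refine (abs_max_sub_max_le_max r ‖y‖ r ‖x‖).trans ?_
    rw [sub_self, abs_zero]
    exact max_le (norm_nonneg _) (abs_norm_sub_norm_le y x)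
  have h4 : ‖(r / a - r / b) • y‖ ≤ ‖x - y‖ := by
    have h5 : r / a - r / b = (r / a) * ((b - a) / b) := by
      field_simp
    rw [norm_smul, h5, norm_mul, Real.norm_of_nonneg (show 0 ≤ r / a by positivity), norm_div,
      Real.norm_of_nonneg hb.le, Real.norm_eq_abs, mul_assoc]
    refine (mul_le_of_le_one_left (by positivity) ((div_le_one ha).2 (le_max_left _ _))).trans ?_
    rw [div_mul_eq_mul_div]
    refine (div_le_of_le_mul₀ hb.le (abs_nonneg _)
      (mul_le_mul_of_nonneg_left (le_max_right _ _) (abs_nonneg _))).trans h3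
  rw [h1, two_mul]
  exact (norm_add_le _ _).trans (add_le_add h2 h4)

end RadialRetraction

variable {H : Type*} [NormedAddCommGroup H] [InnerProductSpace ℝ H] [CompleteSpace H]
  {A : H →ₗ.[ℝ] H}

theorem integral_exp_mul_le {c : ℝ} (hc : 0 < c) (t : ℝ) :
    ∫ s in (0 : ℝ)..t, Real.exp (c * s) ≤ Real.exp (c * t) / c := by
  have hder : ∀ s, HasDerivAt (fun s => Real.exp (c * s) / c) (Real.exp (c * s)) s := by
    intro s
    have := (((hasDerivAt_id s).const_mul c).exp).div_const c
    simpa [hc.ne'] using this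
  rw [intervalIntegral.integral_eq_sub_of_hasDerivAt (fun s _ => hder s)
    ((Real.continuous_exp.comp (continuous_const.mul continuous_id)).intervalIntegrable _ _)]
  have : 0 ≤ Real.exp (c * 0) / c := by positivity
  linarith

/-! ### Picard iteration for a globally Lipschitz nonlinearity. -/

section Picard

variable (hA : IsSelfAdjoint A) (hA0 : IsNonneg A) {F : HalfDomain A → H} {K : ℝ}
  (hF : ∀ u v, ‖F u - F v‖ ≤ K * ‖u - v‖)
include hA hA0 hF

/-- The weight `e^{(2+8K²)t}` is chosen so that the constant `2K²/(1+8K²)` produced by the estimate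
is at most `1/4`. -/
theorem picard_step (hFc : Continuous F) {u₁ u₂ v₁ v₂ : ℝ → HalfDomain A}
    (hu₁ : Continuous u₁) (hu₂ : Continuous u₂) (hv₁ : Continuous v₁) (hv₂ : Continuous v₂)
    (h₁ : IsWeakSol A (fun t => F (u₁ t)) fun t => val (v₁ t))
    (h₂ : IsWeakSol A (fun t => F (u₂ t)) fun t => val (v₂ t)) (h0 : v₁ 0 = v₂ 0)
    {M t : ℝ} (ht : 0 ≤ t)
    (hM : ∀ s ∈ Icc 0 t, ‖u₁ s - u₂ s‖ ^ 2 ≤ M * Real.exp ((2 + 8 * K ^ 2) * s)) :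
    ‖v₁ t - v₂ t‖ ^ 2 ≤ M / 4 * Real.exp ((2 + 8 * K ^ 2) * t) := by
  set c : ℝ := 1 + 8 * K ^ 2 with hc
  have hcpos : 0 < c := by positivity
  have hM0 : 0 ≤ M := by
    have := (sq_nonneg _).trans (hM 0 ⟨le_rfl, ht⟩)
    simpa using this
  have h := norm_sub_sq_le_of_isWeakSol hA hA0 (hFc.comp hu₁) (hFc.comp hu₂) hv₁ hv₂ h₁ h₂ h0 ht
  have hint : ∫ s in (0 : ℝ)..t, Real.exp (-s) * ‖F (u₁ s) - F (u₂ s)‖ ^ 2 ≤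
      ∫ s in (0 : ℝ)..t, (K ^ 2 * M) * Real.exp (c * s) := by
    refine intervalIntegral.integral_mono_on ht ?_ ?_ fun s hs => ?_
    · exact ((Real.continuous_exp.comp continuous_neg).mul
        (((hFc.comp hu₁).sub (hFc.comp hu₂)).norm.pow 2)).intervalIntegrable _ _
    · exact (continuous_const.mul (Real.continuous_exp.comp
        (continuous_const.mul continuous_id))).intervalIntegrable _ _
    · have h1 : ‖F (u₁ s) - F (u₂ s)‖ ^ 2 ≤ K ^ 2 * (M * Real.exp ((2 + 8 * K ^ 2) * s)) := by
        refine (pow_le_pow_left₀ (norm_nonneg _) (hF _ _) 2).trans ?_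
        rw [mul_pow]
        exact mul_le_mul_of_nonneg_left (hM s hs) (sq_nonneg K)
      have h2 : Real.exp (-s) * Real.exp ((2 + 8 * K ^ 2) * s) = Real.exp (c * s) := by
        rw [← Real.exp_add]
        congr 1
        rw [hc]
        ring
      calc _ ≤ Real.exp (-s) * (K ^ 2 * (M * Real.exp ((2 + 8 * K ^ 2) * s))) :=
            mul_le_mul_of_nonneg_left h1 (Real.exp_pos _).le
        _ = (K ^ 2 * M) * (Real.exp (-s) * Real.exp ((2 + 8 * K ^ 2) * s)) := by ring
        _ = _ := by rw [h2]
  rw [intervalIntegral.integral_const_mul] at hint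
  have h3 : Real.exp t * Real.exp (c * t) = Real.exp ((2 + 8 * K ^ 2) * t) := by
    rw [← Real.exp_add]
    congr 1
    rw [hc]
    ring
  have h4 : 2 * (K ^ 2 * M) / c ≤ M / 4 := by
    rw [div_le_div_iff₀ hcpos (by norm_num), hc]
    nlinarith
  calc _ ≤ 2 * Real.exp t * ((K ^ 2 * M) * (Real.exp (c * t) / c)) := by
        refine h.trans (mul_le_mul_of_nonneg_left (hint.trans ?_) (by positivity))
        exact mul_le_mul_of_nonneg_left (integral_exp_mul_le hcpos t) (by positivity)
    _ = 2 * (K ^ 2 * M) / c * (Real.exp t * Real.exp (c * t)) := by ring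
    _ ≤ _ := by
      rw [h3]
      exact mul_le_mul_of_nonneg_right h4 (Real.exp_pos _).le

theorem exists_global_weakSol (u₀ : HalfDomain A) :
    ∃ u : ℝ → HalfDomain A, Continuous u ∧ u 0 = u₀ ∧
      IsWeakSol A (fun t => F (u t)) fun t => val (u t) := by
  have _ : CompleteSpace (HalfDomain A) := HalfDomain.completeSpace hA hA0
  have hFc : Continuous F := (LipschitzWith.of_dist_le' (K := K) fun u v => by
    simpa [dist_eq_norm] using hF u v).continuous
  choose! S hSc hS0 hS using fun u : ℝ → HalfDomain A => fun hu : Continuous u =>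
    exists_continuous_weakSol hA hA0 (hFc.comp hu) u₀
  let U : ℕ → ℝ → HalfDomain A := fun n => S^[n] fun _ => u₀
  have hUsucc : ∀ n, U (n + 1) = S (U n) := fun n => Function.iterate_succ_apply' S n _
  have hUc : ∀ n, Continuous (U n) := by
    intro n
    induction n with
    | zero => exact continuous_const
    | succ n ih =>
      rw [hUsucc]
      exact hSc _ ih
  have hU0 : ∀ n, U n 0 = u₀ := by
    intro n
    cases n with
    | zero => rfl
    | succ n =>
      rw [hUsucc]
      exact hS0 _ (hUc n)
  have hUweak : ∀ n, IsWeakSol A (fun t => F (U n t)) fun t => val (U (n + 1) t) := by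
    intro n
    rw [hUsucc]
    exact hS _ (hUc n)
  set k : ℝ := 2 + 8 * K ^ 2
  have hk : 0 ≤ k := by positivity
  have hstep : ∀ T, ∃ M, 0 ≤ M ∧ ∀ n, ∀ t ∈ Icc 0 T,
      ‖U (n + 1) t - U n t‖ ^ 2 ≤ M * (1 / 4) ^ n * Real.exp (k * t) := by
    intro T
    obtain ⟨M, hM⟩ := (isCompact_Icc (a := (0 : ℝ)) (b := T)).exists_bound_of_continuousOn
      (((hUc 1).sub (hUc 0)).norm.pow 2).continuousOn
    refine ⟨max M 0, le_max_right _ _, fun n => ?_⟩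
    induction n with
    | zero =>
      intro t ht
      have h1 : ‖U (0 + 1) t - U 0 t‖ ^ 2 ≤ M := (le_abs_self _).trans (hM t ht)
      have h2 : 1 ≤ Real.exp (k * t) := Real.one_le_exp (mul_nonneg hk ht.1)
      rw [pow_zero, mul_one]
      exact (h1.trans (le_max_left M 0)).trans (le_mul_of_one_le_right (le_max_right M 0) h2)
    | succ n ih =>
      intro t ht
      refine (picard_step hA hA0 hF hFc (hUc (n + 1)) (hUc n) (hUc (n + 2)) (hUc (n + 1))
        (hUweak (n + 1)) (hUweak n) (by rw [hU0, hU0]) ht.1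
        fun s hs => ih s ⟨hs.1, hs.2.trans ht.2⟩).trans_eq ?_
      simp only [k]
      ring
  have hcauchy : ∀ T, 0 ≤ T → ∃ ε : ℕ → ℝ, Tendsto ε atTop (𝓝 0) ∧
      ∀ n m, ∀ t ∈ Icc 0 T, ‖U n t - U m t‖ ^ 2 ≤ ε n + ε m := by
    intro T hT
    obtain ⟨M, hM0, hM⟩ := hstep T
    set C : ℝ := √(M * Real.exp (k * T))
    -- Squared distances contract by `1/4`, hence distances by `1/2`.
    have hgeo : ∀ n, ∀ t ∈ Icc 0 T, dist (U n t) (U (n + 1) t) ≤ C * (1 / 2) ^ n := by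
      intro n t ht
      rw [dist_comm, dist_eq_norm]
      refine le_of_sq_le_sq ((hM n t ht).trans ?_)
        (mul_nonneg (Real.sqrt_nonneg _) (by positivity))
      rw [mul_pow, Real.sq_sqrt (by positivity), ← pow_mul, mul_comm n 2, pow_mul]
      have h1 : Real.exp (k * t) ≤ Real.exp (k * T) :=
        Real.exp_le_exp.2 (mul_le_mul_of_nonneg_left ht.2 hk)
      calc _ = M * Real.exp (k * t) * (1 / 4) ^ n := by ring
        _ ≤ M * Real.exp (k * T) * (1 / 4) ^ n := by gcongr
        _ = _ := by norm_num
    have hlt : (1 / 2 : ℝ) < 1 := by norm_num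
    have hlim : ∀ t ∈ Icc 0 T, ∃ w, Tendsto (fun n => U n t) atTop (𝓝 w) := fun t ht =>
      cauchySeq_tendsto_of_complete
        (cauchySeq_of_le_geometric (1 / 2) C hlt fun n => hgeo n t ht)
    refine ⟨fun n => 2 * (C * (1 / 2) ^ n / (1 - 1 / 2)) ^ 2, ?_, fun n m t ht => ?_⟩
    · have := (((((tendsto_pow_atTop_nhds_zero_of_lt_one (by norm_num) hlt).const_mul C).div_const
        (1 - 1 / 2)).pow 2).const_mul 2)
      simpa using this
    · obtain ⟨w, hw⟩ := hlim t ht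
      have h1 := dist_le_of_le_geometric_of_tendsto (1 / 2) C hlt (fun n => hgeo n t ht) hw n
      have h2 := dist_le_of_le_geometric_of_tendsto (1 / 2) C hlt (fun n => hgeo n t ht) hw m
      rw [← dist_eq_norm]
      have h3 := dist_triangle_right (U n t) (U m t) w
      have h4 := pow_le_pow_left₀ dist_nonneg (h3.trans (add_le_add h1 h2)) 2
      refine h4.trans ?_
      nlinarith [sq_nonneg (C * (1 / 2) ^ n / (1 - 1 / 2) - C * (1 / 2) ^ m / (1 - 1 / 2))]
  obtain ⟨u, hu, hlim⟩ := exists_continuous_limit hUc hcauchy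
  -- Only nonnegative times are controlled, so `u` is a fixed point of `S` just there; the weak
  -- formulation sees no other times.
  have hfix : ∀ t, 0 ≤ t → S u t = u t := by
    intro t ht
    obtain ⟨ε, hε, hle⟩ := hcauchy t ht
    have h1 : ∀ n, ∀ s ∈ Icc 0 t, ‖U n s - u s‖ ^ 2 ≤ ε n := by
      intro n s hs
      have h2 : Tendsto (fun m => ε n + ε m) atTop (𝓝 (ε n + 0)) := hε.const_add _
      rw [add_zero] at h2
      exact le_of_tendsto_of_tendsto' ((tendsto_const_nhds.sub (hlim s hs.1)).norm.pow 2) h2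
        fun m => hle n m s hs
    have h2 : ∀ n, ‖U (n + 1) t - S u t‖ ^ 2 ≤ ε n / 4 * Real.exp (k * t) := by
      intro n
      rw [hUsucc]
      refine picard_step hA hA0 hF hFc (hUc n) hu (hSc _ (hUc n)) (hSc _ hu) (hS _ (hUc n))
        (hS _ hu) (by rw [hS0 _ (hUc n), hS0 _ hu]) ht fun s hs => ?_
      refine (h1 n s hs).trans (le_mul_of_one_le_right ((sq_nonneg _).trans (h1 n s hs)) ?_)
      exact Real.one_le_exp (mul_nonneg hk hs.1)
    have h3 : ‖u t - S u t‖ ^ 2 ≤ 0 := by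
      refine le_of_tendsto_of_tendsto'
        (((((hlim t ht).comp (tendsto_add_atTop_nat 1)).sub_const (S u t)).norm).pow 2) ?_ h2
      simpa using (hε.div_const 4).mul_const (Real.exp (k * t))
    have h4 : ‖u t - S u t‖ = 0 := by
      have := le_antisymm h3 (sq_nonneg _)
      simpa using this
    exact (sub_eq_zero.1 (norm_eq_zero.1 h4)).symm
  refine ⟨u, hu, ?_, fun l hl t ht => ?_⟩
  · rw [← hfix 0 le_rfl, hS0 u hu]
  · have h := hS u hu l hl t ht
    simp only [hfix t ht, hfix 0 le_rfl] at h
    refine h.trans ?_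
    congr 1
    refine intervalIntegral.integral_congr fun s hs => ?_
    rw [uIcc_of_le ht] at hs
    simp only [hfix s hs.1]
    rfl

end Picard

end SlowSolutions

namespace SlowSolutions

open HalfDomain

variable {H : Type*} [NormedAddCommGroup H] [InnerProductSpace ℝ H] [CompleteSpace H]
  {A : H →ₗ.[ℝ] H}

/-! ### Weak solutions are strong. -/

section Regularity

omit [CompleteSpace H] in
theorem abs_two_mul_inner_sub_le {x y a b : H} (hx : ‖x‖ ≤ ‖a‖) (hy : ‖y‖ ≤ ‖b‖) :
    |2 * ⟪x, y - x⟫| ≤ 3 * ‖a‖ ^ 2 + ‖b‖ ^ 2 := by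
  rw [abs_mul, abs_two]
  have h1 := abs_real_inner_le_norm x (y - x)
  have h2 : ‖y - x‖ ≤ ‖b‖ + ‖a‖ := (norm_sub_le y x).trans (add_le_add hy hx)
  have h3 := mul_le_mul hx h2 (norm_nonneg _) (norm_nonneg _)
  nlinarith [sq_nonneg (‖a‖ - ‖b‖)]

variable (hA : IsSelfAdjoint A) (hA0 : IsNonneg A)
include hA hA0

/-- The energy identity for `|A^{1/2}u|²`, with `2⟨z, y - z⟩ ≤ ‖y‖² - ‖z‖²`, bounds `Au` in `L²`
uniformly in the regularization. -/
theorem integral_norm_sq_regA_le {g : ℝ → H} {u : ℝ → HalfDomain A} (hg : Continuous g)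
    (hu : Continuous u) (h : IsWeakSol A g fun t => val (u t)) (n : ℕ) {t : ℝ} (ht : 0 ≤ t) :
    ∫ s in (0 : ℝ)..t, ‖regA A n (val (u s))‖ ^ 2 ≤
      ‖half (u 0)‖ ^ 2 + ∫ s in (0 : ℝ)..t, ‖g s‖ ^ 2 := by
  have hw := continuous_val.comp hu
  have hz : Continuous fun s => regA A n (val (u s)) := (regA A n).continuous.comp hw
  have hrg : Continuous fun s => reg A n (g s) := (reg A n).continuous.comp hg
  have h1 := inner_eq_add_integral hA (fun s => reg_mem_graph hA hA0 n (val (u s)))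
    ((reg A n).continuous.comp hw) hz hrg
    (fun s hs => h.hasDerivAt_reg hA hA0 hg hw n hs)
    (fun s hs => h.differentiableAt_regA hg hw n hs) ht
  rw [inner_regA_eq hA hA0, inner_regA_eq hA hA0] at h1
  have h2 : ∫ s in (0 : ℝ)..t, 2 * ⟪regA A n (val (u s)), reg A n (g s) - regA A n (val (u s))⟫ ≤
      ∫ s in (0 : ℝ)..t, (‖g s‖ ^ 2 - ‖regA A n (val (u s))‖ ^ 2) := by
    refine intervalIntegral.integral_mono_on ht
      ((continuous_const.mul (hz.inner (hrg.sub hz))).intervalIntegrable _ _)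
      (((hg.norm.pow 2).sub (hz.norm.pow 2)).intervalIntegrable _ _) fun s _ => ?_
    have h3 := norm_sub_sq_real (regA A n (val (u s))) (reg A n (g s))
    have h4 := pow_le_pow_left₀ (norm_nonneg _) (norm_reg_le hA hA0 n (g s)) 2
    rw [inner_sub_right, real_inner_self_eq_norm_sq]
    nlinarith [sq_nonneg ‖regA A n (val (u s)) - reg A n (g s)‖]
  have h5 := intervalIntegral.integral_sub ((hg.norm.pow 2).intervalIntegrable (μ := volume) 0 t)
    ((hz.norm.pow 2).intervalIntegrable 0 t)
  simp only [Pi.pow_apply] at h5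
  rw [h5] at h2
  have h6 := pow_le_pow_left₀ (norm_nonneg _) (norm_reg_le hA hA0 n (half (u 0))) 2
  have h7 := sq_nonneg ‖reg A n (half (u t))‖
  linarith

/-- Weak solutions are strong solutions. -/
theorem IsWeakSol.exists_strong {g : ℝ → H} {u : ℝ → HalfDomain A} (hg : Continuous g)
    (hu : Continuous u) (h : IsWeakSol A g fun t => val (u t)) {T : ℝ} (hT : 0 ≤ T) :
    ∃ a : ℝ → H, MemLp a 2 (volume.restrict (Ioc 0 T)) ∧
      (∀ᵐ t ∂(volume.restrict (Ioc 0 T)), (val (u t), a t) ∈ A.graph) ∧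
      (∀ t ∈ Icc 0 T, val (u t) = val (u 0) + ∫ s in (0 : ℝ)..t, (g s - a s)) ∧
      ∀ t ∈ Icc 0 T,
        ‖half (u t)‖ ^ 2 = ‖half (u 0)‖ ^ 2 + ∫ s in (0 : ℝ)..t, 2 * ⟪a s, g s - a s⟫ := by
  classical
  set μ : Measure ℝ := volume.restrict (Ioc 0 T) with hμ
  have hw : Continuous fun t => val (u t) := continuous_val.comp hu
  have hz : ∀ n, Continuous fun s => regA A n (val (u s)) := fun n =>
    (regA A n).continuous.comp hw
  have hrg : ∀ n, Continuous fun s => reg A n (g s) := fun n => (reg A n).continuous.comp hg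
  set C : ℝ := ‖half (u 0)‖ ^ 2 + ∫ s in (0 : ℝ)..T, ‖g s‖ ^ 2
  have hmeas : ∀ n, Measurable fun s => ENNReal.ofReal (‖regA A n (val (u s))‖ ^ 2) := fun n =>
    ((hz n).norm.pow 2).measurable.ennreal_ofReal
  have hlint : ∀ n, ∫⁻ s, ENNReal.ofReal (‖regA A n (val (u s))‖ ^ 2) ∂μ ≤ ENNReal.ofReal C := by
    intro n
    rw [← ofReal_integral_eq_lintegral_ofReal, hμ, ← intervalIntegral.integral_of_le hT]
    · exact ENNReal.ofReal_le_ofReal (integral_norm_sq_regA_le hA hA0 hg hu h n hT)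
    · exact (((hz n).norm.pow 2).integrableOn_Icc).mono_set Ioc_subset_Icc_self
    · exact .of_forall fun s => by positivity
  -- By Fatou the `liminf` is finite almost everywhere; at such times the regularized `Au` is
  -- bounded along a subsequence, which gives `u(s) ∈ D(A)`.
  have hfatou : ∫⁻ s, liminf (fun n => ENNReal.ofReal (‖regA A n (val (u s))‖ ^ 2)) atTop ∂μ ≤
      ENNReal.ofReal C :=
    (lintegral_liminf_le hmeas).trans (liminf_le_of_le (by isBoundedDefault) fun b hb =>
      let ⟨n, hn⟩ := hb.exists; hn.trans (hlint n))
  have hfin : ∀ᵐ s ∂μ,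
      liminf (fun n => ENNReal.ofReal (‖regA A n (val (u s))‖ ^ 2)) atTop < ⊤ :=
    ae_lt_top (Measurable.liminf hmeas) (hfatou.trans_lt ENNReal.ofReal_lt_top).ne
  have hdom : ∀ᵐ s ∂μ, ∃ y, (val (u s), y) ∈ A.graph := by
    filter_upwards [hfin] with s hs
    obtain ⟨r, hr, hr'⟩ := exists_between hs
    have hfreq := frequently_lt_of_liminf_lt (by isBoundedDefault) hr
    refine exists_mem_graph_of_tendsto hA (C := √r.toReal)
      (fun n => reg_mem_graph hA hA0 n (val (u s))) (tendsto_reg hA hA0 _) (hfreq.mono fun n hn => ?_)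
    refine Real.le_sqrt_of_sq_le ?_
    exact (ENNReal.ofReal_le_iff_le_toReal hr'.ne).1 hn.le
  -- The value `0` is taken only on a null set.
  let a : ℝ → H := fun s => if hs : ∃ y, (val (u s), y) ∈ A.graph then hs.choose else 0
  have ha : ∀ᵐ s ∂μ, (val (u s), a s) ∈ A.graph := by
    filter_upwards [hdom] with s hs
    simp only [a, dif_pos hs]
    exact hs.choose_spec
  have hza : ∀ᵐ s ∂μ, ∀ n, regA A n (val (u s)) = reg A n (a s) := by
    filter_upwards [ha] with s hs n using regA_eq_of_mem_graph hA hA0 hs n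
  have hzlim : ∀ᵐ s ∂μ, Tendsto (fun n => regA A n (val (u s))) atTop (𝓝 (a s)) := by
    filter_upwards [hza] with s hs
    simp only [hs]
    exact tendsto_reg hA hA0 _
  -- Once `u(s) ∈ D(A)` is known, `a` itself dominates the approximations, so both integral
  -- identities pass to the limit by dominated convergence.
  have hzle : ∀ᵐ s ∂μ, ∀ n, ‖regA A n (val (u s))‖ ≤ ‖a s‖ := by
    filter_upwards [hza] with s hs n
    rw [hs]
    exact norm_reg_le hA hA0 n _
  have ham : AEStronglyMeasurable a μ :=
    aestronglyMeasurable_of_tendsto_ae atTop (fun n => (hz n).aestronglyMeasurable) hzlim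
  have haL2 : MemLp a 2 μ := by
    rw [memLp_two_iff_integrable_sq_norm ham]
    refine ⟨(ham.norm.pow 2), ?_⟩
    rw [hasFiniteIntegral_iff_ofReal (.of_forall fun s => by positivity)]
    refine lt_of_le_of_lt ?_ (hfatou.trans_lt ENNReal.ofReal_lt_top)
    refine lintegral_mono_ae ?_
    filter_upwards [hzlim] with s hs
    exact ((ENNReal.continuous_ofReal.tendsto _).comp ((hs.norm).pow 2)).liminf_eq.ge
  have hai : Integrable a μ := haL2.integrable one_le_two
  have hasq : Integrable (fun s => ‖a s‖ ^ 2) μ :=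
    (memLp_two_iff_integrable_sq_norm ham).1 haL2
  have hμ' : ∀ {p : ℝ → Prop}, (∀ᵐ s ∂μ, p s) → ∀ t ∈ Icc 0 T,
      ∀ᵐ s ∂volume, s ∈ uIoc 0 t → p s := by
    intro p hp t ht
    rw [hμ, ae_restrict_iff' measurableSet_Ioc] at hp
    filter_upwards [hp] with s hs hst
    rw [uIoc_of_le ht.1] at hst
    exact hs ⟨hst.1, hst.2.trans ht.2⟩
  have hii : ∀ {p : ℝ → ℝ}, Integrable p μ → ∀ t ∈ Icc 0 T, IntervalIntegrable p volume 0 t := by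
    intro p hp t ht
    rw [intervalIntegrable_iff_integrableOn_Ioc_of_le ht.1]
    exact IntegrableOn.mono_set hp (Ioc_subset_Ioc_right ht.2)
  refine ⟨a, haL2, ha, fun t ht => ?_, fun t ht => ?_⟩
  · have heq : ∀ n, reg A n (val (u t)) = reg A n (val (u 0)) +
        ∫ s in (0 : ℝ)..t, (reg A n (g s) - regA A n (val (u s))) := by
      intro n
      rw [intervalIntegral.integral_eq_sub_of_hasDerivAt_of_le ht.1
        (((reg A n).continuous.comp hw).continuousOn)
        (fun s hs => h.hasDerivAt_reg hA hA0 hg hw n hs.1)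
        (((hrg n).sub (hz n)).intervalIntegrable _ _)]
      simp
    have hlim : Tendsto (fun n => ∫ s in (0 : ℝ)..t, (reg A n (g s) - regA A n (val (u s))))
        atTop (𝓝 (∫ s in (0 : ℝ)..t, (g s - a s))) := by
      refine intervalIntegral.tendsto_integral_filter_of_dominated_convergence
        (fun s => ‖g s‖ + ‖a s‖) ?_ ?_ ?_ ?_
      · exact .of_forall fun n => ((hrg n).sub (hz n)).aestronglyMeasurable
      · refine .of_forall fun n => ?_
        filter_upwards [hμ' hzle t ht] with s hs hst
        exact (norm_sub_le _ _).trans (add_le_add (norm_reg_le hA hA0 n _) (hs hst n))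
      · exact (hg.norm.intervalIntegrable _ _).add (hii hai.norm t ht)
      · filter_upwards [hμ' hzlim t ht] with s hs hst
        exact (tendsto_reg hA hA0 (g s)).sub (hs hst)
    exact tendsto_nhds_unique (tendsto_reg hA hA0 (val (u t)))
      (by simpa only [heq] using (tendsto_reg hA hA0 (val (u 0))).add hlim)
  · have heq : ∀ n, ‖reg A n (half (u t))‖ ^ 2 = ‖reg A n (half (u 0))‖ ^ 2 +
        ∫ s in (0 : ℝ)..t, 2 * ⟪regA A n (val (u s)), reg A n (g s) - regA A n (val (u s))⟫ := by
      intro n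
      have h1 := inner_eq_add_integral hA (fun s => reg_mem_graph hA hA0 n (val (u s)))
        ((reg A n).continuous.comp hw) (hz n) (hrg n)
        (fun s hs => h.hasDerivAt_reg hA hA0 hg hw n hs)
        (fun s hs => h.differentiableAt_regA hg hw n hs) ht.1
      rwa [inner_regA_eq hA hA0, inner_regA_eq hA hA0] at h1
    have hlim : Tendsto (fun n => ∫ s in (0 : ℝ)..t,
        2 * ⟪regA A n (val (u s)), reg A n (g s) - regA A n (val (u s))⟫)
        atTop (𝓝 (∫ s in (0 : ℝ)..t, 2 * ⟪a s, g s - a s⟫)) := by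
      refine intervalIntegral.tendsto_integral_filter_of_dominated_convergence
        (fun s => 3 * ‖a s‖ ^ 2 + ‖g s‖ ^ 2) ?_ ?_ ?_ ?_
      · exact .of_forall fun n =>
          (continuous_const.mul ((hz n).inner ((hrg n).sub (hz n)))).aestronglyMeasurable
      · refine .of_forall fun n => ?_
        filter_upwards [hμ' hzle t ht] with s hs hst
        exact abs_two_mul_inner_sub_le (hs hst n) (norm_reg_le hA hA0 n _)
      · exact ((hii hasq t ht).const_mul 3).add ((hg.norm.pow 2).intervalIntegrable _ _)
      · filter_upwards [hμ' hzlim t ht] with s hs hst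
        exact ((hs hst).inner ((tendsto_reg hA hA0 (g s)).sub (hs hst))).const_mul 2
    exact tendsto_nhds_unique (((tendsto_reg hA hA0 (half (u t))).norm).pow 2)
      (by simpa only [heq] using (((tendsto_reg hA hA0 (half (u 0))).norm).pow 2).add hlim)

end Regularity

/-! ### Absolute continuity and the chain rule for `|F|²`. -/

section AbsolutelyContinuous

theorem AbsolutelyContinuousOnInterval.of_dist_le {X Y : Type*} [PseudoMetricSpace X]
    [PseudoMetricSpace Y] {f : ℝ → X} {k : ℝ → Y} {a b : ℝ}
    (hk : AbsolutelyContinuousOnInterval k a b)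
    (hle : ∀ x ∈ uIcc a b, ∀ y ∈ uIcc a b, dist (f x) (f y) ≤ dist (k x) (k y)) :
    AbsolutelyContinuousOnInterval f a b := by
  refine squeeze_zero' (.of_forall fun E => Finset.sum_nonneg fun i _ => dist_nonneg) ?_ hk
  filter_upwards [mem_inf_of_right (mem_principal_self _)] with E hE
  exact Finset.sum_le_sum fun i hi => hle _ (hE.1 i hi).1 _ (hE.1 i hi).2

/-- The increments of `‖F‖` are bounded by those of the primitive of `‖w‖`, so `‖F‖²` is an
absolutely continuous scalar function and equals the integral of its derivative. -/
theorem norm_sq_eq_add_integral {E : Type*} [NormedAddCommGroup E] [InnerProductSpace ℝ E]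
    [CompleteSpace E] {F w : ℝ → E} {T : ℝ} (hw : IntervalIntegrable w volume 0 T)
    (hF : ∀ t ∈ Icc 0 T, F t = F 0 + ∫ s in (0 : ℝ)..t, w s) {t : ℝ} (ht : t ∈ Icc 0 T) :
    ‖F t‖ ^ 2 = ‖F 0‖ ^ 2 + ∫ s in (0 : ℝ)..t, 2 * ⟪F s, w s⟫ := by
  have hwt : IntervalIntegrable w volume 0 t := hw.mono_set (by
    rw [uIcc_of_le ht.1, uIcc_of_le (ht.1.trans ht.2)]
    exact Icc_subset_Icc_right ht.2)
  have hsub : ∀ x ∈ uIcc 0 t, IntervalIntegrable w volume 0 x := fun x hx =>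
    hwt.mono_set (uIcc_subset_uIcc_left hx)
  set G : ℝ → E := fun t => F 0 + ∫ s in (0 : ℝ)..t, w s with hG
  have hGF : ∀ s ∈ Icc 0 t, F s = G s := fun s hs => hF s ⟨hs.1, hs.2.trans ht.2⟩
  have hac : AbsolutelyContinuousOnInterval (fun s => ‖G s‖) 0 t := by
    refine AbsolutelyContinuousOnInterval.of_dist_le
      (hwt.norm.absolutelyContinuousOnInterval_intervalIntegral left_mem_uIcc)
      fun x hx y hy => ?_
    refine (abs_norm_sub_norm_le _ _).trans ?_
    have h1 := intervalIntegral.integral_interval_sub_left (hsub x hx) (hsub y hy)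
    have h2 := intervalIntegral.integral_interval_sub_left (hsub x hx).norm (hsub y hy).norm
    rw [Real.dist_eq, h2, hG]
    simp only [add_sub_add_left_eq_sub]
    rw [h1]
    exact intervalIntegral.norm_integral_le_abs_integral_norm
  have hac2 : AbsolutelyContinuousOnInterval (fun s => ‖G s‖ ^ 2) 0 t := by
    simpa only [sq] using hac.fun_mul hac
  have hder : ∀ᵐ s, s ∈ uIoc 0 t → deriv (fun s => ‖G s‖ ^ 2) s = 2 * ⟪F s, w s⟫ := by
    filter_upwards [hwt.ae_hasDerivAt_integral] with s hs hst
    have h1 := ((hs (uIoc_subset_uIcc hst) 0 left_mem_uIcc).const_add (F 0)).norm_sq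
    rw [uIoc_of_le ht.1] at hst
    rw [hGF s ⟨hst.1.le, hst.2⟩]
    exact h1.deriv
  have h := hac2.integral_deriv_eq_sub
  rw [intervalIntegral.integral_congr_ae hder] at h
  rw [h, hGF t ⟨ht.1, le_rfl⟩]
  simp [hG]

end AbsolutelyContinuous

end SlowSolutions

namespace SlowSolutions

open HalfDomain

variable {H : Type*} [NormedAddCommGroup H] [InnerProductSpace ℝ H] [CompleteSpace H]
  {A : H →ₗ.[ℝ] H}

/-! ### From weak solutions to solutions, and uniqueness. -/

theorem intervalIntegrable_of_integrable_restrict {E : Type*} [NormedAddCommGroup E] {k : ℝ → E}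
    {T t : ℝ} (hk : Integrable k (volume.restrict (Ioc 0 T))) (ht : t ∈ Icc 0 T) :
    IntervalIntegrable k volume 0 t := by
  rw [intervalIntegrable_iff_integrableOn_Ioc_of_le ht.1]
  exact IntegrableOn.mono_set hk (Ioc_subset_Ioc_right ht.2)

omit [CompleteSpace H] in
theorem integrable_inner_of_memLp {X : Type*} [MeasurableSpace X] {μ : Measure X} {k l : X → H}
    (hk : MemLp k 2 μ) (hl : MemLp l 2 μ) : Integrable (fun x => ⟪k x, l x⟫) μ := by
  refine Integrable.mono' (((memLp_two_iff_integrable_sq_norm hk.1).1 hk).add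
    ((memLp_two_iff_integrable_sq_norm hl.1).1 hl)) (hk.1.inner hl.1) (.of_forall fun x => ?_)
  refine (norm_inner_le_norm _ _).trans ?_
  simp only [Pi.add_apply]
  nlinarith [sq_nonneg (‖k x‖ - ‖l x‖), sq_nonneg ‖k x‖, sq_nonneg ‖l x‖]

omit [CompleteSpace H] in
theorem intervalIntegrable_inner {D w : ℝ → H} {a b : ℝ} (hD : ContinuousOn D (uIcc a b))
    (hw : IntervalIntegrable w volume a b) :
    IntervalIntegrable (fun s => ⟪D s, w s⟫) volume a b := by
  obtain ⟨M, hM⟩ := isCompact_uIcc.exists_bound_of_continuousOn hD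
  have hDm : AEStronglyMeasurable D (volume.restrict (uIoc a b)) :=
    (hD.aestronglyMeasurable measurableSet_uIcc).mono_measure
      (Measure.restrict_mono uIoc_subset_uIcc le_rfl)
  refine (hw.norm.const_mul M).mono_fun' (hDm.inner (intervalIntegrable_iff.1 hw).1) ?_
  filter_upwards [ae_restrict_mem measurableSet_uIoc] with s hs
  exact (norm_inner_le_norm _ _).trans
    (mul_le_mul_of_nonneg_right (hM s (uIoc_subset_uIcc hs)) (norm_nonneg _))

theorem restrict_Ioo_eq_restrict_Ioc (T : ℝ) :
    (volume.restrict (Ioo 0 T) : Measure ℝ) = volume.restrict (Ioc 0 T) :=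
  Measure.restrict_congr_set Ioo_ae_eq_Ioc

/-- If the weak solution stays in the ball and the right-hand side is `f(u)`, then it is a
solution. -/
theorem IsWeakSol.isSolutionOn (hA : IsSelfAdjoint A) (hA0 : IsNonneg A) {g : ℝ → H}
    {u : ℝ → HalfDomain A} (hg : Continuous g) (hu : Continuous u)
    (h : IsWeakSol A g fun t => val (u t)) {R T : ℝ} {f : HalfDomain A → H} (hT : 0 ≤ T)
    (hball : ∀ t ∈ Icc 0 T, u t ∈ Metric.ball (0 : HalfDomain A) R)
    (hgf : ∀ t ∈ Icc 0 T, g t = f (u t)) : IsSolutionOn A R f T (u 0) u := by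
  obtain ⟨a, ha2, ha, hval, hhalf⟩ := h.exists_strong hA hA0 hg hu hT
  have hTT : T ∈ Icc 0 T := ⟨hT, le_rfl⟩
  have hg2 : MemLp g 2 (volume.restrict (Ioc 0 T)) := by
    rw [memLp_two_iff_integrable_sq_norm hg.aestronglyMeasurable]
    exact ((hg.norm.pow 2).integrableOn_Icc).mono_set Ioc_subset_Icc_self
  have hw2 := hg2.sub ha2
  have hwi : IntervalIntegrable (fun s => g s - a s) volume 0 T :=
    intervalIntegrable_of_integrable_restrict (hw2.integrable one_le_two) hTT
  refine ⟨rfl, hball, hu.continuousOn, ⟨fun s => g s - a s, ?_, hval⟩, ⟨a, ?_, ?_⟩, ?_, ?_⟩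
  · rw [restrict_Ioo_eq_restrict_Ioc]
    exact hw2
  · rwa [restrict_Ioo_eq_restrict_Ioc]
  · rwa [restrict_Ioo_eq_restrict_Ioc]
  · have hki : Integrable (fun s => 2 * ⟪a s, g s - a s⟫) (volume.restrict (Ioc 0 T)) :=
      (integrable_inner_of_memLp ha2 hw2).const_mul 2
    -- The energy identity makes the increments of `|A^{1/2}u|²` equal to those of the primitive of
    -- an integrable function.
    refine AbsolutelyContinuousOnInterval.of_dist_le
      ((intervalIntegrable_of_integrable_restrict hki
        hTT).absolutelyContinuousOnInterval_intervalIntegral left_mem_uIcc) fun x hx y hy => ?_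
    rw [uIcc_of_le hT] at hx hy
    rw [hhalf x hx, hhalf y hy, dist_add_left]
  · rw [restrict_Ioo_eq_restrict_Ioc]
    have hder := ae_restrict_of_ae (s := Ioc 0 T) hwi.ae_hasDerivAt_integral
    have hne : ∀ᵐ t ∂(volume.restrict (Ioc 0 T)), t ∈ Ioo 0 T := by
      rw [← restrict_Ioo_eq_restrict_Ioc]
      exact ae_restrict_mem measurableSet_Ioo
    filter_upwards [ha, hder, hne] with t hat hdt ht
    obtain ⟨x, hx, hx'⟩ := A.mem_graph_iff.1 hat
    have htI : t ∈ Icc 0 T := ⟨ht.1.le, ht.2.le⟩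
    refine ⟨x, g t - a t, hx, ?_, ?_⟩
    · have h1 := (hdt (by rwa [uIcc_of_le hT]) 0 left_mem_uIcc).const_add (val (u 0))
      refine h1.congr_of_eventuallyEq ?_
      filter_upwards [Ioo_mem_nhds ht.1 ht.2] with s hs
      exact hval s ⟨hs.1.le, hs.2.le⟩
    · have hx'' : A x = a t := hx'
      rw [hx'', sub_add_cancel, hgf t htI]

/-- By Lebesgue differentiation the Sobolev derivative and the pointwise derivative agree almost
everywhere, so the equation holds for the former. -/
theorem IsSolutionOn.exists_derivative {R T : ℝ} {f : HalfDomain A → H} {u₀ : HalfDomain A}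
    {u : ℝ → HalfDomain A} (hT : 0 ≤ T) (h : IsSolutionOn A R f T u₀ u) :
    ∃ w : ℝ → H, IntervalIntegrable w volume 0 T ∧
      (∀ t ∈ Icc 0 T, val (u t) = val (u 0) + ∫ s in (0 : ℝ)..t, w s) ∧
      ∀ᵐ t ∂(volume.restrict (Ioc 0 T)), (val (u t), f (u t) - w t) ∈ A.graph := by
  obtain ⟨w, hw, hval⟩ := h.sobolev
  rw [restrict_Ioo_eq_restrict_Ioc] at hw
  have hwi : IntervalIntegrable w volume 0 T :=
    intervalIntegrable_of_integrable_restrict (hw.integrable one_le_two) ⟨hT, le_rfl⟩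
  refine ⟨w, hwi, hval, ?_⟩
  have heq := h.equation
  have hne := ae_restrict_mem (μ := volume) (measurableSet_Ioo (a := (0 : ℝ)) (b := T))
  rw [restrict_Ioo_eq_restrict_Ioc] at heq hne
  filter_upwards [heq, hne, ae_restrict_of_ae (s := Ioc 0 T) hwi.ae_hasDerivAt_integral]
    with t hex ht hdt
  obtain ⟨x, u', hx, hu', heq⟩ := hex
  have htI : t ∈ Icc 0 T := ⟨ht.1.le, ht.2.le⟩
  have h1 : HasDerivAt (fun s => val (u s)) (w t) t := by
    have h2 := (hdt (by rwa [uIcc_of_le hT]) 0 left_mem_uIcc).const_add (val (u 0))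
    refine h2.congr_of_eventuallyEq ?_
    filter_upwards [Ioo_mem_nhds ht.1 ht.2] with s hs
    exact hval s ⟨hs.1.le, hs.2.le⟩
  rw [← heq, hu'.unique h1, add_sub_cancel_left, ← hx]
  exact A.mem_graph x

/-- A nonnegative continuous function bounded by a multiple of its primitive vanishes. -/
theorem eq_zero_of_le_mul_integral {ψ : ℝ → ℝ} {C T : ℝ} (hC : 0 ≤ C)
    (hψ : ContinuousOn ψ (Icc 0 T)) (h0 : ∀ t ∈ Icc 0 T, 0 ≤ ψ t)
    (hle : ∀ t ∈ Icc 0 T, ψ t ≤ C * ∫ s in (0 : ℝ)..t, ψ s) {t : ℝ} (ht : t ∈ Icc 0 T) :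
    ψ t = 0 := by
  have hT : 0 ≤ T := ht.1.trans ht.2
  have hint : IntervalIntegrable ψ volume 0 T :=
    (hψ.mono (uIcc_of_le hT).subset).intervalIntegrable
  have hderiv : ∀ s ∈ Ioo 0 T, HasDerivAt (fun s => ∫ r in (0 : ℝ)..s, ψ r) (ψ s) s := by
    intro s hs
    refine intervalIntegral.integral_hasDerivAt_right
      (hint.mono_set (by
        rw [uIcc_of_le hT, uIcc_of_le hs.1.le]
        exact Icc_subset_Icc_right hs.2.le)) ?_ (hψ.continuousAt (Icc_mem_nhds hs.1 hs.2))
    exact (hψ.mono Ioo_subset_Icc_self).stronglyMeasurableAtFilter isOpen_Ioo s hs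
  have hcont : ContinuousOn (fun s => ∫ r in (0 : ℝ)..s, ψ r) (Icc 0 T) := by
    have := intervalIntegral.continuousOn_primitive_interval' hint left_mem_uIcc
    rwa [uIcc_of_le hT] at this
  have hexp : ∀ s, HasDerivAt (fun s => Real.exp (-C * s)) (Real.exp (-C * s) * -C) s := fun s => by
    simpa using ((hasDerivAt_id s).const_mul (-C)).exp
  have hanti : AntitoneOn (fun s => Real.exp (-C * s) * ∫ r in (0 : ℝ)..s, ψ r) (Icc 0 T) := by
    refine antitoneOn_of_hasDerivWithinAt_nonpos (convex_Icc 0 T)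
      ((Real.continuous_exp.comp (continuous_const.mul continuous_id)).continuousOn.mul hcont)
      (fun s hs => ((hexp s).mul (hderiv s (by rwa [interior_Icc] at hs))).hasDerivWithinAt)
      fun s hs => ?_
    rw [interior_Icc] at hs
    have := hle s ⟨hs.1.le, hs.2.le⟩
    have := mul_le_mul_of_nonneg_left this (Real.exp_pos (-C * s)).le
    linarith
  have h1 := hanti ⟨le_rfl, hT⟩ ht ht.1
  simp only [intervalIntegral.integral_same, mul_zero] at h1
  have h2 : ∫ r in (0 : ℝ)..t, ψ r ≤ 0 := nonpos_of_mul_nonpos_right h1 (Real.exp_pos _)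
  have h3 := hle t ht
  have h4 := mul_nonpos_of_nonneg_of_nonpos hC h2
  exact le_antisymm (h3.trans h4) (h0 t ht)

/-- Although `f` is Lipschitz only for the stronger norm, Grönwall can be run on the `H` norm of the
difference: the dissipation `-2|A^{1/2}(u - v)|²` absorbs the `A^{1/2}` part of the Lipschitz bound.
-/
theorem IsSolutionOn.eqOn (hA : IsSelfAdjoint A) (hA0 : IsNonneg A) {R T L : ℝ}
    {f : HalfDomain A → H} {u₀ : HalfDomain A} {u v : ℝ → HalfDomain A} (hT : 0 ≤ T)
    (hfL : ∀ u ∈ Metric.ball (0 : HalfDomain A) R, ∀ v ∈ Metric.ball (0 : HalfDomain A) R,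
      ‖f u - f v‖ ≤ L * ‖u - v‖)
    (hu : IsSolutionOn A R f T u₀ u) (hv : IsSolutionOn A R f T u₀ v) : EqOn u v (Icc 0 T) := by
  obtain ⟨w₁, hw₁, hval₁, hgr₁⟩ := hu.exists_derivative hT
  obtain ⟨w₂, hw₂, hval₂, hgr₂⟩ := hv.exists_derivative hT
  set D : ℝ → H := fun t => val (u t) - val (v t) with hD
  have hD0 : D 0 = 0 := by
    rw [hD]
    simp only [hu.initial, hv.initial, sub_self]
  have hsub : ∀ t ∈ Icc 0 T, uIcc 0 t ⊆ uIcc 0 T := fun t ht =>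
    uIcc_subset_uIcc_left (by rwa [uIcc_of_le hT])
  have hDint : ∀ t ∈ Icc 0 T, D t = D 0 + ∫ s in (0 : ℝ)..t, (w₁ s - w₂ s) := by
    intro t ht
    rw [intervalIntegral.integral_sub (hw₁.mono_set (hsub t ht)) (hw₂.mono_set (hsub t ht)), hD]
    simp only
    rw [hval₁ t ht, hval₂ t ht, add_sub_add_comm]
  -- `2|L|` comes from the `H` part of the Lipschitz bound, `L²` from Young's inequality on the
  -- `A^{1/2}` part.
  set C : ℝ := 2 * |L| + L ^ 2
  have hψc : ContinuousOn (fun t => ‖D t‖ ^ 2) (Icc 0 T) :=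
    (((continuous_val.comp_continuousOn hu.continuousOn).sub
      (continuous_val.comp_continuousOn hv.continuousOn)).norm).pow 2
  have hae : ∀ᵐ t ∂(volume.restrict (Ioc 0 T)), 2 * ⟪D t, w₁ t - w₂ t⟫ ≤ C * ‖D t‖ ^ 2 := by
    filter_upwards [hgr₁, hgr₂, ae_restrict_mem measurableSet_Ioc] with t h1 h2 ht
    have htI : t ∈ Icc 0 T := ⟨ht.1.le, ht.2⟩
    have hmem : (val (u t - v t), (f (u t) - w₁ t) - (f (v t) - w₂ t)) ∈ A.graph := by
      rw [map_sub]
      exact A.graph.sub_mem h1 h2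
    have h3 := norm_sq_half_of_mem_graph hA hA0 hmem
    have h4 : (f (u t) - w₁ t) - (f (v t) - w₂ t) = (f (u t) - f (v t)) - (w₁ t - w₂ t) := by abel
    have hDt : val (u t - v t) = D t := map_sub _ _ _
    rw [h4, hDt, inner_sub_left, real_inner_comm (D t) (w₁ t - w₂ t)] at h3
    have h5 : ⟪f (u t) - f (v t), D t⟫ ≤ |L| * (‖D t‖ + ‖half (u t - v t)‖) * ‖D t‖ := by
      refine (real_inner_le_norm _ _).trans (mul_le_mul_of_nonneg_right ?_ (norm_nonneg _))
      refine (hfL _ (hu.mem_ball t htI) _ (hv.mem_ball t htI)).trans ?_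
      have h6 := norm_le_add (u t - v t)
      rw [hDt] at h6
      exact mul_le_mul (le_abs_self L) h6 (norm_nonneg _) (abs_nonneg L)
    have h7 : 2 * (|L| * ‖half (u t - v t)‖ * ‖D t‖) ≤
        ‖half (u t - v t)‖ ^ 2 + L ^ 2 * ‖D t‖ ^ 2 := by
      rw [← sq_abs L]
      nlinarith [sq_nonneg (‖half (u t - v t)‖ - |L| * ‖D t‖)]
    have h8 := sq_nonneg ‖half (u t - v t)‖
    simp only [C]
    nlinarith
  intro t ht
  refine val_injective (sub_eq_zero.1 ?_)
  have key := eq_zero_of_le_mul_integral (C := C) (by positivity) hψc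
    (fun s _ => sq_nonneg _) (fun s hs => ?_) ht
  · simpa using key
  · have hDc : ContinuousOn D (uIcc 0 s) := by
      refine ((continuous_val.comp_continuousOn hu.continuousOn).sub
        (continuous_val.comp_continuousOn hv.continuousOn)).mono ?_
      have := hsub s hs
      rwa [uIcc_of_le hT] at this
    rw [norm_sq_eq_add_integral (hw₁.sub hw₂) hDint hs, hD0, norm_zero, sq, zero_mul, zero_add,
      ← intervalIntegral.integral_const_mul]
    have hi₁ : IntervalIntegrable (fun r => 2 * ⟪D r, w₁ r - w₂ r⟫) volume 0 s :=
      (intervalIntegrable_inner hDc ((hw₁.sub hw₂).mono_set (hsub s hs))).const_mul 2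
    have hi₂ : IntervalIntegrable (fun r => C * ‖D r‖ ^ 2) volume 0 s :=
      ((hψc.mono (by rw [← uIcc_of_le hT]; exact hsub s hs)).intervalIntegrable).const_mul C
    rw [intervalIntegral.integral_of_le hs.1, intervalIntegral.integral_of_le hs.1]
    exact setIntegral_mono_ae_restrict hi₁.1 hi₂.1
      (ae_restrict_of_ae_restrict_of_subset (Ioc_subset_Ioc_right hs.2) hae)

end SlowSolutions

namespace SlowSolutions

open HalfDomain

/-! ### Choice of the radius and pointwise estimates on the invariant region. -/

section Smallness

theorem eventually_rpow_lt {x C ε : ℝ} (hx : 0 < x) (hε : 0 < ε) :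
    ∀ᶠ σ in 𝓝[>] (0 : ℝ), C * σ ^ x < ε := by
  have h : Tendsto (fun σ : ℝ => C * σ ^ x) (𝓝 0) (𝓝 0) := by
    have := ((Real.continuous_rpow_const hx.le).tendsto 0).const_mul C
    rwa [Real.zero_rpow hx.ne', mul_zero] at this
  exact (h.mono_left nhdsWithin_le_nhds).eventually (gt_mem_nhds hε)

/-- The smallness conditions on the radius of the set of initial data. -/
structure IsSmall (ν p q K₀ K₁ r σ : ℝ) : Prop where
  pos : 0 < σ
  le_one : σ ≤ 1
  ball : σ ^ 2 + K₁ * σ ^ (2 + 2 * p) < r ^ 2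
  nonlinear : √K₁ ^ (1 + q) * σ ^ ((1 + p) * q) ≤ 1
  dissipation : (1 + p) * (4 * K₀ * σ ^ p + 2 * K₁ * σ ^ (2 * p)) ≤ ν / 3

theorem exists_isSmall {ν p q K₀ K₁ r : ℝ} (hν : 0 < ν) (hp : 0 < p) (hq : 0 < q)
    (hr : 0 < r) : ∃ σ, IsSmall ν p q K₀ K₁ r σ := by
  have h1 : ∀ᶠ σ in 𝓝[>] (0 : ℝ), 1 * σ ^ (2 : ℝ) < r ^ 2 / 2 :=
    eventually_rpow_lt (by norm_num) (by positivity)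
  have h2 : ∀ᶠ σ in 𝓝[>] (0 : ℝ), K₁ * σ ^ (2 + 2 * p) < r ^ 2 / 2 :=
    eventually_rpow_lt (by positivity) (by positivity)
  have h3 : ∀ᶠ σ in 𝓝[>] (0 : ℝ), √K₁ ^ (1 + q) * σ ^ ((1 + p) * q) < 1 :=
    eventually_rpow_lt (by positivity) one_pos
  have h4 : ∀ᶠ σ in 𝓝[>] (0 : ℝ), ((1 + p) * (4 * K₀)) * σ ^ p < ν / 6 :=
    eventually_rpow_lt hp (by positivity)
  have h5 : ∀ᶠ σ in 𝓝[>] (0 : ℝ), ((1 + p) * (2 * K₁)) * σ ^ (2 * p) < ν / 6 :=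
    eventually_rpow_lt (by positivity) (by positivity)
  have h6 : ∀ᶠ σ in 𝓝[>] (0 : ℝ), σ < 1 :=
    (gt_mem_nhds one_pos).filter_mono nhdsWithin_le_nhds
  obtain ⟨σ, h1, h2, h3, h4, h5, h6, h7⟩ :=
    (h1.and (h2.and (h3.and (h4.and (h5.and (h6.and self_mem_nhdsWithin)))))).exists
  rw [Real.rpow_two, one_mul] at h1
  exact ⟨σ, h7, h6.le, by linarith, h3.le, by linarith⟩

end Smallness

variable {H : Type*} [NormedAddCommGroup H] [InnerProductSpace ℝ H] [CompleteSpace H]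
  {A : H →ₗ.[ℝ] H}

section SlowSet

theorem rpow_sq {x : ℝ} (hx : 0 ≤ x) (y : ℝ) : (x ^ 2) ^ y = x ^ (2 * y) := by
  rw [Real.rpow_mul hx, Real.rpow_two]

theorem norm_val_pos {v : HalfDomain A} (hv : v ≠ 0) : 0 < ‖val v‖ := by
  rw [norm_pos_iff]
  exact fun h => hv (val_injective (by rw [h, map_zero]))

theorem isOpen_slowSet {p : ℝ} (hp : 0 < p) (σ K₁ : ℝ) : IsOpen (slowSet A p σ K₁) := by
  refine isOpen_ne.inter ((isOpen_lt continuous_val.norm continuous_const).inter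
    (isOpen_lt (continuous_half.norm.pow 2) (continuous_const.mul ?_)))
  exact (Real.continuous_rpow_const (by positivity)).comp continuous_val.norm

variable {ν p q K₀ K₁ r σ : ℝ}

theorem norm_lt_of_mem_slowSet (hσ : IsSmall ν p q K₀ K₁ r σ) (hp : 0 < p) (hr : 0 < r)
    (hK₁ : 0 < K₁) {v : HalfDomain A} (hv : v ∈ slowSet A p σ K₁) : ‖v‖ < r := by
  obtain ⟨_, h1, h2⟩ := hv
  refine lt_of_pow_lt_pow_left₀ 2 hr.le (lt_trans ?_ hσ.ball)
  rw [norm_sq_eq]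
  have h3 : ‖val v‖ ^ (2 + 2 * p) ≤ σ ^ (2 + 2 * p) :=
    Real.rpow_le_rpow (norm_nonneg _) h1.le (by positivity)
  have h4 := mul_le_mul_of_nonneg_left h3 hK₁.le
  have h5 := pow_le_pow_left₀ (norm_nonneg _) h1.le 2
  linarith

/-- On the region `|A^{1/2}v| ≤ √K₁|v|^{1+p}`; raising this to the power `1 + q` leaves the spare
factor `|v|^{(1+p)q}`, which is small. -/
theorem norm_half_rpow_le_of_mem_slowSet (hσ : IsSmall ν p q K₀ K₁ r σ) (hp : 0 < p) (hq : 0 < q)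
    (hK₁ : 0 < K₁) {v : HalfDomain A} (hv : v ∈ slowSet A p σ K₁) :
    ‖half v‖ ^ (1 + q) ≤ ‖val v‖ ^ (1 + p) := by
  obtain ⟨h0, h1, h2⟩ := hv
  have hx := norm_val_pos h0
  set x := ‖val v‖
  have h3 : ‖half v‖ ≤ √K₁ * x ^ (1 + p) := by
    refine le_of_sq_le_sq (h2.le.trans_eq ?_) (by positivity)
    rw [mul_pow, Real.sq_sqrt hK₁.le, ← Real.rpow_two (x ^ (1 + p)), ← Real.rpow_mul hx.le]
    ring_nf
  have h4 : (√K₁ * x ^ (1 + p)) ^ (1 + q) = √K₁ ^ (1 + q) * x ^ ((1 + p) * q) * x ^ (1 + p) := by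
    rw [Real.mul_rpow (Real.sqrt_nonneg _) (by positivity), ← Real.rpow_mul hx.le, mul_assoc,
      ← Real.rpow_add hx]
    ring_nf
  refine (Real.rpow_le_rpow (norm_nonneg _) h3 (by positivity)).trans ?_
  rw [h4]
  refine mul_le_of_le_one_left (by positivity) (le_trans ?_ hσ.nonlinear)
  exact mul_le_mul_of_nonneg_left (Real.rpow_le_rpow hx.le h1.le (by positivity)) (by positivity)

variable {R : ℝ} {f : HalfDomain A → H}

theorem norm_apply_le_of_mem_slowSet (hσ : IsSmall ν p q K₀ K₁ r σ) (hp : 0 < p) (hq : 0 < q)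
    (hr : 0 < r) (hrR : r ≤ R) (hK₀ : 0 ≤ K₀) (hK₁ : 0 < K₁)
    (hf : ∀ u ∈ Metric.ball (0 : HalfDomain A) R,
      ‖f u‖ ≤ K₀ * (‖val u‖ ^ (1 + p) + ‖half u‖ ^ (1 + q)))
    {v : HalfDomain A} (hv : v ∈ slowSet A p σ K₁) :
    ‖f v‖ ≤ 2 * K₀ * ‖val v‖ ^ (1 + p) := by
  have h1 := hf v (by
    rw [mem_ball_zero_iff]
    exact (norm_lt_of_mem_slowSet hσ hp hr hK₁ hv).trans_le hrR)
  have h2 := mul_le_mul_of_nonneg_left (norm_half_rpow_le_of_mem_slowSet hσ hp hq hK₁ hv) hK₀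
  linarith

/-- A lower bound for the derivative of `|u|²`. -/
theorem neg_le_deriv_of_mem_slowSet (hσ : IsSmall ν p q K₀ K₁ r σ) (hp : 0 < p)
    (hK₁ : 0 < K₁) {v : HalfDomain A} (hv : v ∈ slowSet A p σ K₁)
    {y : H} (hy : ‖y‖ ≤ 2 * K₀ * ‖val v‖ ^ (1 + p)) :
    -((4 * K₀ + 2 * K₁) * (‖val v‖ ^ 2) ^ (1 + p / 2)) ≤
      2 * ⟪val v, y⟫ - 2 * ‖half v‖ ^ 2 := by
  obtain ⟨h0, h1, h2⟩ := hv
  have hx := norm_val_pos h0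
  have h3 := neg_le_of_abs_le (abs_real_inner_le_norm (val v) y)
  rw [rpow_sq hx.le]
  set x := ‖val v‖
  have h4 : x * x ^ (1 + p) = x ^ (2 * (1 + p / 2)) := by
    rw [← Real.rpow_one_add' hx.le (by positivity)]
    ring_nf
  -- Here `x < 1` is used: the exponent drops from `2 + 2p` to `2 + p`.
  have h5 : x ^ (2 + 2 * p) ≤ x ^ (2 * (1 + p / 2)) :=
    Real.rpow_le_rpow_of_exponent_ge hx (h1.le.trans hσ.le_one) (by linarith)
  have h6 := mul_le_mul_of_nonneg_left hy hx.le
  have h7 := mul_le_mul_of_nonneg_left h5 hK₁.le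
  have h8 : x * (2 * K₀ * x ^ (1 + p)) = 2 * K₀ * x ^ (2 * (1 + p / 2)) := by
    rw [← h4]
    ring
  linarith

/-- The dissipation estimate for `|A^{1/2} u|² - K₁ |u|^{2+2p}`. -/
theorem dissipation_le_of_mem_slowSet (hσ : IsSmall ν p q K₀ K₁ r σ) (hp : 0 < p)
    (hν : 0 < ν) (hK₀ : 0 ≤ K₀) (hK₁ : 0 < K₁) (hK₁' : 4 * K₀ ^ 2 * (3 + 2 * p) / ν ≤ K₁)
    {v : HalfDomain A} (hv : v ∈ slowSet A p σ K₁) {y a : H}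
    (ha : ν * ‖half v‖ ^ 2 ≤ ‖a‖ ^ 2) (hy : ‖y‖ ≤ 2 * K₀ * ‖val v‖ ^ (1 + p)) :
    2 * ⟪a, y - a⟫ - K₁ * ((2 * ⟪val v, y⟫ - 2 * ‖half v‖ ^ 2) * (1 + p) * (‖val v‖ ^ 2) ^ p) ≤
      -ν * ‖half v‖ ^ 2 + 2 / 3 * ν * K₁ * (‖val v‖ ^ 2) ^ (1 + p) := by
  obtain ⟨h0, h1, h2⟩ := hv
  have hx := norm_val_pos h0
  have h3 := neg_le_of_abs_le (abs_real_inner_le_norm (val v) y)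
  rw [rpow_sq hx.le, rpow_sq hx.le]
  set x := ‖val v‖
  have hm : 2 * (1 + p) = 2 + 2 * p := by ring
  rw [hm]
  set m := x ^ (2 + 2 * p) with hmdef
  have hm0 : 0 < m := by positivity
  have h4 : 2 * ⟪a, y - a⟫ ≤ ‖y‖ ^ 2 - ‖a‖ ^ 2 := by
    rw [inner_sub_right, real_inner_self_eq_norm_sq]
    have := norm_sub_sq_real a y
    nlinarith [sq_nonneg ‖a - y‖]
  have h5 : ‖y‖ ^ 2 ≤ 4 * K₀ ^ 2 * m := by
    refine (pow_le_pow_left₀ (norm_nonneg _) hy 2).trans_eq ?_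
    rw [mul_pow, ← Real.rpow_two (x ^ (1 + p)), ← Real.rpow_mul hx.le, mul_comm (1 + p), hm]
    ring
  -- The place where the lower bound on `K₁` enters, through `12K₀² ≤ νK₁`. The forcing and the
  -- variation of `K₁|u|^{2+2p}` each cost a third of `νK₁m`, leaving a third as margin.
  have h6 : 4 * K₀ ^ 2 ≤ ν * K₁ / 3 := by
    rw [div_le_iff₀ hν] at hK₁'
    nlinarith [mul_nonneg (sq_nonneg K₀) hp.le]
  have h7 : -(4 * K₀ * (x * x ^ (1 + p)) + 2 * K₁ * m) ≤ 2 * ⟪val v, y⟫ - 2 * ‖half v‖ ^ 2 := by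
    have := mul_le_mul_of_nonneg_left hy hx.le
    nlinarith
  have h8 : x ^ (2 * p) * (x * x ^ (1 + p)) = m * x ^ p := by
    rw [hmdef, ← Real.rpow_one_add' hx.le (by positivity), ← Real.rpow_add hx, ← Real.rpow_add hx]
    ring_nf
  have h9 : x ^ p ≤ σ ^ p := Real.rpow_le_rpow hx.le h1.le hp.le
  have h10 : x ^ (2 * p) ≤ σ ^ (2 * p) := Real.rpow_le_rpow hx.le h1.le (by positivity)
  have h11 : (1 + p) * (4 * K₀ * x ^ p + 2 * K₁ * x ^ (2 * p)) ≤ ν / 3 := by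
    refine le_trans (mul_le_mul_of_nonneg_left ?_ (by positivity)) hσ.dissipation
    exact add_le_add (mul_le_mul_of_nonneg_left h9 (by positivity))
      (mul_le_mul_of_nonneg_left h10 (by positivity))
  have h12 := mul_le_mul_of_nonneg_left h11 (mul_pos hK₁ hm0).le
  have h13 : 0 ≤ K₁ * ((1 + p) * x ^ (2 * p)) := by positivity
  have h14 := mul_le_mul_of_nonneg_left h7 h13
  have h15 : K₁ * ((1 + p) * x ^ (2 * p)) * -(4 * K₀ * (x * x ^ (1 + p)) + 2 * K₁ * m) =
      -(K₁ * m * ((1 + p) * (4 * K₀ * x ^ p + 2 * K₁ * x ^ (2 * p)))) := by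
    linear_combination (-(K₁ * (1 + p) * 4 * K₀)) * h8
  have h16 := mul_le_mul_of_nonneg_right h6 hm0.le
  linarith

end SlowSet

end SlowSolutions

namespace SlowSolutions

open HalfDomain

variable {H : Type*} [NormedAddCommGroup H] [InnerProductSpace ℝ H] [CompleteSpace H]
  {A : H →ₗ.[ℝ] H}

/-! ### The evolution of `|u|²` and the lower bound on decay. -/

section Decay

theorem IsWeakSol.norm_sq_val_eq (hA : IsSelfAdjoint A) (hA0 : IsNonneg A) {g : ℝ → H}
    {u : ℝ → HalfDomain A} (hg : Continuous g) (hu : Continuous u)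
    (h : IsWeakSol A g fun t => val (u t)) {t : ℝ} (ht : 0 ≤ t) :
    ‖val (u t)‖ ^ 2 = ‖val (u 0)‖ ^ 2 +
      ∫ s in (0 : ℝ)..t, (2 * ⟪val (u s), g s⟫ - 2 * ‖half (u s)‖ ^ 2) := by
  obtain ⟨a, ha2, ha, hval, -⟩ := h.exists_strong hA hA0 hg hu ht
  have htt : t ∈ Icc 0 t := ⟨ht, le_rfl⟩
  have hi : IntervalIntegrable (fun s => g s - a s) volume 0 t :=
    (hg.intervalIntegrable _ _).sub
      (intervalIntegrable_of_integrable_restrict (ha2.integrable one_le_two) htt)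
  rw [norm_sq_eq_add_integral hi hval htt]
  congr 1
  rw [intervalIntegral.integral_of_le ht, intervalIntegral.integral_of_le ht]
  refine integral_congr_ae ?_
  filter_upwards [ha] with s hs
  rw [norm_sq_half_of_mem_graph hA hA0 hs, inner_sub_right, real_inner_comm (val (u s)) (a s)]
  ring

theorem IsWeakSol.hasDerivAt_norm_sq_val (hA : IsSelfAdjoint A) (hA0 : IsNonneg A) {g : ℝ → H}
    {u : ℝ → HalfDomain A} (hg : Continuous g) (hu : Continuous u)
    (h : IsWeakSol A g fun t => val (u t)) {t : ℝ} (ht : 0 < t) :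
    HasDerivAt (fun s => ‖val (u s)‖ ^ 2) (2 * ⟪val (u t), g t⟫ - 2 * ‖half (u t)‖ ^ 2) t := by
  have hc : Continuous fun s => 2 * ⟪val (u s), g s⟫ - 2 * ‖half (u s)‖ ^ 2 :=
    (continuous_const.mul ((continuous_val.comp hu).inner hg)).sub
      (continuous_const.mul ((continuous_half.comp hu).norm.pow 2))
  refine ((hc.integral_hasStrictDerivAt 0 t).hasDerivAt.const_add
    (‖val (u 0)‖ ^ 2)).congr_of_eventuallyEq ?_
  filter_upwards [lt_mem_nhds ht] with s hs
  exact h.norm_sq_val_eq hA hA0 hg hu hs.le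

/-- Lower bound for positive solutions of `ψ' ≥ -c ψ^{1 + p/2}`. -/
theorem le_of_neg_rpow_le_deriv {ψ ψ' : ℝ → ℝ} {c p τ : ℝ} (hp : 0 < p) (hτ : 0 < τ)
    (hψ : Continuous ψ) (hpos : ∀ t ∈ Ico 0 τ, 0 < ψ t)
    (hder : ∀ t, 0 < t → HasDerivAt ψ (ψ' t) t)
    (hle : ∀ t ∈ Ico 0 τ, -(c * ψ t ^ (1 + p / 2)) ≤ ψ' t) {t : ℝ} (ht : t ∈ Icc 0 τ) :
    max (ψ 0 ^ (-(p / 2))) (p / 2 * c) ^ (-(2 / p)) / (1 + t) ^ (2 / p) ≤ ψ t := by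
  set m := max (ψ 0 ^ (-(p / 2))) (p / 2 * c)
  have hm : 0 < m := lt_max_of_lt_left (Real.rpow_pos_of_pos (hpos 0 ⟨le_rfl, hτ⟩) _)
  -- The inequality says that `ψ^{-p/2}` grows at rate at most `pc/2`.
  have hanti : AntitoneOn (fun t => ψ t ^ (-(p / 2)) - p / 2 * c * t) (Ico 0 τ) := by
    refine antitoneOn_of_hasDerivWithinAt_nonpos (convex_Ico 0 τ)
      (f' := fun t => ψ' t * (-(p / 2)) * ψ t ^ (-(p / 2) - 1) - p / 2 * c * 1) ?_ ?_ ?_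
    · refine (hψ.continuousOn.rpow_const fun t ht => Or.inl (hpos t ht).ne').sub
        (continuous_const.mul continuous_id).continuousOn
    · intro t ht
      rw [interior_Ico] at ht
      exact (((hder t ht.1).rpow_const (Or.inl (hpos t ⟨ht.1.le, ht.2⟩).ne')).sub
        ((hasDerivAt_id t).const_mul (p / 2 * c))).hasDerivWithinAt
    · intro t ht
      rw [interior_Ico] at ht
      have ht' : t ∈ Ico 0 τ := ⟨ht.1.le, ht.2⟩
      have h0 := hpos t ht'
      have h1 : ψ t ^ (1 + p / 2) * ψ t ^ (-(p / 2) - 1) = 1 := by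
        rw [← Real.rpow_add h0, show 1 + p / 2 + (-(p / 2) - 1) = 0 by ring, Real.rpow_zero]
      have h2 : 0 ≤ p / 2 * ψ t ^ (-(p / 2) - 1) := by positivity
      have h3 := mul_le_mul_of_nonneg_left (hle t ht') h2
      have h4 : p / 2 * ψ t ^ (-(p / 2) - 1) * -(c * ψ t ^ (1 + p / 2)) = -(p / 2 * c) := by
        linear_combination (-(p / 2 * c)) * h1
      linarith
  have key : ∀ t ∈ Ico 0 τ, m ^ (-(2 / p)) / (1 + t) ^ (2 / p) ≤ ψ t := by
    intro t ht
    have h0 := hpos t ht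
    have h1 := hanti ⟨le_rfl, hτ⟩ ht ht.1
    simp only [mul_zero, sub_zero] at h1
    have h2 : ψ t ^ (-(p / 2)) ≤ m * (1 + t) := by
      have h3 := mul_le_mul_of_nonneg_right (le_max_right (ψ 0 ^ (-(p / 2))) (p / 2 * c)) ht.1
      have h4 := le_max_left (ψ 0 ^ (-(p / 2))) (p / 2 * c)
      linarith
    have h1t : 0 < 1 + t := by linarith [ht.1]
    have h5 := Real.rpow_le_rpow_of_nonpos (by positivity) h2
      (show -(2 / p) ≤ 0 by simp only [neg_nonpos]; positivity)
    rw [← Real.rpow_mul h0.le, Real.mul_rpow hm.le h1t.le, Real.rpow_neg h1t.le] at h5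
    have h6 : -(p / 2) * -(2 / p) = 1 := by field_simp
    rwa [h6, Real.rpow_one, ← div_eq_mul_inv] at h5
  have hcl : ContinuousOn (fun t => m ^ (-(2 / p)) / (1 + t) ^ (2 / p)) (Icc 0 τ) := by
    intro t ht
    have h1t : 0 < 1 + t := by linarith [ht.1]
    refine ContinuousAt.continuousWithinAt (continuousAt_const.div ?_ (by positivity))
    exact (continuousAt_const.add continuousAt_id).rpow_const (Or.inl h1t.ne')
  -- Positivity is assumed only before `τ`; passing to the closure yields it at `τ` as well, which
  -- excludes reaching `0` at an exit time.
  exact ContinuousWithinAt.closure_le (by rwa [closure_Ico hτ.ne])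
    ((hcl t ht).mono Ico_subset_Icc_self) hψ.continuousWithinAt key

end Decay

/-! ### Forward invariance of the region. -/

section Invariance

variable (hA : IsSelfAdjoint A) (hA0 : IsNonneg A) {ν p q K₀ K₁ r σ R : ℝ}
  {f : HalfDomain A → H} (hσ : IsSmall ν p q K₀ K₁ r σ) (hν : 0 < ν) (hp : 0 < p) (hq : 0 < q)
  (hr : 0 < r) (hrR : r ≤ R) (hK₀ : 0 ≤ K₀) (hK₁ : 0 < K₁)
  (hK₁' : 4 * K₀ ^ 2 * (3 + 2 * p) / ν ≤ K₁)
  (hAν : ∀ (x : A.domain) (v : HalfDomain A), val v = (x : H) → ν * ‖half v‖ ^ 2 ≤ ‖A x‖ ^ 2)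
  (hf : ∀ u ∈ Metric.ball (0 : HalfDomain A) R,
    ‖f u‖ ≤ K₀ * (‖val u‖ ^ (1 + p) + ‖half u‖ ^ (1 + q)))
  (hsign : ∀ u ∈ Metric.ball (0 : HalfDomain A) R, inner ℝ (val u) (f u) ≤ 0)
  {g : ℝ → H} {u : ℝ → HalfDomain A} (hg : Continuous g) (hu : Continuous u)
  (h : IsWeakSol A g fun t => val (u t))
  (hgf : ∀ t, u t ∈ slowSet A p σ K₁ → g t = f (u t))
include hA hA0 hσ hp hq hr hrR hK₀ hK₁ hf hg hu h hgf

theorem lower_bound_of_mem_slowSet {τ : ℝ} (hτ : 0 < τ)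
    (hmem : ∀ t ∈ Ico 0 τ, u t ∈ slowSet A p σ K₁) {t : ℝ} (ht : t ∈ Icc 0 τ) :
    max ((‖val (u 0)‖ ^ 2) ^ (-(p / 2))) (p / 2 * (4 * K₀ + 2 * K₁)) ^ (-(2 / p)) /
      (1 + t) ^ (2 / p) ≤ ‖val (u t)‖ ^ 2 := by
  refine le_of_neg_rpow_le_deriv (ψ := fun t => ‖val (u t)‖ ^ 2) (c := 4 * K₀ + 2 * K₁) hp hτ
    ((continuous_val.comp hu).norm.pow 2) (fun t ht => pow_pos (norm_val_pos (hmem t ht).1) 2)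
    (fun t ht => h.hasDerivAt_norm_sq_val hA hA0 hg hu ht) (fun t ht => ?_) ht
  refine neg_le_deriv_of_mem_slowSet hσ hp hK₁ (hmem t ht) ?_
  rw [hgf t (hmem t ht)]
  exact norm_apply_le_of_mem_slowSet hσ hp hq hr hrR hK₀ hK₁ hf (hmem t ht)

include hν hK₁' hAν hsign

/-- A solution cannot leave at `τ`: the decay bound keeps it nonzero, the sign condition keeps `|u|`
below `σ`, and the dissipation estimate rules out the third face. -/
theorem mem_slowSet_of_forall_lt {τ : ℝ} (hτ : 0 < τ)
    (hmem : ∀ t ∈ Ico 0 τ, u t ∈ slowSet A p σ K₁) : u τ ∈ slowSet A p σ K₁ := by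
  have hττ : τ ∈ Icc 0 τ := ⟨hτ.le, le_rfl⟩
  have hψc : Continuous fun t => ‖val (u t)‖ ^ 2 := (continuous_val.comp hu).norm.pow 2
  have hZc : Continuous fun t => ‖half (u t)‖ ^ 2 := (continuous_half.comp hu).norm.pow 2
  have hball : ∀ t ∈ Ico 0 τ, u t ∈ Metric.ball (0 : HalfDomain A) R := fun t ht => by
    rw [mem_ball_zero_iff]
    exact (norm_lt_of_mem_slowSet hσ hp hr hK₁ (hmem t ht)).trans_le hrR
  have hgle : ∀ t ∈ Ico 0 τ, ‖g t‖ ≤ 2 * K₀ * ‖val (u t)‖ ^ (1 + p) := fun t ht => by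
    rw [hgf t (hmem t ht)]
    exact norm_apply_le_of_mem_slowSet hσ hp hq hr hrR hK₀ hK₁ hf (hmem t ht)
  have hpos : 0 < ‖val (u τ)‖ := by
    have h1 := lower_bound_of_mem_slowSet hA hA0 hσ hp hq hr hrR hK₀ hK₁ hf hg hu h hgf hτ hmem hττ
    have h0 : 0 < (‖val (u 0)‖ ^ 2) ^ (-(p / 2)) :=
      Real.rpow_pos_of_pos (pow_pos (norm_val_pos (hmem 0 ⟨le_rfl, hτ⟩).1) 2) _
    have h2 : 0 < max ((‖val (u 0)‖ ^ 2) ^ (-(p / 2))) (p / 2 * (4 * K₀ + 2 * K₁)) :=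
      lt_max_of_lt_left h0
    have h3 : 0 < 1 + τ := by linarith
    have h4 : 0 < ‖val (u τ)‖ ^ 2 := lt_of_lt_of_le (by positivity) h1
    exact (norm_nonneg _).lt_of_ne fun h0 => by simp [← h0] at h4
  have hanti : AntitoneOn (fun t => ‖val (u t)‖ ^ 2) (Icc 0 τ) := by
    refine antitoneOn_of_hasDerivWithinAt_nonpos (convex_Icc 0 τ) hψc.continuousOn
      (fun t ht => (h.hasDerivAt_norm_sq_val hA hA0 hg hu ?_).hasDerivWithinAt) fun t ht => ?_
    · rw [interior_Icc] at ht
      exact ht.1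
    · rw [interior_Icc] at ht
      have ht' : t ∈ Ico 0 τ := ⟨ht.1.le, ht.2⟩
      have h1 := hsign _ (hball t ht')
      rw [← hgf t (hmem t ht')] at h1
      have h2 := sq_nonneg ‖half (u t)‖
      linarith
  refine ⟨fun h0 => by simp [h0] at hpos, ?_, ?_⟩
  · have h1 := hanti ⟨le_rfl, hτ.le⟩ hττ hτ.le
    exact (le_of_sq_le_sq h1 (norm_nonneg _)).trans_lt (hmem 0 ⟨le_rfl, hτ⟩).2.1
  by_contra! hcon
  have hpow : ∀ t, ‖val (u t)‖ ^ (2 + 2 * p) = (‖val (u t)‖ ^ 2) ^ (1 + p) := fun t => by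
    rw [rpow_sq (norm_nonneg _)]
    ring_nf
  rw [hpow] at hcon
  have hmc : Continuous fun t => (‖val (u t)‖ ^ 2) ^ (1 + p) :=
    (Real.continuous_rpow_const (by positivity)).comp hψc
  have hχc : Continuous fun t =>
      -ν * ‖half (u t)‖ ^ 2 + 2 / 3 * ν * K₁ * (‖val (u t)‖ ^ 2) ^ (1 + p) :=
    (continuous_const.mul hZc).add (continuous_const.mul hmc)
  -- Where `|A^{1/2}u|² ≥ K₁|u|^{2+2p}`, the dissipation bound is at most `-νK₁|u|^{2+2p}/3`; by
  -- continuity it stays negative just before `τ`.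
  have hχτ : -ν * ‖half (u τ)‖ ^ 2 + 2 / 3 * ν * K₁ * (‖val (u τ)‖ ^ 2) ^ (1 + p) < 0 := by
    have h1 : 0 < (‖val (u τ)‖ ^ 2) ^ (1 + p) := by positivity
    have h2 := mul_le_mul_of_nonneg_left hcon hν.le
    have h3 : 0 < ν * (K₁ * (‖val (u τ)‖ ^ 2) ^ (1 + p)) := by positivity
    linarith
  obtain ⟨l, hl, hlχ⟩ : ∃ l < τ, ∀ t ∈ Ioc l τ,
      -ν * ‖half (u t)‖ ^ 2 + 2 / 3 * ν * K₁ * (‖val (u t)‖ ^ 2) ^ (1 + p) < 0 := by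
    have h1 := hχc.continuousAt.eventually (gt_mem_nhds hχτ)
    exact exists_Ioc_subset_of_mem_nhds h1 ⟨τ - 1, by linarith⟩
  obtain ⟨s, hs1, hs2⟩ := exists_between (max_lt hl hτ)
  have hs0 : 0 < s := (le_max_right l 0).trans_lt hs1
  have hls : l < s := (le_max_left l 0).trans_lt hs1
  have hsτ : s ∈ Icc 0 τ := ⟨hs0.le, hs2.le⟩
  obtain ⟨a, ha2, ha, -, hhalf⟩ := h.exists_strong hA hA0 hg hu hτ.le
  have hg2 : MemLp g 2 (volume.restrict (Ioc 0 τ)) := by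
    rw [memLp_two_iff_integrable_sq_norm hg.aestronglyMeasurable]
    exact ((hg.norm.pow 2).integrableOn_Icc).mono_set Ioc_subset_Icc_self
  have hki : Integrable (fun s => 2 * ⟪a s, g s - a s⟫) (volume.restrict (Ioc 0 τ)) :=
    (integrable_inner_of_memLp ha2 (hg2.sub ha2)).const_mul 2
  have hiτ := intervalIntegrable_of_integrable_restrict hki hττ
  have his := intervalIntegrable_of_integrable_restrict hki hsτ
  have hZ : ‖half (u τ)‖ ^ 2 - ‖half (u s)‖ ^ 2 = ∫ x in s..τ, 2 * ⟪a x, g x - a x⟫ := by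
    rw [hhalf τ hττ, hhalf s hsτ, add_sub_add_left_eq_sub,
      intervalIntegral.integral_interval_sub_left hiτ his]
  set φ : ℝ → ℝ := fun t =>
    K₁ * ((2 * ⟪val (u t), g t⟫ - 2 * ‖half (u t)‖ ^ 2) * (1 + p) * (‖val (u t)‖ ^ 2) ^ p)
  have hφc : Continuous φ := by
    refine continuous_const.mul ((((continuous_const.mul
      ((continuous_val.comp hu).inner hg)).sub (continuous_const.mul hZc)).mul
      continuous_const).mul ?_)
    exact (Real.continuous_rpow_const hp.le).comp hψc
  have hmder : ∀ t ∈ uIcc s τ,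
      HasDerivAt (fun t => K₁ * (‖val (u t)‖ ^ 2) ^ (1 + p)) (φ t) t := by
    intro t ht
    rw [uIcc_of_le hs2.le] at ht
    have h1 := ((h.hasDerivAt_norm_sq_val hA hA0 hg hu (hs0.trans_le ht.1)).rpow_const
      (p := 1 + p) (Or.inr (by linarith))).const_mul K₁
    rwa [add_sub_cancel_left] at h1
  have hM := intervalIntegral.integral_eq_sub_of_hasDerivAt hmder (hφc.intervalIntegrable _ _)
  -- `|A^{1/2}u|²` is only absolutely continuous, so its growth is compared with that of
  -- `K₁|u|^{2+2p}` through integrals. The strict inequality at `s` then persists at `τ`, a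
  -- contradiction.
  have hle : ∫ x in s..τ, 2 * ⟪a x, g x - a x⟫ ≤ ∫ x in s..τ, φ x := by
    rw [intervalIntegral.integral_of_le hs2.le, intervalIntegral.integral_of_le hs2.le]
    have hsub : Ioc s τ ⊆ Ioc 0 τ := Ioc_subset_Ioc_left hs0.le
    refine setIntegral_mono_ae_restrict (IntegrableOn.mono_set hki hsub)
      ((hφc.integrableOn_Icc).mono_set Ioc_subset_Icc_self) ?_
    have hne : ∀ᵐ x ∂(volume.restrict (Ioc s τ)), x ∈ Ioo s τ := by
      rw [← Measure.restrict_congr_set (Ioo_ae_eq_Ioc (a := s) (b := τ) (μ := volume))]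
      exact ae_restrict_mem measurableSet_Ioo
    filter_upwards [ae_restrict_of_ae_restrict_of_subset hsub ha, hne] with x hax hx
    have hx' : x ∈ Ico 0 τ := ⟨(hs0.trans hx.1).le, hx.2⟩
    obtain ⟨y, hy, hy'⟩ := A.mem_graph_iff.1 hax
    have h1 := hAν y (u x) hy.symm
    have hy'' : A y = a x := hy'
    rw [hy''] at h1
    have h2 := dissipation_le_of_mem_slowSet hσ hp hν hK₀ hK₁ hK₁' (hmem x hx') h1 (hgle x hx')
    have h3 := hlχ x ⟨hls.trans hx.1, hx.2.le⟩
    simp only [φ]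
    linarith
  have hfin := (hmem s ⟨hs0.le, hs2⟩).2.2
  rw [hpow] at hfin
  linarith

/-- The region is open, so a first exit time would be attained outside it, against the preceding
lemma. -/
theorem mem_slowSet_of_nonneg (h0 : u 0 ∈ slowSet A p σ K₁) {t : ℝ} (ht : 0 ≤ t) :
    u t ∈ slowSet A p σ K₁ := by
  by_contra hcon
  set S : Set ℝ := Ici 0 ∩ u ⁻¹' (slowSet A p σ K₁)ᶜ
  have hScl : IsClosed S :=
    isClosed_Ici.inter ((isOpen_slowSet hp σ K₁).isClosed_compl.preimage hu)
  have hSbdd : BddBelow S := ⟨0, fun x hx => hx.1⟩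
  have hmem : sInf S ∈ S := hScl.csInf_mem ⟨t, ht, hcon⟩ hSbdd
  have hpos : 0 < sInf S := by
    refine lt_of_le_of_ne hmem.1 fun heq => hmem.2 ?_
    rw [← heq]
    exact h0
  refine hmem.2 (mem_slowSet_of_forall_lt hA hA0 hσ hν hp hq hr hrR hK₀ hK₁ hK₁' hAν hf hsign
    hg hu h hgf hpos fun s hs => ?_)
  by_contra hs'
  exact absurd (csInf_le hSbdd ⟨hs.1, hs'⟩) (not_le.2 hs.2)

end Invariance

end SlowSolutions

namespace SlowSolutions

open HalfDomain

variable {H : Type*} [NormedAddCommGroup H] [InnerProductSpace ℝ H] [CompleteSpace H]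
  {A : H →ₗ.[ℝ] H}

/-! ### Initial data from the kernel, and the conclusion. -/

theorem slowSet_nonempty (hA : IsSelfAdjoint A) (hA0 : IsNonneg A)
    (hker : ∃ x : A.domain, x ≠ 0 ∧ A x = 0) {p σ K₁ : ℝ} (hσ : 0 < σ) (hK₁ : 0 < K₁) :
    (slowSet A p σ K₁).Nonempty := by
  obtain ⟨x, hx0, hx⟩ := hker
  have hmem := A.mem_graph x
  rw [hx] at hmem
  obtain ⟨v, hv, -⟩ := exists_val_of_mem_graph hA hA0 hmem
  rw [← hv] at hmem
  have hhalf := half_eq_zero_of_mem_graph hA hA0 hmem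
  have hv0 : v ≠ 0 := by
    rintro rfl
    exact hx0 (Subtype.ext (by rw [← hv, map_zero]; rfl))
  have hpos := norm_val_pos hv0
  -- A kernel vector is annihilated by `A^{1/2}`; it is rescaled to length `σ/2`.
  have hc : 0 < σ / (2 * ‖val v‖) := by positivity
  have hnorm : ‖val ((σ / (2 * ‖val v‖)) • v)‖ = σ / 2 := by
    rw [map_smul, norm_smul, Real.norm_of_nonneg hc.le]
    field_simp
  refine ⟨(σ / (2 * ‖val v‖)) • v, smul_ne_zero hc.ne' hv0, ?_, ?_⟩
  · rw [hnorm]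
    linarith
  · rw [hnorm, map_smul, hhalf, smul_zero, norm_zero, sq, zero_mul]
    positivity

end SlowSolutions

theorem theorem2p2 {H : Type*} [NormedAddCommGroup H] [InnerProductSpace ℝ H] [CompleteSpace H]
    (A : H →ₗ.[ℝ] H) (hA : IsSelfAdjoint A) (hA0 : SlowSolutions.IsNonneg A)
    (hker : ∃ x : A.domain, x ≠ 0 ∧ A x = 0)
    (ν : ℝ) (hν : 0 < ν)
    (hAν : ∀ (x : A.domain) (v : SlowSolutions.HalfDomain A), v.val = (x : H) →
      ν * ‖v.half‖ ^ 2 ≤ ‖A x‖ ^ 2)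
    (R : ℝ) (hR : 0 < R) (f : SlowSolutions.HalfDomain A → H)
    (L : ℝ)
    (hfL : ∀ u ∈ Metric.ball (0 : SlowSolutions.HalfDomain A) R,
      ∀ v ∈ Metric.ball (0 : SlowSolutions.HalfDomain A) R, ‖f u - f v‖ ≤ L * ‖u - v‖)
    (p q K₀ : ℝ) (hp : 0 < p) (hq : 0 < q) (hK₀ : 0 ≤ K₀)
    (hf : ∀ u ∈ Metric.ball (0 : SlowSolutions.HalfDomain A) R,
      ‖f u‖ ≤ K₀ * (‖u.val‖ ^ (1 + p) + ‖u.half‖ ^ (1 + q)))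
    (hsign : ∀ u ∈ Metric.ball (0 : SlowSolutions.HalfDomain A) R, inner ℝ u.val (f u) ≤ 0)
    (K₁ : ℝ) (hK₁ : 0 < K₁) (hK₁' : 4 * K₀ ^ 2 * (3 + 2 * p) / ν ≤ K₁) :
    ∃ σ₀ : ℝ, 0 < σ₀ ∧
      (SlowSolutions.slowSet A p σ₀ K₁).Nonempty ∧
      IsOpen (SlowSolutions.slowSet A p σ₀ K₁) ∧
      SlowSolutions.slowSet A p σ₀ K₁ ⊆ Metric.ball 0 R ∧
      ∀ u₀ ∈ SlowSolutions.slowSet A p σ₀ K₁,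
        ∃ u : ℝ → SlowSolutions.HalfDomain A,
          (∀ T : ℝ, 0 < T → SlowSolutions.IsSolutionOn A R f T u₀ u) ∧
          (∀ (T : ℝ) (v : ℝ → SlowSolutions.HalfDomain A), 0 < T →
            SlowSolutions.IsSolutionOn A R f T u₀ v → Set.EqOn v u (Set.Icc 0 T)) ∧
          ∃ M₁ : ℝ, 0 < M₁ ∧ ∀ t : ℝ, 0 ≤ t → M₁ / (1 + t) ^ (1 / p) ≤ ‖(u t).val‖ := by
  open SlowSolutions SlowSolutions.HalfDomain in
  -- The retraction lands in a closed ball, which must fit inside the open ball where `f` is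
  -- controlled; hence the radius `R / 2`.
  have hr : 0 < R / 2 := by positivity
  have hrR : R / 2 ≤ R := by linarith
  obtain ⟨σ, hσ⟩ := exists_isSmall (K₀ := K₀) (K₁ := K₁) hν hp hq hr
  have hball : ∀ v ∈ slowSet A p σ K₁, ‖v‖ < R / 2 := fun v hv =>
    norm_lt_of_mem_slowSet hσ hp hr hK₁ hv
  refine ⟨σ, hσ.pos, slowSet_nonempty hA hA0 hker hσ.pos hK₁, isOpen_slowSet hp σ K₁,
    fun v hv => mem_ball_zero_iff.2 ((hball v hv).trans_le hrR), fun u₀ hu₀ => ?_⟩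
  let F : HalfDomain A → H := fun v => f (radialRetraction (R / 2) v)
  have hmemball : ∀ v : HalfDomain A,
      radialRetraction (R / 2) v ∈ Metric.ball (0 : HalfDomain A) R := fun v =>
    mem_ball_zero_iff.2 ((norm_radialRetraction_le hr v).trans_lt (by linarith))
  have hF : ∀ v w, ‖F v - F w‖ ≤ (|L| * 2) * ‖v - w‖ := by
    intro v w
    refine (hfL _ (hmemball v) _ (hmemball w)).trans ?_
    rw [mul_assoc]
    exact mul_le_mul (le_abs_self L) (norm_radialRetraction_sub_le hr v w) (norm_nonneg _)
      (abs_nonneg L)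
  have hFc : Continuous F := (LipschitzWith.of_dist_le' (K := |L| * 2) fun v w => by
    simpa only [dist_eq_norm] using hF v w).continuous
  have hFf : ∀ v ∈ slowSet A p σ K₁, F v = f v := fun v hv => by
    simp only [F, radialRetraction_of_norm_le hr (hball v hv).le]
  obtain ⟨u, hu, hu0, hweak⟩ := exists_global_weakSol hA hA0 hF u₀
  have hg : Continuous fun t => F (u t) := hFc.comp hu
  have hmem : ∀ t, 0 ≤ t → u t ∈ slowSet A p σ K₁ := fun t ht =>
    mem_slowSet_of_nonneg hA hA0 hσ hν hp hq hr hrR hK₀ hK₁ hK₁' hAν hf hsign hg hu hweak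
      (fun t ht => hFf _ ht) (hu0 ▸ hu₀) ht
  have hsol : ∀ T : ℝ, 0 < T → IsSolutionOn A R f T u₀ u := by
    intro T hT
    have := hweak.isSolutionOn hA hA0 (R := R) (f := f) hg hu hT.le
      (fun t ht => mem_ball_zero_iff.2 ((hball _ (hmem t ht.1)).trans_le hrR))
      (fun t ht => hFf _ (hmem t ht.1))
    rwa [hu0] at this
  refine ⟨u, hsol, fun T v hT hv => hv.eqOn hA hA0 hT.le hfL (hsol T hT), ?_⟩
  set m := max ((‖val (u 0)‖ ^ 2) ^ (-(p / 2))) (p / 2 * (4 * K₀ + 2 * K₁))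
  have hm : 0 < m := lt_max_of_lt_left
    (Real.rpow_pos_of_pos (pow_pos (norm_val_pos (hmem 0 le_rfl).1) 2) _)
  -- The square root of the constant in the lower bound for `|u|²`.
  refine ⟨m ^ (-(1 / p)), by positivity, fun t ht => ?_⟩
  -- Any `τ > 0` with `τ ≥ t` would do; `t + 1` covers `t = 0`.
  have h1 := lower_bound_of_mem_slowSet hA hA0 hσ hp hq hr hrR hK₀ hK₁ hf hg hu hweak
    (fun t ht => hFf _ ht) (τ := t + 1) (by linarith) (fun s hs => hmem s hs.1)
    ⟨ht, by linarith⟩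
  have h1t : 0 < 1 + t := by linarith
  refine le_of_sq_le_sq (le_trans (le_of_eq ?_) h1) (norm_nonneg _)
  rw [div_pow, ← Real.rpow_two, ← Real.rpow_two, ← Real.rpow_mul hm.le, ← Real.rpow_mul h1t.le,
    show -(1 / p) * 2 = -(2 / p) by ring, show 1 / p * 2 = 2 / p by ring]
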